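/- Let $d\ge 2$ be an integer, $p>d$ real, $\beta=\frac{p-d}{2d(p-1)}$ and $f_0=(p-1)^{-1/(p-1)}$. Consider the profile problem $$\frac{1}{z^{d-1}}|f'|^{d-1}f''-\beta f'z-\frac{1}{p-1}f+|f|^{p-1}f=0,\quad f'\le 0 \ \text{ for } z>0;\qquad f'(0)=0,\ f(+\infty)=0, \tag{1}$$ where a solution is a nonnegative $f\in C^1([0,\infty))$ such that $|f'|^{d-1}f'$ is differentiable on $(0,\infty)$ and (1) holds there with $|f'|^{d-1}f''$ read as $\frac1d(|f'|^{d-1}f')'$, and such that, wherever $f'\neq0$, $f$ is twice differentiable and (1) holds literally. Then (1) admits two solutions $F^P$ and $F^Q$, strictly positive on $[0,\infty)$, such that, for some constants $C^P,C^Q>0$, $$F^P(z)=C^P z^{-\frac{2d}{p-d}}(1+o(1)),\qquad F^Q(z)=C^Q z^{-\frac{2d}{p-d}}(1+o(1))\qquad (z\to+\infty),$$ and: (i) $(F^P)'(z)<0$ for all $z>0$ (so $F^P$ is strictly decreasing), and $F^P(0)>f_0$; (ii) for some $a_0>0$, $F^Q\equiv f_0$ on $[0,a_0]$, $$F^Q(z)=f_0-\frac{d-1}{d}\big((d-1)\beta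 a_0^{d}\big)^{\frac1{d-1}}(z-a_0)_+^{\frac d{d-1}}(1+o(1))\qquad (z\to a_0)$$ (for $d=2$ this reads $f_0-\frac12\beta a_0^2(z-a_0)_+^2(1+o(1))$), and $F^Q$ is $C^\infty$ with $(F^Q)'<0$ on $(a_0,\infty)$. Both profiles give single-point blow-up: for $(F,C)=(F^P,C^P)$ or $(F^Q,C^Q)$ and every $T\in\mathbb R$, the function $u_S(r,t)=(T-t)^{-\frac1{p-1}}F\big(r/(T-t)^{\beta}\big)$ is, for $r>0$, $t<T$, a radially nonincreasing solution of $$u_t=(-1)^{d-1}\frac1{r^{d-1}}(u_r)^{d-1}u_{rr}+|u|^{p-1}u,\qquad u_r=0 \text{ at } r=0$$ (with $(u_r)^{d-1}u_{rr}$ read as $\frac1d((u_r)^d)_r$); the blow-up set of $u_S(|x|,t)$, $x\in\mathbb R^d$, at time $T$, that is, the set of $x$ for which there are $x_n\to x$, $t_n\to T$ with $t_n<T$ and $|u_S(|x_n|,t_n)|\to\infty$, equals $\{0\}$; and $u_S(r,t)\to C\,r^{-\frac{2d}{p-d}}$ as $t\to T^-$ for every $r>0$. -/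

import Mathlib

open Set Filter Topology Asymptotics

namespace MongeAmpere

/-- The similarity exponent `β = (p - d) / (2 d (p - 1))`. -/
noncomputable def beta (d : ℕ) (p : ℝ) : ℝ := (p - d) / (2 * d * (p - 1))

/-- The positive constant equilibrium `f₀ = (p - 1) ^ (-1 / (p - 1))` of the profile equation. -/
noncomputable def equilibrium (p : ℝ) : ℝ := (p - 1) ^ (-1 / (p - 1))

/-- The lower order part `- β f' z - f / (p - 1) + |f| ^ (p - 1) f` of the profile equation. -/
noncomputable def lowerOrder (d : ℕ) (p : ℝ) (f : ℝ → ℝ) (z : ℝ) : ℝ :=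
  -beta d p * deriv f z * z - 1 / (p - 1) * f z + |f z| ^ (p - 1) * f z

/-- The flux `|f'| ^ (d - 1) f'`; where `f'` is differentiable, its derivative is
`d |f'| ^ (d - 1) f''`. -/
noncomputable def flux (d : ℕ) (f : ℝ → ℝ) (z : ℝ) : ℝ := |deriv f z| ^ (d - 1) * deriv f z

/-- `f` (of which only the values on `[0, ∞)` matter) is a nonnegative monotone solution of
`z ^ (1 - d) |f'| ^ (d - 1) f'' - β f' z - f / (p - 1) + |f| ^ (p - 1) f = 0`, `f' ≤ 0` on `(0, ∞)`,
`f'(0) = f(+∞) = 0`.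

Solutions of this degenerate equation need not be twice differentiable where `f' = 0`. As usual for
`p`-Laplacian type equations, `f` is `C¹` and `|f'| ^ (d - 1) f''` is read in divergence form, as
`(|f'| ^ (d - 1) f')' / d`, on all of `(0, ∞)`; at the nondegenerate points, where `f' ≠ 0`, the
function is moreover twice differentiable and the equation holds literally. -/
structure IsProfile (d : ℕ) (p : ℝ) (f : ℝ → ℝ) : Prop where
  contDiffOn : ContDiffOn ℝ 1 f (Ici 0)
  nonneg : ∀ z, 0 ≤ z → 0 ≤ f z
  deriv_nonpos : ∀ z, 0 < z → deriv f z ≤ 0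
  deriv_zero : HasDerivWithinAt f 0 (Ici 0) 0
  tendsto_zero : Tendsto f atTop (𝓝 0)
  flux_differentiable : ∀ z, 0 < z → DifferentiableAt ℝ (flux d f) z
  equation : ∀ z, 0 < z →
    1 / z ^ (d - 1) * (deriv (flux d f) z / d) + lowerOrder d p f z = 0
  equation_classical : ∀ z, 0 < z → deriv f z ≠ 0 →
    DifferentiableAt ℝ (deriv f) z ∧
      1 / z ^ (d - 1) * (|deriv f z| ^ (d - 1) * deriv (deriv f) z) + lowerOrder d p f z = 0

/-- The self-similar function `u_S(r, t) = (T - t) ^ (-1 / (p - 1)) f(r / (T - t) ^ β)`, `t < T`,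
with profile `f` and blow-up time `T`. -/
noncomputable def similaritySolution (d : ℕ) (p T : ℝ) (f : ℝ → ℝ) (r t : ℝ) : ℝ :=
  (T - t) ^ (-1 / (p - 1)) * f (r / (T - t) ^ beta d p)

/-- `u(r, t)` solves the radial parabolic Monge-Ampère equation
`u_t = (-1) ^ (d - 1) r ^ (1 - d) (u_r) ^ (d - 1) u_rr + |u| ^ (p - 1) u` for `r > 0`, `t < T`,
where `u_r ≤ 0`, with the symmetry condition `u_r = 0` at `r = 0`. The second order term is in
divergence form: `(u_r) ^ (d - 1) u_rr = ((u_r) ^ d)_r / d`. -/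
structure IsRadialSolution (d : ℕ) (p T : ℝ) (u : ℝ → ℝ → ℝ) : Prop where
  symm : ∀ t, t < T → HasDerivWithinAt (fun r => u r t) 0 (Ici 0) 0
  differentiable_space : ∀ r t, 0 < r → t < T → DifferentiableAt ℝ (fun s => u s t) r
  deriv_nonpos : ∀ r t, 0 < r → t < T → deriv (fun s => u s t) r ≤ 0
  differentiable_time : ∀ r t, 0 < r → t < T → DifferentiableAt ℝ (fun τ => u r τ) t
  differentiable_flux : ∀ r t, 0 < r → t < T →
    DifferentiableAt ℝ (fun ρ => deriv (fun s => u s t) ρ ^ d) r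
  equation : ∀ r t, 0 < r → t < T →
    deriv (fun τ => u r τ) t =
      (-1) ^ (d - 1) * (1 / r ^ (d - 1)) *
          (deriv (fun ρ => deriv (fun s => u s t) ρ ^ d) r / d) +
        |u r t| ^ (p - 1) * u r t

/-- The blow-up set at time `T` of a radial function `u(|x|, t)`, `x ∈ ℝ^d`, `t < T`: the points
`x` for which `|u(|xₙ|, tₙ)| → ∞` along some sequences `xₙ → x`, `tₙ → T⁻`. -/
def blowUpSet (d : ℕ) (T : ℝ) (u : ℝ → ℝ → ℝ) : Set (EuclideanSpace ℝ (Fin d)) :=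
  {x | ∃ (y : ℕ → EuclideanSpace ℝ (Fin d)) (t : ℕ → ℝ),
    (∀ n, t n < T) ∧ Tendsto y atTop (𝓝 x) ∧ Tendsto t atTop (𝓝 T) ∧
      Tendsto (fun n => |u ‖y n‖ (t n)|) atTop atTop}

/-- For every `T`, the self-similar function with profile `f` is a radial solution for `t < T` that
blows up at time `T` at the origin only, with final-time profile `C r ^ (-2 d / (p - d))`. -/
structure GivesSinglePointBlowUp (d : ℕ) (p : ℝ) (f : ℝ → ℝ) (C : ℝ) : Prop where
  solution : ∀ T, IsRadialSolution d p T (similaritySolution d p T f)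
  blowUpSet_eq : ∀ T, blowUpSet d T (similaritySolution d p T f) = {0}
  final_profile : ∀ T r, 0 < r →
    Tendsto (fun t => similaritySolution d p T f r t) (𝓝[<] T)
      (𝓝 (C * r ^ (-(2 * d) / (p - d))))

/-- The coefficient `((d - 1) / d) ((d - 1) β a ^ d) ^ (1 / (d - 1))` of the expansion at the
interface `a`; for `d = 2` it is `β a ^ 2 / 2`. -/
noncomputable def interfaceCoeff (d : ℕ) (p a : ℝ) : ℝ :=
  ((d : ℝ) - 1) / d * (((d : ℝ) - 1) * beta d p * a ^ d) ^ (1 / ((d : ℝ) - 1))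

end MongeAmpere

/-! With `v = |f'| ^ d` the profile equation becomes the first order system `f' = -v ^ (1/d)`, `v' =
d z ^ (d-1) (β z v ^ (1/d) + h(f))`, where `h = reaction p` is negative on `(0, f₀)` and vanishes at
`f₀`. The root is not Lipschitz at `v = 0`; this is what lets a solution leave the equilibrium at an
interface, and it also destroys uniqueness there. Shooting is therefore carried out for a
regularized system, with the Lipschitz `regRoot` for the root and `v = δ > 0` at the start, and `δ →
0` afterwards.

Shooting: along a regularized trajectory `f` and `v` cannot both become negative
(`fst_pos_of_snd_neg`), since once `v < 0` the value of `f` is frozen in `(0, f₀)` and `v` never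
recovers. The two failures are thus disjoint open conditions on the data, and connectedness yields
data with neither, once the ends of a path of data are understood
(`exists_nonneg_regularizedSolution`). For `F^P` the parameter is the height `f(0) > f₀`, for `F^Q`
the interface position. For a large parameter the transport term beats the linear damping, so `v`
stays nonnegative. For a small parameter `f` stays nonnegative: otherwise `v ≥ 0` throughout, and
the virial identity for `v + d β z ^ d (f - f₀)` shows that a deviation `μ` below `f₀` at `z₀` must
satisfy `μ ≤ C z₀ ^ (σ/β)` (`exists_growth_bound`), while the data produce a deviation of order at
least `z₀ ^ (2d/(d-1))`. Because `2dβ < 1`, some `σ < 1` has `σ/β > 2d ≥ 2d/(d-1)`, which is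
impossible for small `z₀`.

Limit: all parameter bounds are independent of `δ`, so a nontrivial limit exists
(`exists_limitProfile`). There transport never dominates damping (`mul_rpow_le`), since otherwise
`v` would be nondecreasing forever and `f` would become negative. Hence `f z ^ γ` with `γ =
2d/(p-d)` is nondecreasing. It is bounded by a Gronwall argument for `f + v / (d β z ^ d)`, in which
transport cancels (`exists_mul_rpow_le`), so it has a positive limit. The interface expansion
follows from the one-sided derivative of `v ^ (1 - 1/d)`, and single-point blow-up from the scaling
of `f z ^ γ`. -/

namespace MongeAmpere

/-- The reaction term `x ^ p - x / (p - 1)` of the profile equation, for `x ≥ 0`. -/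
noncomputable def reaction (p x : ℝ) : ℝ := x ^ p - x / (p - 1)

/-! ### Exponents, the constant equilibrium and the reaction term -/

section Constants

variable {d : ℕ} {p : ℝ}

theorem one_lt_exponent (hd : 2 ≤ d) (hp : (d : ℝ) < p) : 1 < p := by
  have : (2 : ℝ) ≤ d := by exact_mod_cast hd
  linarith

theorem beta_pos (hd : 2 ≤ d) (hp : (d : ℝ) < p) : 0 < beta d p := by
  have h2 : (2 : ℝ) ≤ d := by exact_mod_cast hd
  unfold beta
  apply div_pos (by linarith)
  have : 0 < p - 1 := by linarith
  positivity

/-- This strict inequality is the margin on which shooting with small data rests: it leaves room for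
a slope `σ` with `2dβ < σ < 1`, where `1` is the slope of the reaction term at the equilibrium. -/
theorem two_mul_dim_mul_beta_lt_one (hd : 2 ≤ d) (hp : (d : ℝ) < p) :
    2 * d * beta d p < 1 := by
  have h2 : (2 : ℝ) ≤ d := by exact_mod_cast hd
  have h1 : 0 < p - 1 := by linarith
  have : 2 * d * beta d p = (p - d) / (p - 1) := by
    unfold beta
    field_simp
  rw [this, div_lt_one h1]
  linarith

theorem beta_lt_quarter (hd : 2 ≤ d) (hp : (d : ℝ) < p) : beta d p < 1 / 4 := by
  have h2 : (2 : ℝ) ≤ d := by exact_mod_cast hd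
  nlinarith [two_mul_dim_mul_beta_lt_one hd hp, beta_pos hd hp]

/-- The decay exponent is dictated by the balance of transport and damping, `β z f' = -f / (p - 1)`.
-/
theorem decayExponent_mul_beta (hd : 2 ≤ d) (hp : (d : ℝ) < p) :
    2 * d / (p - d) * beta d p = 1 / (p - 1) := by
  have h2 : (2 : ℝ) ≤ d := by exact_mod_cast hd
  have h1 : p - 1 ≠ 0 := by linarith
  have h3 : p - d ≠ 0 := by linarith
  unfold beta
  field_simp

theorem equilibrium_pos (hp : 1 < p) : 0 < equilibrium p :=
  Real.rpow_pos_of_pos (by linarith) _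

theorem equilibrium_rpow_sub_one (hp : 1 < p) : equilibrium p ^ (p - 1) = 1 / (p - 1) := by
  have h1 : 0 < p - 1 := by linarith
  unfold equilibrium
  rw [← Real.rpow_mul h1.le, div_mul_cancel₀ _ h1.ne', Real.rpow_neg_one, one_div]

theorem equilibrium_rpow (hp : 1 < p) : equilibrium p ^ p = equilibrium p / (p - 1) := by
  have h := equilibrium_rpow_sub_one hp
  rw [Real.rpow_sub_one (equilibrium_pos hp).ne', div_eq_iff (equilibrium_pos hp).ne'] at h
  rw [h]
  ring

theorem reaction_equilibrium (hp : 1 < p) : reaction p (equilibrium p) = 0 := by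
  unfold reaction
  rw [equilibrium_rpow hp]
  ring

/-- By convexity the reaction term lies above its tangent at the equilibrium, which has slope `1`;
Bernoulli's inequality is this tangent bound for `x ^ p`. -/
theorem sub_equilibrium_le_reaction (hp : 1 < p) {x : ℝ} (hx : 0 ≤ x) :
    x - equilibrium p ≤ reaction p x := by
  have h0 := equilibrium_pos hp
  have h1 : 0 < p - 1 := by linarith
  have key := one_add_mul_self_le_rpow_one_add (s := x / equilibrium p - 1) (p := p)
    (by have := div_nonneg hx h0.le; linarith) hp.le
  rw [add_sub_cancel, Real.div_rpow hx h0.le, equilibrium_rpow hp, le_div_iff₀ (by positivity)]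
    at key
  have : (1 + p * (x / equilibrium p - 1)) * (equilibrium p / (p - 1)) =
      x - equilibrium p + x / (p - 1) := by
    field_simp
    ring
  unfold reaction
  linarith

theorem reaction_eq_mul (x : ℝ) (hx : 0 < x) :
    reaction p x = x * (x ^ (p - 1) - 1 / (p - 1)) := by
  unfold reaction
  rw [Real.rpow_sub_one hx.ne']
  field_simp

theorem reaction_zero (hp : 1 < p) : reaction p 0 = 0 := by
  unfold reaction
  rw [Real.zero_rpow (by linarith)]
  simp

theorem neg_div_le_reaction {x : ℝ} (hx : 0 ≤ x) : -(x / (p - 1)) ≤ reaction p x := by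
  unfold reaction
  linarith [Real.rpow_nonneg hx p]

theorem reaction_neg (hp : 1 < p) {x : ℝ} (hx : 0 < x) (hx' : x < equilibrium p) :
    reaction p x < 0 := by
  rw [reaction_eq_mul x hx]
  refine mul_neg_of_pos_of_neg hx ?_
  rw [← equilibrium_rpow_sub_one hp]
  linarith [Real.rpow_lt_rpow hx.le hx' (show 0 < p - 1 by linarith)]

theorem reaction_nonneg (hp : 1 < p) {x : ℝ} (hx : equilibrium p ≤ x) : 0 ≤ reaction p x := by
  linarith [sub_equilibrium_le_reaction hp ((equilibrium_pos hp).le.trans hx)]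

theorem reaction_nonpos (hp : 1 < p) {x : ℝ} (hx : 0 ≤ x) (hx' : x ≤ equilibrium p) :
    reaction p x ≤ 0 := by
  rcases hx.eq_or_lt with rfl | h
  · exact (reaction_zero hp).le
  rcases hx'.eq_or_lt with rfl | h'
  · exact (reaction_equilibrium hp).le
  exact (reaction_neg hp h h').le

theorem continuous_reaction (hp : 1 < p) : Continuous (reaction p) := by
  unfold reaction
  exact (Real.continuous_rpow_const (by linarith)).sub (continuous_id.div_const _)

theorem hasDerivAt_reaction {x : ℝ} (hx : 0 < x) :
    HasDerivAt (reaction p) (p * x ^ (p - 1) - 1 / (p - 1)) x :=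
  (Real.hasDerivAt_rpow_const (Or.inl hx.ne')).sub ((hasDerivAt_id x).div_const _)

theorem hasDerivAt_reaction_equilibrium (hp : 1 < p) :
    HasDerivAt (reaction p) 1 (equilibrium p) := by
  have h1 : p - 1 ≠ 0 := by linarith
  convert hasDerivAt_reaction (p := p) (equilibrium_pos hp) using 1
  rw [equilibrium_rpow_sub_one hp]
  field_simp

/-- Near the equilibrium, the reaction term is close to its linearization. -/
theorem exists_abs_reaction_sub_le (hp : 1 < p) {ε : ℝ} (hε : 0 < ε) :
    ∃ η > 0, η < equilibrium p ∧ ∀ x, |x - equilibrium p| ≤ η →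
      |reaction p x - (x - equilibrium p)| ≤ ε * |x - equilibrium p| := by
  have h := (hasDerivAt_reaction_equilibrium hp).isLittleO.bound hε
  rw [Metric.eventually_nhds_iff] at h
  obtain ⟨r, hr, h⟩ := h
  have h0 := equilibrium_pos hp
  refine ⟨min (r / 2) (equilibrium p / 2), by positivity, ?_, fun x hx => ?_⟩
  · linarith [min_le_right (r / 2) (equilibrium p / 2)]
  · have := h (y := x) (by
      rw [Real.dist_eq]; linarith [min_le_left (r / 2) (equilibrium p / 2)])
    simpa [reaction_equilibrium hp, Real.norm_eq_abs] using this

/-- The reaction term with its argument truncated to `[0, B]`. -/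
noncomputable def truncReaction (p B x : ℝ) : ℝ := reaction p (max 0 (min x B))

theorem truncReaction_of_mem {B x : ℝ} (h0 : 0 ≤ x) (hB : x ≤ B) :
    truncReaction p B x = reaction p x := by
  unfold truncReaction
  rw [min_eq_left hB, max_eq_right h0]

theorem truncReaction_of_nonpos (hp : 1 < p) {B x : ℝ} (hB : 0 ≤ B) (hx : x ≤ 0) :
    truncReaction p B x = 0 := by
  unfold truncReaction
  rw [min_eq_left (hx.trans hB), max_eq_left hx, reaction_zero hp]

/-- The truncation is zero for negative arguments and nonnegative above the equilibrium, so a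
decrease of `v` caused by reaction alone locates `f`. -/
theorem mem_of_truncReaction_neg (hp : 1 < p) {B x : ℝ} (hB : equilibrium p ≤ B)
    (h : truncReaction p B x < 0) : 0 < x ∧ x < equilibrium p := by
  have h0 := equilibrium_pos hp
  constructor
  · by_contra! hx
    rw [truncReaction_of_nonpos hp (h0.le.trans hB) hx] at h
    exact h.false
  · by_contra! hx
    refine h.not_ge (reaction_nonneg hp ?_)
    exact le_max_of_le_right (le_min hx hB)

theorem truncReaction_nonneg (hp : 1 < p) {B x : ℝ} (hB : equilibrium p ≤ B)
    (hx : equilibrium p ≤ x) : 0 ≤ truncReaction p B x :=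
  reaction_nonneg hp (le_max_of_le_right (le_min hx hB))

theorem sub_equilibrium_le_truncReaction (hp : 1 < p) {B x : ℝ} (hB : equilibrium p ≤ B)
    (hx : x ≤ B) : x - equilibrium p ≤ truncReaction p B x := by
  have h0 := equilibrium_pos hp
  rcases le_total 0 x with h | h
  · rw [truncReaction_of_mem h hx]
    exact sub_equilibrium_le_reaction hp h
  · rw [truncReaction_of_nonpos hp (h0.le.trans hB) h]
    linarith

theorem neg_div_le_truncReaction (hp : 1 < p) {B x : ℝ} (hB : 0 ≤ B) (hx : x ≤ B) :
    -(max x 0 / (p - 1)) ≤ truncReaction p B x := by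
  rcases le_total 0 x with h | h
  · rw [truncReaction_of_mem h hx, max_eq_left h]
    exact neg_div_le_reaction h
  · rw [truncReaction_of_nonpos hp hB h, max_eq_right h]
    simp

theorem exists_abs_truncReaction_le (hp : 1 < p) (B : ℝ) :
    ∃ C > 0, ∀ x, |truncReaction p B x| ≤ C := by
  obtain ⟨C, hC⟩ := isCompact_Icc.exists_bound_of_continuousOn (s := Icc 0 (max 0 B))
    (continuous_reaction hp).continuousOn
  refine ⟨max C 1, by positivity, fun x => (hC _ ⟨le_max_left _ _, ?_⟩).trans (le_max_left _ _)⟩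
  exact max_le_max le_rfl (min_le_right _ _)

theorem exists_lipschitz_reaction (hp : 1 < p) (B : ℝ) :
    ∃ C ≥ 0, ∀ x ∈ Icc 0 B, ∀ y ∈ Icc 0 B,
      |reaction p x - reaction p y| ≤ C * |x - y| := by
  obtain ⟨C, hC⟩ := isCompact_Icc.exists_bound_of_continuousOn (s := Icc 0 B)
    (f := fun x : ℝ => p * x ^ (p - 1) - 1 / (p - 1))
    (((Real.continuous_rpow_const (by linarith)).const_mul _).sub continuous_const).continuousOn
  refine ⟨max C 0, le_max_right _ _, fun x hx y hy => ?_⟩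
  have := (convex_Icc (0 : ℝ) B).norm_image_sub_le_of_norm_hasDerivWithin_le
    (f := reaction p) (f' := fun x : ℝ => p * x ^ (p - 1) - 1 / (p - 1)) (C := max C 0)
    (fun x hx => ((Real.hasDerivAt_rpow_const (Or.inr hp.le)).sub
      ((hasDerivAt_id x).div_const _)).hasDerivWithinAt)
    (fun x hx => (hC x hx).trans (le_max_left _ _)) hy hx
  simpa [Real.norm_eq_abs] using this

theorem abs_trunc_sub_trunc_le (B x y : ℝ) :
    |max 0 (min x B) - max 0 (min y B)| ≤ |x - y| := by
  have h1 := abs_max_sub_max_le_abs (min x B) (min y B) 0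
  rw [max_comm 0, max_comm 0]
  refine h1.trans ((abs_min_sub_min_le_max x B y B).trans ?_)
  simp

theorem exists_lipschitz_truncReaction (hp : 1 < p) {B : ℝ} (hB : 0 ≤ B) :
    ∃ C ≥ 0, ∀ x y, |truncReaction p B x - truncReaction p B y| ≤ C * |x - y| := by
  obtain ⟨C, h0, hC⟩ := exists_lipschitz_reaction hp B
  refine ⟨C, h0, fun x y => (hC _ ⟨le_max_left _ _, max_le hB (min_le_right _ _)⟩ _
    ⟨le_max_left _ _, max_le hB (min_le_right _ _)⟩).trans ?_⟩
  refine mul_le_mul_of_nonneg_left ?_ h0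
  exact abs_trunc_sub_trunc_le B x y

end Constants

/-! ### Global flows of vector fields with sublinear growth -/

section Flow

open Metric NNReal

theorem hasDerivAt_fst_comp {E F : Type*} [NormedAddCommGroup E] [NormedSpace ℝ E]
    [NormedAddCommGroup F] [NormedSpace ℝ F] {f : ℝ → E × F} {f' : E × F} {x : ℝ}
    (h : HasDerivAt f f' x) : HasDerivAt (fun t => (f t).1) f'.1 x :=
  (ContinuousLinearMap.fst ℝ E F).hasFDerivAt.comp_hasDerivAt x h

theorem hasDerivAt_snd_comp {E F : Type*} [NormedAddCommGroup E] [NormedSpace ℝ E]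
    [NormedAddCommGroup F] [NormedSpace ℝ F] {f : ℝ → E × F} {f' : E × F} {x : ℝ}
    (h : HasDerivAt f f' x) : HasDerivAt (fun t => (f t).2) f'.2 x :=
  (ContinuousLinearMap.snd ℝ E F).hasFDerivAt.comp_hasDerivAt x h

/-- A vector field of sublinear growth that is Lipschitz on bounded sets has a flow on every bounded
time interval, which is continuous in the initial point. -/
theorem exists_flow_of_sublinear {E : Type*} [NormedAddCommGroup E] [NormedSpace ℝ E]
    [CompleteSpace E] {V : E → E} (hL : ∀ R : ℝ, ∃ K : ℝ≥0, LipschitzOnWith K V (closedBall 0 R))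
    {A B : ℝ} (hA : 0 ≤ A) (hB : 0 ≤ B) (hV : ∀ x, ‖V x‖ ≤ A + B * √‖x‖) {r T : ℝ} (hr : 0 ≤ r)
    (hT : 0 < T) :
    ∃ α : E → ℝ → E, (∀ x ∈ closedBall (0 : E) r, α x 0 = x ∧
      ∀ t ∈ Ioo (-T) T, HasDerivAt (α x) (V (α x t)) t) ∧
      ∀ t ∈ Ioo (-T) T, ContinuousOn (fun x => α x t) (closedBall 0 r) := by
  -- On the ball of radius `s ^ 2` the speed is at most `A + B s`. Since `s ^ 2` outgrows `(A + B s)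
  -- T`, this choice of `s` keeps trajectories from the ball of radius `r` inside up to time `T`.
  set s : ℝ := 1 + T * A + T * B + r with hs
  have hTA : 0 ≤ T * A := by positivity
  have hTB : 0 ≤ T * B := by positivity
  have hs1 : 1 ≤ s := by linarith
  have hs0 : 0 ≤ s := by linarith
  obtain ⟨K, hK⟩ := hL (s ^ 2)
  have key : (A + B * s) * T ≤ s ^ 2 - r := by nlinarith
  have hAB : 0 ≤ A + B * s := by positivity
  have hpl : IsPicardLindelof (fun _ => V) (tmin := -T) (tmax := T)
      ⟨0, by constructor <;> linarith⟩ (0 : E) ⟨s ^ 2, by positivity⟩ ⟨r, hr⟩ ⟨A + B * s, hAB⟩ K := by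
    refine ⟨fun t _ => hK, fun x _ => continuousOn_const, fun t _ x hx => ?_, ?_⟩
    · refine (hV x).trans ?_
      have hx' : ‖x‖ ≤ s ^ 2 := mem_closedBall_zero_iff.1 hx
      have : √‖x‖ ≤ s := Real.sqrt_le_iff.2 ⟨hs0, hx'⟩
      show A + B * √‖x‖ ≤ A + B * s
      gcongr
    · show (A + B * s) * max (T - 0) (0 - -T) ≤ s ^ 2 - r
      simpa using key
  obtain ⟨α, hα, L', hL'⟩ := hpl.exists_forall_mem_closedBall_eq_hasDerivWithinAt_lipschitzOnWith
  refine ⟨α, fun x hx => ⟨(hα x hx).1, fun t ht => ?_⟩, fun t ht => ?_⟩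
  · exact ((hα x hx).2 t (Ioo_subset_Icc_self ht)).hasDerivAt (Icc_mem_nhds ht.1 ht.2)
  · exact (hL' t (Ioo_subset_Icc_self ht)).continuousOn

/-- A real function that is bounded and Lipschitz on a set. -/
def BoundedLipschitzOn {E : Type*} [NormedAddCommGroup E] (s : Set E) (F : E → ℝ) : Prop :=
  ∃ B K : ℝ, 0 ≤ B ∧ 0 ≤ K ∧ (∀ x ∈ s, |F x| ≤ B) ∧ ∀ x ∈ s, ∀ y ∈ s, |F x - F y| ≤ K * ‖x - y‖

namespace BoundedLipschitzOn

variable {E : Type*} [NormedAddCommGroup E] {s : Set E} {F G : E → ℝ}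

theorem const (c : ℝ) : BoundedLipschitzOn s (fun _ => c) :=
  ⟨|c|, 0, abs_nonneg _, le_rfl, fun _ _ => le_rfl, by simp⟩

theorem add (hF : BoundedLipschitzOn s F) (hG : BoundedLipschitzOn s G) :
    BoundedLipschitzOn s (fun x => F x + G x) := by
  obtain ⟨B, K, hB, hK, h1, h2⟩ := hF
  obtain ⟨B', K', hB', hK', h1', h2'⟩ := hG
  refine ⟨B + B', K + K', by positivity, by positivity, fun x hx => ?_, fun x hx y hy => ?_⟩
  · exact (abs_add_le _ _).trans (add_le_add (h1 x hx) (h1' x hx))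
  · have : F x + G x - (F y + G y) = (F x - F y) + (G x - G y) := by ring
    rw [this, add_mul]
    exact (abs_add_le _ _).trans (add_le_add (h2 x hx y hy) (h2' x hx y hy))

theorem mul (hF : BoundedLipschitzOn s F) (hG : BoundedLipschitzOn s G) :
    BoundedLipschitzOn s (fun x => F x * G x) := by
  obtain ⟨B, K, hB, hK, h1, h2⟩ := hF
  obtain ⟨B', K', hB', hK', h1', h2'⟩ := hG
  refine ⟨B * B', B * K' + K * B', by positivity, by positivity, fun x hx => ?_,
    fun x hx y hy => ?_⟩
  · rw [abs_mul]
    exact mul_le_mul (h1 x hx) (h1' x hx) (abs_nonneg _) hB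
  · have : F x * G x - F y * G y = F x * (G x - G y) + (F x - F y) * G y := by ring
    rw [this]
    refine (abs_add_le _ _).trans ?_
    rw [abs_mul, abs_mul]
    have e1 := mul_le_mul (h1 x hx) (h2' x hx y hy) (abs_nonneg _) hB
    have e2 := mul_le_mul (h2 x hx y hy) (h1' y hy) (abs_nonneg _) (by positivity)
    linarith

theorem pow (hF : BoundedLipschitzOn s F) (n : ℕ) :
    BoundedLipschitzOn s (fun x => F x ^ n) := by
  induction n with
  | zero => simpa using const (s := s) 1
  | succ n ih => simpa [pow_succ] using ih.mul hF

end BoundedLipschitzOn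

end Flow

/-! ### The regularized root -/

section RegRoot

/-- A Lipschitz regularization of `v ↦ v ^ (1 / d)`: it agrees with this function for `v ≥ δ`, is
linear on `[0, δ]`, and vanishes for `v ≤ 0`. -/
noncomputable def regRoot (d : ℕ) (δ v : ℝ) : ℝ :=
  (max v δ) ^ (1 / (d : ℝ)) - δ ^ (1 / (d : ℝ)) +
    δ ^ (1 / (d : ℝ)) * (max 0 (min v δ) / δ)

variable {d : ℕ} {δ v w : ℝ}

theorem regRoot_of_le (hδ : 0 < δ) (hv : δ ≤ v) : regRoot d δ v = v ^ (1 / (d : ℝ)) := by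
  unfold regRoot
  rw [max_eq_left hv, min_eq_right hv, max_eq_right hδ.le, div_self hδ.ne']
  ring

theorem regRoot_of_nonpos (hδ : 0 < δ) (hv : v ≤ 0) : regRoot d δ v = 0 := by
  unfold regRoot
  rw [max_eq_right (hv.trans hδ.le), min_eq_left (hv.trans hδ.le), max_eq_left hv]
  simp

theorem regRoot_of_mem (h0 : 0 ≤ v) (hv : v ≤ δ) :
    regRoot d δ v = δ ^ (1 / (d : ℝ)) * (v / δ) := by
  unfold regRoot
  rw [max_eq_right hv, min_eq_left hv, max_eq_right h0]
  ring

theorem monotone_regRoot (hδ : 0 < δ) : Monotone (regRoot d δ) := by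
  intro v w h
  unfold regRoot
  gcongr

theorem regRoot_nonneg (hδ : 0 < δ) : 0 ≤ regRoot d δ v := by
  rcases le_total v 0 with h | h
  · exact (regRoot_of_nonpos hδ h).ge
  · exact (regRoot_of_nonpos hδ le_rfl).ge.trans (monotone_regRoot hδ h)

theorem regRoot_le (hδ : 0 < δ) : regRoot d δ v ≤ (max v δ) ^ (1 / (d : ℝ)) := by
  unfold regRoot
  have h1 : 0 ≤ δ ^ (1 / (d : ℝ)) := Real.rpow_nonneg hδ.le _
  have h2 : max 0 (min v δ) / δ ≤ 1 := by
    rw [div_le_one hδ]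
    exact max_le hδ.le (min_le_right _ _)
  nlinarith

/-- The error is uniform in `v`, so the regularization may be removed along sequences in which `v`
also varies. -/
theorem abs_regRoot_sub_le (hd : 2 ≤ d) (hδ : 0 < δ) :
    |regRoot d δ v - (max v 0) ^ (1 / (d : ℝ))| ≤ δ ^ (1 / (d : ℝ)) := by
  have h1 : 0 < δ ^ (1 / (d : ℝ)) := Real.rpow_pos_of_pos hδ _
  have hd' : (1 / (d : ℝ)) ≠ 0 := by
    have : (d : ℝ) ≠ 0 := by positivity
    positivity
  rcases le_total v 0 with h | h
  · rw [regRoot_of_nonpos hδ h, max_eq_right h, Real.zero_rpow hd']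
    simpa using h1.le
  rw [max_eq_left h]
  rcases le_total δ v with h' | h'
  · rw [regRoot_of_le hδ h']
    simpa using h1.le
  · rw [regRoot_of_mem h h']
    have h2 : v ^ (1 / (d : ℝ)) ≤ δ ^ (1 / (d : ℝ)) :=
      Real.rpow_le_rpow h h' (by positivity)
    have h3 := Real.rpow_nonneg h (1 / (d : ℝ))
    have h4 : v / δ ≤ 1 := (div_le_one hδ).2 h'
    have h5 : 0 ≤ v / δ := by positivity
    rw [abs_le]
    constructor <;> nlinarith

theorem regRoot_pos (hδ : 0 < δ) (hv : 0 < v) : 0 < regRoot d δ v := by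
  rcases le_total δ v with h' | h'
  · rw [regRoot_of_le hδ h']
    exact Real.rpow_pos_of_pos hv _
  · rw [regRoot_of_mem hv.le h']
    have := Real.rpow_pos_of_pos hδ (1 / (d : ℝ))
    positivity

theorem exists_lipschitz_regRoot (hd : 2 ≤ d) (hδ : 0 < δ) :
    ∃ C ≥ 0, ∀ v w, |regRoot d δ v - regRoot d δ w| ≤ C * |v - w| := by
  have hd2 : (2 : ℝ) ≤ d := by exact_mod_cast hd
  have hq0 : 0 ≤ 1 / (d : ℝ) := by positivity
  have hq1 : 1 / (d : ℝ) ≤ 1 := by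
    rw [div_le_one (by positivity)]
    linarith
  set c := δ ^ (1 / (d : ℝ)) with hc
  have hc0 : 0 < c := Real.rpow_pos_of_pos hδ _
  set e := δ ^ (1 / (d : ℝ) - 1) with he
  have he0 : 0 < e := Real.rpow_pos_of_pos hδ _
  have hroot : ∀ x ∈ Ici δ, ∀ y ∈ Ici δ,
      |x ^ (1 / (d : ℝ)) - y ^ (1 / (d : ℝ))| ≤ e * |x - y| := by
    intro x hx y hy
    have := (convex_Ici δ).norm_image_sub_le_of_norm_hasDerivWithin_le
      (f := fun x : ℝ => x ^ (1 / (d : ℝ)))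
      (f' := fun x : ℝ => 1 / (d : ℝ) * x ^ (1 / (d : ℝ) - 1)) (C := e)
      (fun x hx => (Real.hasDerivAt_rpow_const
        (Or.inl (hδ.trans_le hx).ne')).hasDerivWithinAt)
      (fun x hx => by
        have hx0 : 0 < x := hδ.trans_le hx
        rw [Real.norm_eq_abs, abs_of_nonneg (by positivity)]
        calc 1 / (d : ℝ) * x ^ (1 / (d : ℝ) - 1) ≤ 1 * x ^ (1 / (d : ℝ) - 1) := by gcongr
          _ = x ^ (1 / (d : ℝ) - 1) := one_mul _
          _ ≤ e := Real.rpow_le_rpow_of_nonpos hδ hx (by linarith)) hy hx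
    simpa [Real.norm_eq_abs] using this
  refine ⟨e + c / δ, by positivity, fun v w => ?_⟩
  have h1 := hroot (max v δ) (le_max_right v δ) (max w δ) (le_max_right w δ)
  have h2 := abs_max_sub_max_le_abs v w δ
  have h3 := abs_trunc_sub_trunc_le δ v w
  have h4 : regRoot d δ v - regRoot d δ w =
      ((max v δ) ^ (1 / (d : ℝ)) - (max w δ) ^ (1 / (d : ℝ))) +
        c / δ * (max 0 (min v δ) - max 0 (min w δ)) := by
    unfold regRoot
    ring
  rw [h4]
  refine (abs_add_le _ _).trans ?_
  rw [abs_mul, abs_of_nonneg (show 0 ≤ c / δ by positivity), add_mul]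
  refine add_le_add (h1.trans ?_) ?_
  · gcongr
  · gcongr

/-- For `d ≥ 2` the `d`-th root grows no faster than the square root, which is the growth admitted
by `exists_flow_of_sublinear`. -/
theorem regRoot_le_one_add_sqrt (hd : 2 ≤ d) (hδ : 0 < δ) (hδ1 : δ ≤ 1) :
    regRoot d δ v ≤ 1 + √|v| := by
  have hd2 : (2 : ℝ) ≤ d := by exact_mod_cast hd
  have hq0 : 0 ≤ 1 / (d : ℝ) := by positivity
  have hq1 : 1 / (d : ℝ) ≤ 1 / 2 := one_div_le_one_div_of_le (by norm_num) hd2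
  refine (regRoot_le hδ).trans ?_
  rcases le_total (max v δ) 1 with h | h
  · have := Real.rpow_le_one (hδ.le.trans (le_max_right v δ)) h hq0
    linarith [Real.sqrt_nonneg |v|]
  · have h1 : (max v δ) ^ (1 / (d : ℝ)) ≤ (max v δ) ^ (1 / 2 : ℝ) :=
      Real.rpow_le_rpow_of_exponent_le h hq1
    rw [← Real.sqrt_eq_rpow] at h1
    have h2 : max v δ ≤ max |v| 1 := max_le_max (le_abs_self v) hδ1
    have h3 : √(max v δ) ≤ √(max |v| 1) := Real.sqrt_le_sqrt h2
    have h4 : √(max |v| 1) ≤ 1 + √|v| := by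
      rcases max_choice |v| 1 with h | h <;> rw [h]
      · linarith
      · simp
    linarith

end RegRoot

/-- Solutions on `[a, b]` of the regularized first order system for the profile `f` and
`v = |f'| ^ d`. -/
structure IsRegularizedSolution (d : ℕ) (p δ B a b : ℝ) (f v : ℝ → ℝ) : Prop where
  hasDerivAt_fst : ∀ z ∈ Icc a b, HasDerivAt f (-regRoot d δ (v z)) z
  hasDerivAt_snd : ∀ z ∈ Icc a b, HasDerivAt v
    (d * z ^ (d - 1) * (beta d p * z * regRoot d δ (v z) + truncReaction p B (f z))) z

/-! ### Solvability of the regularized system -/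

section Existence

open Metric NNReal

variable {d : ℕ} {p δ B : ℝ}

/-- The regularized vector field in the variables `(z, f, v)`. -/
noncomputable def regField (d : ℕ) (p δ B Z : ℝ) (x : ℝ × ℝ × ℝ) : ℝ × ℝ × ℝ :=
  (1, -regRoot d δ x.2.2, d * (max 0 (min x.1 Z)) ^ (d - 1) *
    (beta d p * max 0 (min x.1 Z) * regRoot d δ x.2.2 + truncReaction p B x.2.1))

theorem exists_lipschitzOnWith_regField (hd : 2 ≤ d) (hp : (d : ℝ) < p) (hδ : 0 < δ)
    (hδ1 : δ ≤ 1) (hB : 0 ≤ B) {Z : ℝ} (hZ : 0 ≤ Z) (R : ℝ) :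
    ∃ K : ℝ≥0, LipschitzOnWith K (regField d p δ B Z) (closedBall 0 R) := by
  obtain ⟨Cr, hCr0, hCr⟩ := exists_lipschitz_regRoot hd hδ
  obtain ⟨Ch, hCh0, hCh⟩ := exists_lipschitz_truncReaction (one_lt_exponent hd hp) hB
  obtain ⟨Bh, hBh0, hBh⟩ := exists_abs_truncReaction_le (one_lt_exponent hd hp) B
  set s : Set (ℝ × ℝ × ℝ) := closedBall 0 R
  have n1 : ∀ x : ℝ × ℝ × ℝ, |x.1| ≤ ‖x‖ := fun x => norm_fst_le x
  have n2 : ∀ x : ℝ × ℝ × ℝ, |x.2.1| ≤ ‖x‖ := fun x => (norm_fst_le x.2).trans (norm_snd_le x)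
  have n3 : ∀ x : ℝ × ℝ × ℝ, |x.2.2| ≤ ‖x‖ := fun x => (norm_snd_le x.2).trans (norm_snd_le x)
  have hz : BoundedLipschitzOn s (fun x => max 0 (min x.1 Z)) := by
    refine ⟨Z, 1, hZ, zero_le_one, fun x _ => ?_, fun x _ y _ => ?_⟩
    · rw [abs_of_nonneg (le_max_left _ _)]
      exact max_le hZ (min_le_right _ _)
    · rw [one_mul]
      exact (abs_trunc_sub_trunc_le Z x.1 y.1).trans (n1 (x - y))
  have hr : BoundedLipschitzOn s (fun x => regRoot d δ x.2.2) := by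
    refine ⟨1 + √R, Cr, by positivity, hCr0, fun x hx => ?_, fun x _ y _ => ?_⟩
    · rw [abs_of_nonneg (regRoot_nonneg hδ)]
      refine (regRoot_le_one_add_sqrt hd hδ hδ1).trans ?_
      gcongr
      exact (n3 x).trans (by simpa [s] using hx)
    · refine (hCr _ _).trans ?_
      gcongr
      exact n3 (x - y)
  have hh : BoundedLipschitzOn s (fun x => truncReaction p B x.2.1) := by
    refine ⟨Bh, Ch, hBh0.le, hCh0, fun x hx => hBh _, fun x _ y _ => ?_⟩
    refine (hCh _ _).trans ?_
    gcongr
    exact n2 (x - y)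
  have h3 := ((BoundedLipschitzOn.const (s := s) (d : ℝ)).mul (hz.pow (d - 1))).mul
    ((((BoundedLipschitzOn.const (s := s) (beta d p)).mul hz).mul hr).add hh)
  obtain ⟨_, K2, _, hK20, _, hK2⟩ := hr
  obtain ⟨_, K3, _, hK30, _, hK3⟩ := h3
  refine ⟨⟨max K2 K3, le_max_of_le_left hK20⟩, LipschitzOnWith.of_dist_le_mul fun x hx y hy => ?_⟩
  rw [dist_eq_norm, dist_eq_norm]
  show _ ≤ max K2 K3 * ‖x - y‖
  refine max_le ?_ (max_le ?_ ?_)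
  · have : 0 ≤ max K2 K3 * ‖x - y‖ := mul_nonneg (le_max_of_le_left hK20) (norm_nonneg _)
    simpa [regField] using this
  · have := (hK2 x hx y hy).trans
      (mul_le_mul_of_nonneg_right (le_max_left K2 K3) (norm_nonneg (x - y)))
    show |-regRoot d δ x.2.2 - -regRoot d δ y.2.2| ≤ _
    rw [show -regRoot d δ x.2.2 - -regRoot d δ y.2.2 =
      -(regRoot d δ x.2.2 - regRoot d δ y.2.2) by ring, abs_neg]
    exact this
  · exact (hK3 x hx y hy).trans
      (mul_le_mul_of_nonneg_right (le_max_right K2 K3) (norm_nonneg (x - y)))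

/-- Clamping `z` to `[0, Z]` and truncating the reaction bound every factor except the root, so only
square root growth remains. -/
theorem exists_norm_regField_le (hd : 2 ≤ d) (hp : (d : ℝ) < p) (hδ : 0 < δ)
    (hδ1 : δ ≤ 1) (B : ℝ) {Z : ℝ} (hZ : 0 ≤ Z) :
    ∃ A C : ℝ, 0 ≤ A ∧ 0 ≤ C ∧ ∀ x, ‖regField d p δ B Z x‖ ≤ A + C * √‖x‖ := by
  obtain ⟨Bh, hBh0, hBh⟩ := exists_abs_truncReaction_le (one_lt_exponent hd hp) B
  have hb := beta_pos hd hp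
  set c : ℝ := d * Z ^ (d - 1)
  have hc : 0 ≤ c := by positivity
  refine ⟨1 + c * (beta d p * Z + Bh), 1 + c * (beta d p * Z), by positivity, by positivity,
    fun x => ?_⟩
  have n3 : |x.2.2| ≤ ‖x‖ := (norm_snd_le x.2).trans (norm_snd_le x)
  have hr : regRoot d δ x.2.2 ≤ 1 + √‖x‖ :=
    (regRoot_le_one_add_sqrt hd hδ hδ1).trans (by gcongr)
  have hr0 : 0 ≤ regRoot d δ x.2.2 := regRoot_nonneg hδ
  have hs := Real.sqrt_nonneg ‖x‖
  have hm0 : 0 ≤ max 0 (min x.1 Z) := le_max_left _ _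
  have hmZ : max 0 (min x.1 Z) ≤ Z := max_le hZ (min_le_right _ _)
  have hP : 0 ≤ c * (beta d p * Z) := by positivity
  have hQ : 0 ≤ c * Bh := by positivity
  refine max_le ?_ (max_le ?_ ?_)
  · show ‖(1 : ℝ)‖ ≤ _
    rw [norm_one]
    nlinarith
  · show |-regRoot d δ x.2.2| ≤ _
    rw [abs_neg, abs_of_nonneg hr0]
    nlinarith
  · show |(d * (max 0 (min x.1 Z)) ^ (d - 1) *
      (beta d p * max 0 (min x.1 Z) * regRoot d δ x.2.2 + truncReaction p B x.2.1))| ≤ _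
    rw [abs_mul, abs_of_nonneg (by positivity : 0 ≤ d * (max 0 (min x.1 Z)) ^ (d - 1))]
    have h1 : |beta d p * max 0 (min x.1 Z) * regRoot d δ x.2.2 + truncReaction p B x.2.1| ≤
        beta d p * Z * (1 + √‖x‖) + Bh := by
      refine (abs_add_le _ _).trans (add_le_add ?_ (hBh _))
      rw [abs_of_nonneg (by positivity)]
      gcongr
    calc _ ≤ c * (beta d p * Z * (1 + √‖x‖) + Bh) := by
          exact mul_le_mul (mul_le_mul_of_nonneg_left (pow_le_pow_left₀ hm0 hmZ _)
            (Nat.cast_nonneg d)) h1 (abs_nonneg _) hc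
      _ ≤ _ := by nlinarith

/-- The regularized system has solutions of any length, which depend continuously on the initial
position `a` and the initial height `M`. -/
theorem exists_regularizedSolution (hd : 2 ≤ d) (hp : (d : ℝ) < p) (hδ : 0 < δ) (hδ1 : δ ≤ 1)
    (hB : 0 ≤ B) {R T : ℝ} (hR : 1 ≤ R) (hT : 0 ≤ T) :
    ∃ f v : ℝ × ℝ → ℝ → ℝ,
      (∀ x ∈ Icc (0 : ℝ) R ×ˢ Icc (0 : ℝ) R, f x x.1 = x.2 ∧ v x x.1 = δ ∧
        IsRegularizedSolution d p δ B x.1 (x.1 + T) (f x) (v x)) ∧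
      ∀ τ ∈ Icc (0 : ℝ) T,
        ContinuousOn (fun x => f x (x.1 + τ)) (Icc (0 : ℝ) R ×ˢ Icc (0 : ℝ) R) ∧
        ContinuousOn (fun x => v x (x.1 + τ)) (Icc (0 : ℝ) R ×ˢ Icc (0 : ℝ) R) := by
  have hZ : 0 ≤ R + T := by linarith
  obtain ⟨A, C, hA, hC, hV⟩ := exists_norm_regField_le hd hp hδ hδ1 B hZ
  obtain ⟨α, hα, hαc⟩ := exists_flow_of_sublinear
    (exists_lipschitzOnWith_regField hd hp hδ hδ1 hB hZ) hA hC hV (r := R) (T := T + 1)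
    (by linarith) (by linarith)
  -- The position `z` is a coordinate of the autonomous system, so continuity of one flow in its
  -- initial point covers both the starting position and the height.
  set ι : ℝ × ℝ → ℝ × ℝ × ℝ := fun x => (x.1, x.2, δ) with hι
  have hmem : ∀ x ∈ Icc (0 : ℝ) R ×ˢ Icc (0 : ℝ) R, ι x ∈ closedBall (0 : ℝ × ℝ × ℝ) R := by
    rintro x ⟨⟨h1, h2⟩, h3, h4⟩
    rw [mem_closedBall, dist_zero_right]
    refine max_le ?_ (max_le ?_ ?_)
    · exact abs_le.2 ⟨by linarith, h2⟩
    · exact abs_le.2 ⟨by linarith, h4⟩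
    · exact abs_le.2 ⟨by linarith, hδ1.trans hR⟩
  have hsub : ∀ τ ∈ Icc (0 : ℝ) T, τ ∈ Ioo (-(T + 1)) (T + 1) := fun τ hτ =>
    ⟨by linarith [hτ.1], by linarith [hτ.2]⟩
  refine ⟨fun x z => (α (ι x) (z - x.1)).2.1, fun x z => (α (ι x) (z - x.1)).2.2,
    fun x hx => ?_, fun τ hτ => ?_⟩
  · obtain ⟨h0, h1⟩ := hα _ (hmem x hx)
    refine ⟨by simp only [sub_self, h0]; rfl, by simp only [sub_self, h0]; rfl, ?_⟩
    have hfst : ∀ t ∈ Icc (0 : ℝ) T, (α (ι x) t).1 = x.1 + t := by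
      intro t ht
      have hc : ∀ s ∈ Icc (0 : ℝ) T, HasDerivAt (fun t => (α (ι x) t).1 - t) 0 s := by
        intro s hs
        have h2 : HasDerivAt (fun t => (α (ι x) t).1) 1 s :=
          hasDerivAt_fst_comp (h1 s (hsub s hs))
        simpa using h2.fun_sub (hasDerivAt_id' s)
      have := constant_of_has_deriv_right_zero
        (fun s hs => (hc s hs).continuousAt.continuousWithinAt)
        (fun s hs => (hc s ⟨hs.1, hs.2.le⟩).hasDerivWithinAt) t ht
      simp only [h0, sub_zero] at this
      have h2 : (ι x).1 = x.1 := rfl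
      linarith
    have hz : ∀ z ∈ Icc x.1 (x.1 + T), z - x.1 ∈ Icc (0 : ℝ) T := fun z hz =>
      ⟨by linarith [hz.1], by linarith [hz.2]⟩
    have hder : ∀ z ∈ Icc x.1 (x.1 + T), HasDerivAt (fun z => α (ι x) (z - x.1))
        (regField d p δ B (R + T) (α (ι x) (z - x.1))) z := fun z hz' => by
      have := (h1 _ (hsub _ (hz z hz'))).scomp z ((hasDerivAt_id z).sub_const x.1)
      simpa [Function.comp_def] using this
    have hder2 : ∀ z ∈ Icc x.1 (x.1 + T), HasDerivAt (fun z => (α (ι x) (z - x.1)).2)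
        (regField d p δ B (R + T) (α (ι x) (z - x.1))).2 z := fun z hz' =>
      hasDerivAt_snd_comp (hder z hz')
    refine ⟨fun z hz' => hasDerivAt_fst_comp (hder2 z hz'), fun z hz' => ?_⟩
    have h2 : HasDerivAt (fun z => (α (ι x) (z - x.1)).2.2) _ z :=
      hasDerivAt_snd_comp (hder2 z hz')
    -- The clamp on `z` is inactive, because the first coordinate equals `z` and stays in `[0, R +
    -- T]`.
    have h3 : max 0 (min (α (ι x) (z - x.1)).1 (R + T)) = z := by
      rw [hfst _ (hz z hz')]
      have := hz'.1
      have := hz'.2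
      have := hx.1.1
      have := hx.1.2
      rw [min_eq_left (by linarith), max_eq_right (by linarith)]
      ring
    simp only [regField, h3] at h2
    exact h2
  · have hc : ContinuousOn (fun x => α (ι x) τ) (Icc (0 : ℝ) R ×ˢ Icc (0 : ℝ) R) :=
      (hαc τ (hsub τ hτ)).comp (by fun_prop) hmem
    constructor
    · simpa using hc.snd.fst
    · simpa using hc.snd.snd

end Existence

/-! ### Barrier and mean value arguments -/

section Barrier

/-- A continuous function that is positive at `a` and cannot vanish for the first time is positive
on all of `[a, b]`. -/
theorem pos_on_Icc_of_barrier {Q : ℝ → ℝ} {a b : ℝ} (hQ : ContinuousOn Q (Icc a b))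
    (ha : 0 < Q a) (hstep : ∀ t ∈ Ioc a b, (∀ s ∈ Ico a t, 0 < Q s) → Q t ≠ 0) :
    ∀ t ∈ Icc a b, 0 < Q t := by
  intro t ht
  by_contra! hneg
  set S := Icc a b ∩ Q ⁻¹' Iic 0 with hS
  have hSc : IsCompact S :=
    isCompact_Icc.of_isClosed_subset (hQ.preimage_isClosed_of_isClosed isClosed_Icc isClosed_Iic)
      inter_subset_left
  obtain ⟨t₀, ⟨⟨h1, h2⟩, h3⟩, hmin⟩ := hSc.exists_isLeast ⟨t, ht, hneg⟩
  have h3 : Q t₀ ≤ 0 := h3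
  have hpos : ∀ s ∈ Ico a t₀, 0 < Q s := by
    intro s hs
    by_contra! h
    exact hs.2.not_ge (hmin ⟨⟨hs.1, hs.2.le.trans h2⟩, h⟩)
  have hat : a < t₀ := by
    rcases h1.eq_or_lt with rfl | h
    · exact absurd ha h3.not_gt
    · exact h
  obtain ⟨c, hc, hc0⟩ := intermediate_value_Icc' h1 (hQ.mono (Icc_subset_Icc_right h2))
    (⟨h3, ha.le⟩ : (0 : ℝ) ∈ Icc (Q t₀) (Q a))
  have : t₀ ≤ c := hmin ⟨⟨hc.1, hc.2.trans h2⟩, hc0.le⟩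
  have hct : c = t₀ := le_antisymm hc.2 this
  exact hstep t₀ ⟨hat, h2⟩ hpos (hct ▸ hc0)

theorem monotoneOn_Icc_of_hasDerivAt {g g' : ℝ → ℝ} {a b : ℝ}
    (h : ∀ z ∈ Icc a b, HasDerivAt g (g' z) z) (h0 : ∀ z ∈ Ioo a b, 0 ≤ g' z) :
    MonotoneOn g (Icc a b) := by
  refine monotoneOn_of_deriv_nonneg (convex_Icc a b)
    (fun z hz => (h z hz).continuousAt.continuousWithinAt) ?_ ?_
  · rw [interior_Icc]
    exact fun z hz => (h z (Ioo_subset_Icc_self hz)).differentiableAt.differentiableWithinAt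
  · rw [interior_Icc]
    intro z hz
    rw [(h z (Ioo_subset_Icc_self hz)).deriv]
    exact h0 z hz

theorem antitoneOn_Icc_of_hasDerivAt {g g' : ℝ → ℝ} {a b : ℝ}
    (h : ∀ z ∈ Icc a b, HasDerivAt g (g' z) z) (h0 : ∀ z ∈ Ioo a b, g' z ≤ 0) :
    AntitoneOn g (Icc a b) := by
  have := monotoneOn_Icc_of_hasDerivAt (g := fun z => -g z) (fun z hz => (h z hz).fun_neg)
    (fun z hz => neg_nonneg.2 (h0 z hz))
  exact fun x hx y hy hxy => neg_le_neg_iff.1 (this hx hy hxy)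

/-- Mean value inequality: a lower bound for the increment. -/
theorem le_sub_of_hasDerivAt {g g' : ℝ → ℝ} {a b c : ℝ} (hab : a ≤ b)
    (h : ∀ z ∈ Icc a b, HasDerivAt g (g' z) z) (h0 : ∀ z ∈ Ioo a b, c ≤ g' z) :
    c * (b - a) ≤ g b - g a := by
  have := monotoneOn_Icc_of_hasDerivAt (g := fun z => g z - c * z) (g' := fun z => g' z - c * 1)
    (fun z hz => (h z hz).fun_sub ((hasDerivAt_id' z).const_mul c))
    (fun z hz => by linarith [h0 z hz]) (left_mem_Icc.2 hab) (right_mem_Icc.2 hab) hab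
  simp only at this
  linarith

/-- Mean value inequality: an upper bound for the increment. -/
theorem sub_le_of_hasDerivAt {g g' : ℝ → ℝ} {a b c : ℝ} (hab : a ≤ b)
    (h : ∀ z ∈ Icc a b, HasDerivAt g (g' z) z) (h0 : ∀ z ∈ Ioo a b, g' z ≤ c) :
    g b - g a ≤ c * (b - a) := by
  have := le_sub_of_hasDerivAt (g := fun z => -g z) (c := -c) hab (fun z hz => (h z hz).fun_neg)
    (fun z hz => neg_le_neg (h0 z hz))
  linarith

/-- Once the transport term dominates the linear damping, it does so until the end, and `v` is
nondecreasing. -/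
theorem monotoneOn_of_transport_dominates {d : ℕ} {p z₁ b : ℝ} {f v H ρ : ℝ → ℝ} (hp : 1 < p)
    {β : ℝ} (hβ : 0 < β) (hρ : Monotone ρ) (hρc : Continuous ρ) (hρ0 : ∀ x, 0 ≤ ρ x)
    (hz₁ : 0 < z₁) (hf : ∀ z ∈ Icc z₁ b, HasDerivAt f (-ρ (v z)) z)
    (hv : ∀ z ∈ Icc z₁ b, HasDerivAt v (d * z ^ (d - 1) * (β * z * ρ (v z) + H z)) z)
    (hH : ∀ z ∈ Icc z₁ b, -(max (f z) 0 / (p - 1)) ≤ H z)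
    (hdom : max (f z₁) 0 / (p - 1) < β * z₁ * ρ (v z₁)) :
    MonotoneOn v (Icc z₁ b) := by
  have hp1 : 0 < p - 1 := by linarith
  have hfc : ContinuousOn f (Icc z₁ b) := fun z hz => (hf z hz).continuousAt.continuousWithinAt
  have hvc : ContinuousOn v (Icc z₁ b) := fun z hz => (hv z hz).continuousAt.continuousWithinAt
  have hQ : ContinuousOn (fun z => β * z * ρ (v z) - max (f z) 0 / (p - 1)) (Icc z₁ b) := by
    refine ((continuousOn_const.mul continuousOn_id).mul (hρc.comp_continuousOn hvc)).sub
      ((ContinuousOn.sup hfc continuousOn_const).div_const _)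
  have hmono : ∀ t ∈ Icc z₁ b,
      (∀ s ∈ Ico z₁ t, 0 < β * s * ρ (v s) - max (f s) 0 / (p - 1)) →
      MonotoneOn v (Icc z₁ t) := by
    intro t ht h
    refine monotoneOn_Icc_of_hasDerivAt (fun z hz => hv z ⟨hz.1, hz.2.trans ht.2⟩) fun z hz => ?_
    have hz0 : 0 < z := hz₁.trans hz.1
    have h1 := h z ⟨hz.1.le, hz.2⟩
    have h2 := hH z ⟨hz.1.le, hz.2.le.trans ht.2⟩
    have : 0 ≤ β * z * ρ (v z) + H z := by linarith
    positivity
  have hanti : AntitoneOn f (Icc z₁ b) :=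
    antitoneOn_Icc_of_hasDerivAt hf fun z _ => neg_nonpos.2 (hρ0 _)
  -- While transport dominates, `v` increases and `f` decreases, so transport grows and damping
  -- shrinks; their difference cannot reach zero.
  have hpos := pos_on_Icc_of_barrier hQ (by linarith) (by
    intro t ht h
    have hm := hmono t ⟨ht.1.le, ht.2⟩ h
    have h1 : v z₁ ≤ v t := hm (left_mem_Icc.2 ht.1.le) (right_mem_Icc.2 ht.1.le) ht.1.le
    have h2 : f t ≤ f z₁ := hanti (left_mem_Icc.2 (ht.1.le.trans ht.2)) ⟨ht.1.le, ht.2⟩ ht.1.le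
    have h3 : β * z₁ * ρ (v z₁) ≤ β * t * ρ (v t) := by
      have := hρ h1
      have := hρ0 (v z₁)
      have := ht.1.le
      have : 0 < t := hz₁.trans ht.1
      gcongr
    have h4 : max (f t) 0 / (p - 1) ≤ max (f z₁) 0 / (p - 1) := by gcongr
    have : 0 < β * t * ρ (v t) - max (f t) 0 / (p - 1) := by linarith
    exact this.ne')
  rcases le_or_gt z₁ b with h | h
  · exact hmono b ⟨h, le_rfl⟩ fun s hs => hpos s ⟨hs.1, hs.2.le⟩
  · rw [Icc_eq_empty h.not_ge]
    exact fun x hx => absurd hx (notMem_empty x)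

end Barrier

theorem continuous_regRoot {d : ℕ} {δ : ℝ} : Continuous (regRoot d δ) := by
  have : Continuous fun x : ℝ => x ^ (1 / (d : ℝ)) := Real.continuous_rpow_const (by positivity)
  unfold regRoot
  have h1 : Continuous fun v : ℝ => (max v δ) ^ (1 / (d : ℝ)) :=
    this.comp (continuous_id.max continuous_const)
  fun_prop

/-! ### Signs along regularized solutions, and shooting with large data -/

namespace IsRegularizedSolution

variable {d : ℕ} {p δ B a b : ℝ} {f v : ℝ → ℝ}

theorem mono (h : IsRegularizedSolution d p δ B a b f v) {a' b' : ℝ} (ha : a ≤ a') (hb : b' ≤ b) :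
    IsRegularizedSolution d p δ B a' b' f v :=
  ⟨fun z hz => h.1 z ⟨ha.trans hz.1, hz.2.trans hb⟩,
    fun z hz => h.2 z ⟨ha.trans hz.1, hz.2.trans hb⟩⟩

theorem continuousOn_fst (h : IsRegularizedSolution d p δ B a b f v) : ContinuousOn f (Icc a b) :=
  fun z hz => (h.1 z hz).continuousAt.continuousWithinAt

theorem continuousOn_snd (h : IsRegularizedSolution d p δ B a b f v) : ContinuousOn v (Icc a b) :=
  fun z hz => (h.2 z hz).continuousAt.continuousWithinAt

theorem antitoneOn (h : IsRegularizedSolution d p δ B a b f v) (hδ : 0 < δ) :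
    AntitoneOn f (Icc a b) :=
  antitoneOn_Icc_of_hasDerivAt h.1 fun _ _ => neg_nonpos.2 (regRoot_nonneg hδ)

/-- The regularized root vanishes for `v ≤ 0`, so `f` is frozen there. This is what separates the
two ways in which shooting can fail. -/
theorem eq_of_snd_nonpos (h : IsRegularizedSolution d p δ B a b f v) (hδ : 0 < δ) (hab : a ≤ b)
    (hv : ∀ z ∈ Ioo a b, v z ≤ 0) : ∀ z ∈ Icc a b, f z = f a := by
  intro z hz
  refine le_antisymm (h.antitoneOn hδ (left_mem_Icc.2 hab) hz hz.1) ?_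
  refine monotoneOn_Icc_of_hasDerivAt h.1 (fun z hz => ?_) (left_mem_Icc.2 hab) hz hz.1
  rw [regRoot_of_nonpos hδ (hv z hz), neg_zero]

/-- Along a solution, `v` and `f` cannot both become negative. -/
theorem fst_pos_of_snd_neg (h : IsRegularizedSolution d p δ B a b f v) (hp : 1 < p) (hδ : 0 < δ)
    (ha : 0 ≤ a) (hB : equilibrium p ≤ B) (hva : v a = δ) {z₁ : ℝ} (hz₁ : z₁ ∈ Icc a b)
    (hneg : v z₁ < 0) : ∀ z ∈ Icc a b, 0 < f z := by
  have hsmall : 0 < f z₁ ∧ f z₁ < equilibrium p := by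
    -- From the last point `w` with `v ≥ 0` up to `z₁`, `f` is frozen and only the reaction drives
    -- `v`. Since `v` drops, the mean value theorem makes the reaction negative, so the frozen value
    -- lies strictly between `0` and the equilibrium.
    set S := Icc a z₁ ∩ v ⁻¹' Ici 0 with hS
    have hc : ContinuousOn v (Icc a z₁) := h.continuousOn_snd.mono (Icc_subset_Icc_right hz₁.2)
    have hSc : IsCompact S := isCompact_Icc.of_isClosed_subset
      (hc.preimage_isClosed_of_isClosed isClosed_Icc isClosed_Ici) inter_subset_left
    obtain ⟨w, ⟨⟨h1, h2⟩, h3⟩, hmax⟩ := hSc.exists_isGreatest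
      ⟨a, left_mem_Icc.2 hz₁.1, by simp [hva, hδ.le]⟩
    have h3 : 0 ≤ v w := h3
    have hw : w < z₁ := by
      rcases h2.eq_or_lt with rfl | h'
      · exact absurd h3 hneg.not_ge
      · exact h'
    have hlt : ∀ s ∈ Ioc w z₁, v s < 0 := by
      intro s hs
      by_contra! h'
      exact hs.1.not_ge (hmax ⟨⟨h1.trans hs.1.le, hs.2⟩, h'⟩)
    have hsol := h.mono h1 hz₁.2
    have hconst := hsol.eq_of_snd_nonpos hδ hw.le fun s hs => (hlt s ⟨hs.1, hs.2.le⟩).le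
    obtain ⟨c, hc, hceq⟩ := exists_hasDerivAt_eq_slope v _ hw hsol.continuousOn_snd
      fun z hz => hsol.2 z (Ioo_subset_Icc_self hz)
    have hc0 : 0 < c := (ha.trans h1).trans_lt hc.1
    rw [regRoot_of_nonpos hδ (hlt c ⟨hc.1, hc.2.le⟩).le, mul_zero, zero_add,
      hconst c (Ioo_subset_Icc_self hc)] at hceq
    have hslope : (v z₁ - v w) / (z₁ - w) < 0 :=
      div_neg_of_neg_of_pos (by linarith) (by linarith)
    rw [hconst z₁ (right_mem_Icc.2 hw.le)]
    refine mem_of_truncReaction_neg hp hB ?_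
    by_contra! hnn
    have : 0 ≤ (d : ℝ) * c ^ (d - 1) * truncReaction p B (f w) := by positivity
    linarith
  -- After `z₁` the reaction at the frozen value is nonpositive, so `v` cannot climb back to zero.
  have hle : ∀ t ∈ Icc z₁ b, (∀ s ∈ Ico z₁ t, 0 < -v s) → v t ≤ v z₁ ∧ f t = f z₁ := by
    intro t ht hs
    have hsol := h.mono hz₁.1 ht.2
    have hconst := hsol.eq_of_snd_nonpos hδ ht.1 fun s hs' => by
      linarith [hs s ⟨hs'.1.le, hs'.2⟩]
    refine ⟨antitoneOn_Icc_of_hasDerivAt hsol.2 (fun z hz => ?_) (left_mem_Icc.2 ht.1)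
      (right_mem_Icc.2 ht.1) ht.1, hconst t (right_mem_Icc.2 ht.1)⟩
    have hz0 : 0 < z := (ha.trans hz₁.1).trans_lt hz.1
    rw [regRoot_of_nonpos hδ (by linarith [hs z ⟨hz.1.le, hz.2⟩]), mul_zero, zero_add,
      hconst z (Ioo_subset_Icc_self hz)]
    have hB' : f z₁ ≤ B := hsmall.2.le.trans hB
    rw [truncReaction_of_mem hsmall.1.le hB']
    exact mul_nonpos_of_nonneg_of_nonpos (by positivity)
      (reaction_nonpos hp hsmall.1.le hsmall.2.le)
  have hneg' := pos_on_Icc_of_barrier (h.mono hz₁.1 le_rfl).continuousOn_snd.neg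
    (by simpa using hneg) (by
      intro t ht hs
      have := (hle t ⟨ht.1.le, ht.2⟩ hs).1
      simp only [Pi.neg_apply]
      linarith)
  intro z hz
  rcases le_total z z₁ with h' | h'
  · exact hsmall.1.trans_le (h.antitoneOn hδ hz hz₁ h')
  · rw [(hle z ⟨h', hz.2⟩ fun s hs => hneg' s ⟨hs.1, hs.2.le.trans hz.2⟩).2]
    exact hsmall.1

theorem fst_sub_le (h : IsRegularizedSolution d p δ B a b f v) (hδ : 0 < δ) (hab : a ≤ b)
    (hm : MonotoneOn v (Icc a b)) : f a - f b ≤ (b - a) * regRoot d δ (v b) := by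
  have := le_sub_of_hasDerivAt (c := -regRoot d δ (v b)) hab h.1 fun z hz =>
    neg_le_neg (monotone_regRoot hδ
      (hm (Ioo_subset_Icc_self hz) (right_mem_Icc.2 hab) hz.2.le))
  linarith

theorem le_fst_sub (h : IsRegularizedSolution d p δ B a b f v) (hδ : 0 < δ) (hab : a ≤ b)
    (hm : MonotoneOn v (Icc a b)) : (b - a) * regRoot d δ (v a) ≤ f a - f b := by
  have := sub_le_of_hasDerivAt (c := -regRoot d δ (v a)) hab h.1 fun z hz =>
    neg_le_neg (monotone_regRoot hδ
      (hm (left_mem_Icc.2 hab) (Ioo_subset_Icc_self hz) hz.1.le))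
  linarith

/-- After the profile passes through the equilibrium with nonzero slope, `v` increases for some
time. -/
theorem monotoneOn_after_equilibrium (h : IsRegularizedSolution d p δ B a b f v) (hd : 2 ≤ d)
    (hp : (d : ℝ) < p) (hδ : 0 < δ) (ha : 0 < a) (hB : equilibrium p ≤ B)
    (hfa : f a = equilibrium p) (hva : 0 < v a) (hb : b ≤ (1 + beta d p) * a) :
    MonotoneOn v (Icc a b) := by
  have hβ := beta_pos hd hp
  have hp1 := one_lt_exponent hd hp
  -- The tangent bound for the reaction makes `v` nondecreasing while this barrier is positive.
  -- Conversely, monotone `v` gives `f₀ - f(z) ≤ (z - a) g(z)` for the root `g` of `v`, and `z - a <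
  -- β z` as long as `z ≤ (1 + β) a`, so the barrier cannot vanish.
  have hQ : ContinuousOn (fun z => beta d p * z * regRoot d δ (v z) - (equilibrium p - f z))
      (Icc a b) :=
    ((continuousOn_const.mul continuousOn_id).mul
      (continuous_regRoot.comp_continuousOn h.continuousOn_snd)).sub
      (continuousOn_const.sub h.continuousOn_fst)
  have hmono : ∀ t ∈ Icc a b,
      (∀ s ∈ Ico a t, 0 < beta d p * s * regRoot d δ (v s) - (equilibrium p - f s)) →
      MonotoneOn v (Icc a t) := by
    intro t ht hs
    refine monotoneOn_Icc_of_hasDerivAt (fun z hz => h.2 z ⟨hz.1, hz.2.trans ht.2⟩) fun z hz => ?_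
    have hz0 : 0 < z := ha.trans hz.1
    have h1 := hs z ⟨hz.1.le, hz.2⟩
    have hfz : f z ≤ B := by
      refine (h.antitoneOn hδ (left_mem_Icc.2 (ht.1.trans ht.2))
        ⟨hz.1.le, hz.2.le.trans ht.2⟩ hz.1.le).trans (hfa ▸ hB)
    have h2 := sub_equilibrium_le_truncReaction hp1 hB hfz
    have : 0 ≤ beta d p * z * regRoot d δ (v z) + truncReaction p B (f z) := by linarith
    positivity
  have hpos := pos_on_Icc_of_barrier hQ (by
      have := regRoot_pos (d := d) hδ hva
      have : 0 < beta d p * a * regRoot d δ (v a) := by positivity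
      simpa [hfa] using this) (by
    intro t ht hs
    have hm := hmono t ⟨ht.1.le, ht.2⟩ hs
    have h1 : 0 < v t :=
      hva.trans_le (hm (left_mem_Icc.2 ht.1.le) (right_mem_Icc.2 ht.1.le) ht.1.le)
    have h2 := (h.mono le_rfl ht.2).fst_sub_le hδ ht.1.le hm
    have h3 := regRoot_pos (d := d) hδ h1
    have h4 : t - a < beta d p * t := by
      have := ht.1
      have := ht.2
      nlinarith
    have : (t - a) * regRoot d δ (v t) < beta d p * t * regRoot d δ (v t) := by gcongr
    rw [hfa] at h2
    have : 0 < beta d p * t * regRoot d δ (v t) - (equilibrium p - f t) := by linarith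
    exact this.ne')
  rcases le_or_gt a b with h' | h'
  · exact hmono b ⟨h', le_rfl⟩ fun s hs => hpos s ⟨hs.1, hs.2.le⟩
  · rw [Icc_eq_empty h'.not_ge]
    exact fun x hx => absurd hx (notMem_empty x)

/-- The lower bound for the growth of `v` at an interface. -/
theorem interface_le (h : IsRegularizedSolution d p δ B a b f v) (hd : 2 ≤ d)
    (hp : (d : ℝ) < p) (hδ : 0 < δ) (ha : 0 < a) (hB : equilibrium p ≤ B)
    (hfa : f a = equilibrium p) (hva : v a = δ) {z : ℝ} (hz : z ∈ Icc a b)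
    (hz' : z ≤ (1 + beta d p / 2) * a) :
    ((d : ℝ) - 1) * (beta d p / 2) * a ^ d * (z - a) ≤ v z ^ (1 - 1 / (d : ℝ)) := by
  have hβ := beta_pos hd hp
  have hp1 := one_lt_exponent hd hp
  have hd2 : (2 : ℝ) ≤ d := by exact_mod_cast hd
  have hsol := h.mono le_rfl hz.2
  have hm := hsol.monotoneOn_after_equilibrium hd hp hδ ha hB hfa (hva ▸ hδ) (by nlinarith)
  have hge : ∀ s ∈ Icc a z, δ ≤ v s := fun s hs =>
    hva ▸ hm (left_mem_Icc.2 hz.1) hs hs.1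
  -- Differentiating `v ^ (1 - 1/d)` divides `v'` by the root `g`, and `v'` is at least `d a ^ (d-1)
  -- (β/2) a g`: for `s ≤ (1 + β/2) a` the reaction costs at most half of `β a g`. The root cancels,
  -- so the bound does not depend on `δ`.
  have key := le_sub_of_hasDerivAt (g := fun s => v s ^ (1 - 1 / (d : ℝ)))
    (c := ((d : ℝ) - 1) * (beta d p / 2) * a ^ d) hz.1
    (fun s hs => (hsol.2 s hs).rpow_const (Or.inl (hδ.trans_le (hge s hs)).ne'))
    (fun s hs => by
      have hs' := Ioo_subset_Icc_self hs
      have hvs : 0 < v s := hδ.trans_le (hge s hs')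
      have hs0 : 0 < s := ha.trans hs.1
      rw [regRoot_of_le hδ (hge s hs')]
      set g := v s ^ (1 / (d : ℝ)) with hg
      have hg0 : 0 < g := Real.rpow_pos_of_pos hvs _
      have hgi : v s ^ (1 - 1 / (d : ℝ) - 1) = g⁻¹ := by
        rw [hg, ← Real.rpow_neg hvs.le]
        congr 1
        ring
      rw [hgi]
      have h1 := (hsol.mono le_rfl hs.2.le).fst_sub_le hδ hs.1.le
        (hm.mono (Icc_subset_Icc_right hs.2.le))
      rw [regRoot_of_le hδ (hge s hs'), ← hg, hfa] at h1
      have hfs : f s ≤ B := (hsol.antitoneOn hδ (left_mem_Icc.2 hz.1) hs' hs.1.le).trans (hfa ▸ hB)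
      have h2 := sub_equilibrium_le_truncReaction hp1 hB hfs
      have h3 : beta d p / 2 * a * g ≤ beta d p * s * g + truncReaction p B (f s) := by
        have : beta d p / 2 * a ≤ beta d p * s - (s - a) := by
          have := hs.1
          have := hs.2
          nlinarith
        nlinarith
      have h4 : a ^ (d - 1) ≤ s ^ (d - 1) := pow_le_pow_left₀ ha.le hs.1.le _
      have h5 : a ^ d = a ^ (d - 1) * a := by
        rw [← pow_succ]
        congr 1
        omega
      calc ((d : ℝ) - 1) * (beta d p / 2) * a ^ d
          = (d * a ^ (d - 1) * (beta d p / 2 * a * g)) * (1 - 1 / (d : ℝ)) * g⁻¹ := by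
            rw [h5]
            field_simp
        _ ≤ (d * s ^ (d - 1) * (beta d p * s * g + truncReaction p B (f s))) *
              (1 - 1 / (d : ℝ)) * g⁻¹ := by
            have : 0 ≤ 1 - 1 / (d : ℝ) := by
              rw [sub_nonneg, div_le_one (by positivity)]
              linarith
            gcongr)
  have : 0 ≤ v a ^ (1 - 1 / (d : ℝ)) := Real.rpow_nonneg (hva ▸ hδ.le) _
  linarith

theorem monotoneOn_of_dominates (h : IsRegularizedSolution d p δ B a b f v) (hd : 2 ≤ d)
    (hp : (d : ℝ) < p) (hδ : 0 < δ) (hB : 0 ≤ B) (hfa : f a ≤ B) (ha : 0 < a)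
    (hdom : max (f a) 0 / (p - 1) < beta d p * a * regRoot d δ (v a)) :
    MonotoneOn v (Icc a b) :=
  monotoneOn_of_transport_dominates (one_lt_exponent hd hp) (beta_pos hd hp) (monotone_regRoot hδ)
    continuous_regRoot (fun _ => regRoot_nonneg hδ) ha h.1 h.2
    (fun _ hz => neg_div_le_truncReaction (one_lt_exponent hd hp) hB
      ((h.antitoneOn hδ (left_mem_Icc.2 (hz.1.trans hz.2)) hz hz.1).trans hfa)) hdom

theorem monotoneOn_of_equilibrium_le (h : IsRegularizedSolution d p δ B a b f v) (hd : 2 ≤ d)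
    (hp : (d : ℝ) < p) (hδ : 0 < δ) (hB : equilibrium p ≤ B) (ha : 0 ≤ a)
    (hf : ∀ z ∈ Icc a b, equilibrium p ≤ f z) : MonotoneOn v (Icc a b) := by
  refine monotoneOn_Icc_of_hasDerivAt h.2 fun z hz => ?_
  have h1 := truncReaction_nonneg (one_lt_exponent hd hp) hB (hf z (Ioo_subset_Icc_self hz))
  have h2 : 0 ≤ z := ha.trans hz.1.le
  have h3 := beta_pos hd hp
  have h4 := regRoot_nonneg (d := d) (v := v z) hδ
  positivity

/-- For solutions that start high enough, `v` remains positive. -/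
theorem snd_nonneg_of_large_height (h : IsRegularizedSolution d p δ B 0 b f v) (hd : 2 ≤ d)
    (hp : (d : ℝ) < p) (hδ : 0 < δ) (hB : equilibrium p ≤ B) (hv0 : v 0 = δ)
    (hM : equilibrium p / (p - 1) < beta d p * (f 0 - equilibrium p)) :
    ∀ z ∈ Icc 0 b, 0 ≤ v z := by
  have hp1 := one_lt_exponent hd hp
  have hβ := beta_pos hd hp
  have he := equilibrium_pos hp1
  intro z hz
  have hb : 0 ≤ b := hz.1.trans hz.2
  by_cases hall : equilibrium p ≤ f b
  · have := h.monotoneOn_of_equilibrium_le hd hp hδ hB le_rfl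
      (fun z hz => hall.trans (h.antitoneOn hδ hz (right_mem_Icc.2 hb) hz.2))
      (left_mem_Icc.2 hb) hz hz.1
    linarith
  push Not at hall
  have hpp : 0 < p - 1 := by linarith
  have hf0e : equilibrium p < f 0 := by
    have : 0 < equilibrium p / (p - 1) := by positivity
    by_contra! h'
    nlinarith
  obtain ⟨z₁, hz₁, hz₁e⟩ := intermediate_value_Icc' hb h.continuousOn_fst
    (⟨hall.le, hf0e.le⟩ : equilibrium p ∈ Icc (f b) (f 0))
  have hz₁0 : 0 < z₁ := by
    rcases hz₁.1.eq_or_lt with rfl | h'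
    · linarith
    · exact h'
  have hs1 := h.mono le_rfl hz₁.2
  have hm1 := hs1.monotoneOn_of_equilibrium_le hd hp hδ hB le_rfl
    (fun z hz => hz₁e.ge.trans (hs1.antitoneOn hδ hz (right_mem_Icc.2 hz₁.1) hz.2))
  -- Falling from `f 0` to the equilibrium within distance `z₁` requires `z₁ g(z₁) ≥ f 0 - f₀`; by
  -- `hM`, transport then dominates damping at the crossing `z₁`.
  have h1 := hs1.fst_sub_le hδ hz₁.1 hm1
  have hm2 := (h.mono hz₁.1 le_rfl).monotoneOn_of_dominates hd hp hδ (he.le.trans hB)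
    (hz₁e ▸ hB) hz₁0 (by
      rw [hz₁e, max_eq_left he.le]
      rw [hz₁e] at h1
      nlinarith)
  rcases le_total z z₁ with h' | h'
  · have := hm1 (left_mem_Icc.2 hz₁.1) ⟨hz.1, h'⟩ hz.1
    linarith
  · have e1 := hm1 (left_mem_Icc.2 hz₁.1) (right_mem_Icc.2 hz₁.1) hz₁.1
    have e2 := hm2 (left_mem_Icc.2 hz₁.2) ⟨h', hz.2⟩ h'
    linarith

/-- For solutions with an interface far away from the origin, `v` remains positive. -/
theorem snd_nonneg_of_large_interface (h : IsRegularizedSolution d p δ B a b f v) (hd : 2 ≤ d)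
    (hp : (d : ℝ) < p) (hδ : 0 < δ) (hδ1 : δ ≤ 1) (hB : equilibrium p ≤ B) (ha : 0 < a)
    (hfa : f a = equilibrium p) (hva : v a = δ)
    (hb : (1 + beta d p / 2) * a ≤ b)
    (ha1 : 1 ≤ ((d : ℝ) - 1) * (beta d p / 2) * a ^ d * (beta d p / 2 * a))
    (ha2 : equilibrium p / (p - 1) < beta d p * a) :
    ∀ z ∈ Icc a b, 0 ≤ v z := by
  have hp1 := one_lt_exponent hd hp
  have hβ := beta_pos hd hp
  have he := equilibrium_pos hp1
  have hpp : 0 < p - 1 := by linarith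
  have hd2 : (2 : ℝ) ≤ d := by exact_mod_cast hd
  set z₁ := (1 + beta d p / 2) * a with hz₁
  have haz : a ≤ z₁ := by nlinarith
  have h1 := h.interface_le hd hp hδ ha hB hfa hva ⟨haz, hb⟩ le_rfl
  have hm1 := (h.mono le_rfl hb).monotoneOn_after_equilibrium hd hp hδ ha hB hfa (hva ▸ hδ)
    (by nlinarith)
  have hvz : v a ≤ v z₁ := hm1 (left_mem_Icc.2 haz) (right_mem_Icc.2 haz) haz
  have hq : 0 < 1 - 1 / (d : ℝ) := by
    rw [sub_pos, div_lt_one (by positivity)]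
    linarith
  -- Here `ha1` says exactly that the interface bound at `z₁` is at least `1`. With the root at
  -- least `1`, `ha2` gives dominance of transport at `z₁`.
  have hv1 : 1 ≤ v z₁ := by
    by_contra! h'
    have := Real.rpow_lt_one (by linarith) h' hq
    have : z₁ - a = beta d p / 2 * a := by rw [hz₁]; ring
    rw [this] at h1
    linarith
  have hr1 : 1 ≤ regRoot d δ (v z₁) := by
    rw [regRoot_of_le hδ (hδ1.trans hv1)]
    exact Real.one_le_rpow hv1 (by positivity)
  have hfz : f z₁ ≤ equilibrium p :=
    hfa ▸ h.antitoneOn hδ (left_mem_Icc.2 (haz.trans hb)) ⟨haz, hb⟩ haz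
  have hm2 := (h.mono haz le_rfl).monotoneOn_of_dominates hd hp hδ (he.le.trans hB)
    (hfz.trans hB) (ha.trans_le haz) (by
      calc max (f z₁) 0 / (p - 1) ≤ equilibrium p / (p - 1) := by
            gcongr
            exact max_le hfz he.le
        _ < beta d p * a := ha2
        _ ≤ beta d p * z₁ := by gcongr
        _ ≤ beta d p * z₁ * regRoot d δ (v z₁) := le_mul_of_one_le_right (by positivity) hr1)
  intro z hz
  rcases le_total z z₁ with h' | h'
  · have := hm1 (left_mem_Icc.2 haz) ⟨hz.1, h'⟩ hz.1
    linarith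
  · have e2 := hm2 (left_mem_Icc.2 hb) ⟨h', hz.2⟩ h'
    linarith

end IsRegularizedSolution

/-- The virial identity: the transport term is a total derivative up to lower order terms. -/
theorem hasDerivAt_virial {d : ℕ} (hd : 2 ≤ d) {β g H z : ℝ} {f v : ℝ → ℝ} (e : ℝ)
    (hf : HasDerivAt f (-g) z) (hv : HasDerivAt v (d * z ^ (d - 1) * (β * z * g + H)) z) :
    HasDerivAt (fun z => v z + d * β * z ^ d * (f z - e))
      (d * z ^ (d - 1) * (d * β * (f z - e) + H)) z := by
  have h1 := hv.fun_add (((hasDerivAt_pow d z).const_mul (d * β : ℝ)).fun_mul (hf.sub_const e))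
  refine h1.congr_deriv ?_
  have : z ^ d = z ^ (d - 1) * z := by
    rw [← pow_succ]
    congr 1
    omega
  rw [this]
  ring

/-! ### Virial estimates near the equilibrium, uniform in the regularization -/

namespace IsRegularizedSolution

variable {d : ℕ} {p δ B a b : ℝ} {f v : ℝ → ℝ}

theorem hasDerivAt_energy (h : IsRegularizedSolution d p δ B a b f v) (hd : 2 ≤ d) (e : ℝ)
    {z : ℝ} (hz : z ∈ Icc a b) :
    HasDerivAt (fun z => v z + d * beta d p * z ^ d * (f z - e))
      (d * z ^ (d - 1) * (d * beta d p * (f z - e) + truncReaction p B (f z))) z :=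
  hasDerivAt_virial hd e (h.1 z hz) (h.2 z hz)

/-- The regularized profiles remain close to the equilibrium on an interval that does not depend on
the regularization. -/
theorem exists_equilibrium_sub_le (hd : 2 ≤ d) (hp : (d : ℝ) < p) (hB : equilibrium p ≤ B)
    {η : ℝ} (hη : 0 < η) (hη' : η < equilibrium p) :
    ∃ Z > 0, Z ≤ 1 ∧ ∀ {δ a b : ℝ} {f v : ℝ → ℝ}, 0 < δ → δ ≤ 1 → 0 ≤ a → Z ≤ b →
      IsRegularizedSolution d p δ B a b f v → equilibrium p ≤ f a → f a ≤ B → v a = δ →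
      ∀ z ∈ Icc a Z, equilibrium p - η ≤ f z := by
  have hp1 := one_lt_exponent hd hp
  have hβ := beta_pos hd hp
  have he := equilibrium_pos hp1
  have hd2 : (2 : ℝ) ≤ d := by exact_mod_cast hd
  have hB0 : 0 < B := he.trans_le hB
  obtain ⟨H, hH0, hH⟩ := exists_abs_truncReaction_le hp1 B
  -- On `[0, 1]`, while `f ≥ 0`, `W` bounds the derivative of the energy `v + d β z ^ d f`, which is
  -- at most `1 + d β B` at the start. Hence `v ≤ V`, and `f` loses at most `V Z ≤ η / 2` up to `Z`.
  set W : ℝ := d * (d * beta d p * B + H) with hW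
  set V : ℝ := 1 + d * beta d p * B + W with hV
  have hW0 : 0 < W := by positivity
  have hV1 : 1 ≤ V := by
    have : 0 < d * beta d p * B := by positivity
    linarith
  refine ⟨min 1 (η / (2 * V)), by positivity, min_le_left _ _, ?_⟩
  intro δ a b f v hδ hδ1 ha hZb hs hfa hfaB hva
  set Z := min 1 (η / (2 * V)) with hZ
  have hZ1 : Z ≤ 1 := min_le_left _ _
  have hZV : V * Z ≤ η / 2 := by
    have : Z ≤ η / (2 * V) := min_le_right _ _
    calc V * Z ≤ V * (η / (2 * V)) := by gcongr
      _ = η / 2 := by field_simp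
  intro z hz
  have hsol := hs.mono le_rfl hZb
  have hpos := pos_on_Icc_of_barrier (Q := fun z => f z - (equilibrium p - η)) (a := a) (b := Z)
    (hsol.continuousOn_fst.sub continuousOn_const) (by linarith) (by
      intro t ht hQ
      have hst := hsol.mono le_rfl ht.2
      have hf0 : ∀ s ∈ Ico a t, 0 ≤ f s := fun s hs => by linarith [hQ s hs]
      have hfB : ∀ s ∈ Icc a t, f s ≤ B := fun s hs =>
        (hst.antitoneOn hδ (left_mem_Icc.2 ht.1.le) hs hs.1).trans hfaB
      have hvV : ∀ s ∈ Ioo a t, v s ≤ V := by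
        intro s hs
        have h1 := sub_le_of_hasDerivAt (c := W) hs.1.le
          (fun z hz => hst.hasDerivAt_energy hd 0 ⟨hz.1, hz.2.trans hs.2.le⟩) (by
            intro y hy
            have hy0 : 0 ≤ y := ha.trans hy.1.le
            have hy1 : y ^ (d - 1) ≤ 1 :=
              pow_le_one₀ hy0 (hy.2.le.trans (hs.2.le.trans (ht.2.trans hZ1)))
            have e1 := hfB y ⟨hy.1.le, hy.2.le.trans hs.2.le⟩
            have e2 := (abs_le.1 (hH (f y))).2
            have e3 := hf0 y ⟨hy.1.le, hy.2.trans hs.2⟩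
            calc d * y ^ (d - 1) * (d * beta d p * (f y - 0) + truncReaction p B (f y))
                ≤ d * y ^ (d - 1) * (d * beta d p * B + H) := by
                  rw [sub_zero]
                  gcongr
              _ ≤ d * 1 * (d * beta d p * B + H) := by gcongr
              _ = W := by rw [hW]; ring)
        simp only [sub_zero] at h1
        have h2 : s - a ≤ 1 := by linarith [hs.2, ht.2]
        have h3 : 0 ≤ d * beta d p * s ^ d * f s := by
          have := ha.trans hs.1.le
          have := hf0 s ⟨hs.1.le, hs.2⟩
          positivity
        have h4 : d * beta d p * a ^ d * f a ≤ d * beta d p * B := by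
          have h5 : a ^ d ≤ 1 := pow_le_one₀ ha (by linarith [ht.1, ht.2])
          calc d * beta d p * a ^ d * f a ≤ d * beta d p * 1 * B := by
                have := he.le.trans hfa
                gcongr
            _ = _ := by ring
        have h6 : W * (s - a) ≤ W := by nlinarith
        linarith
      have h1 := le_sub_of_hasDerivAt (c := -V) ht.1.le hst.1 (by
        intro s hs
        refine neg_le_neg ((regRoot_le hδ).trans ?_)
        have h2 : max (v s) δ ≤ V := max_le (hvV s hs) (hδ1.trans hV1)
        calc (max (v s) δ) ^ (1 / (d : ℝ)) ≤ V ^ (1 / (d : ℝ)) :=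
              Real.rpow_le_rpow (hδ.le.trans (le_max_right _ _)) h2 (by positivity)
          _ ≤ V ^ (1 : ℝ) := Real.rpow_le_rpow_of_exponent_le hV1 (by
              rw [div_le_one (by positivity)]
              linarith)
          _ = V := Real.rpow_one V)
      have h2 : V * (t - a) ≤ η / 2 := by
        refine le_trans ?_ hZV
        have := ht.2
        gcongr
        linarith
      have : 0 < f t - (equilibrium p - η) := by linarith
      exact this.ne')
  linarith [hpos z hz]

/-- A profile below the equilibrium along which `v` remains nonnegative has to leave the equilibrium
so fast that this is incompatible with a small start. -/
theorem exists_growth_bound (hd : 2 ≤ d) (hp : (d : ℝ) < p) {σ K Z : ℝ} (hσ : 0 < σ)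
    (hK : 0 ≤ K) (hZ : 0 < Z) (hZ1 : Z ≤ 1) :
    ∃ C > 0, ∃ L ≥ 1, ∀ {δ B z₀ μ : ℝ} {f v : ℝ → ℝ},
      IsRegularizedSolution d p δ B z₀ Z f v → 0 < δ → 0 < z₀ → L * z₀ ≤ Z → 0 < μ →
      (∀ z ∈ Icc z₀ Z, 0 ≤ v z) → (∀ z ∈ Icc z₀ Z, 0 ≤ f z) →
      (∀ z ∈ Icc z₀ Z, truncReaction p B (f z) ≤ -σ * (equilibrium p - f z)) →
      μ ≤ equilibrium p - f z₀ →
      v z₀ + d * beta d p * z₀ ^ d * (f z₀ - equilibrium p) ≤ K * μ * z₀ ^ d →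
      μ ≤ C * z₀ ^ (σ / beta d p) := by
  have hp1 := one_lt_exponent hd hp
  have hβ := beta_pos hd hp
  have he := equilibrium_pos hp1
  have hd2 : (2 : ℝ) ≤ d := by exact_mod_cast hd
  set c : ℝ := d * beta d p + σ with hc
  have hc0 : 0 < c := by positivity
  -- Chosen so that `c (L - 1) = K + 1`: growth between `z₀` and `L z₀` first repays the deficit `K
  -- μ z₀ ^ d` of the initial energy and then leaves `μ z₀ ^ d`.
  set L : ℝ := (K + 1) / c + 1 with hL
  have hL1 : 1 ≤ L := by
    have : 0 ≤ (K + 1) / c := by positivity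
    linarith
  have hL0 : 0 < L := by linarith
  set m : ℝ := d + σ / beta d p with hm
  have hm0 : 0 < m := by positivity
  have hcm : c = m * beta d p := by
    rw [hm, hc]
    field_simp
  refine ⟨d * beta d p * equilibrium p * L ^ m * Z ^ (-m), by positivity, L, hL1, ?_⟩
  intro δ B z₀ μ f v hs hδ hz₀ hLz hμ hv hf hr hμf hE
  have hz₀L : z₀ ≤ L * z₀ := le_mul_of_one_le_left hz₀.le hL1
  have hz₀Z : z₀ ≤ Z := hz₀L.trans hLz
  set N : ℝ → ℝ := fun z => -(v z + d * beta d p * z ^ d * (f z - equilibrium p)) with hN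
  set N' : ℝ → ℝ := fun z => -(d * z ^ (d - 1) *
    (d * beta d p * (f z - equilibrium p) + truncReaction p B (f z))) with hN'
  have hNd : ∀ z ∈ Icc z₀ Z, HasDerivAt N (N' z) z := fun z hz =>
    (hs.hasDerivAt_energy hd (equilibrium p) hz).fun_neg
  have hN'le : ∀ z ∈ Icc z₀ Z, d * z ^ (d - 1) * (c * (equilibrium p - f z)) ≤ N' z := by
    intro z hz
    have h1 := hr z hz
    have h2 : 0 ≤ d * z ^ (d - 1) := by
      have := hz₀.le.trans hz.1
      positivity
    rw [hN', hc]
    simp only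
    nlinarith
  have hψ : ∀ z ∈ Icc z₀ Z, μ ≤ equilibrium p - f z := fun z hz => by
    linarith [hs.antitoneOn hδ (left_mem_Icc.2 hz₀Z) hz hz.1]
  have hN1 : μ * z₀ ^ d ≤ N (L * z₀) := by
    have h1 := monotoneOn_Icc_of_hasDerivAt (g := fun z => N z - c * μ * z ^ d)
      (fun z (hz : z ∈ Icc z₀ (L * z₀)) => (hNd z ⟨hz.1, hz.2.trans hLz⟩).fun_sub
        ((hasDerivAt_pow d z).const_mul (c * μ))) (by
        intro z hz
        have hz' : z ∈ Icc z₀ Z := ⟨hz.1.le, hz.2.le.trans hLz⟩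
        have e1 := hN'le z hz'
        have e2 := hψ z hz'
        have e3 : 0 ≤ d * z ^ (d - 1) * c := by
          have := hz₀.le.trans hz.1.le
          positivity
        nlinarith) (left_mem_Icc.2 hz₀L) (right_mem_Icc.2 hz₀L) hz₀L
    simp only at h1
    have h2 : -(K * μ * z₀ ^ d) ≤ N z₀ := neg_le_neg hE
    have h3 : L ≤ L ^ d := le_self_pow₀ hL1 (by omega)
    have h4 : K + 1 = c * (L - 1) := by
      rw [hL]
      field_simp
      ring
    have h5 : 0 ≤ c * μ * z₀ ^ d * (L ^ d - L) := by
      have : 0 ≤ L ^ d - L := by linarith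
      positivity
    rw [mul_pow] at h1
    have h6 : (K + 1) * (μ * z₀ ^ d) = c * (L - 1) * (μ * z₀ ^ d) := by rw [h4]
    nlinarith
  -- The sign of `v` enters here: `v ≥ 0` gives `N ≤ d β z ^ d (f₀ - f)`, hence `m N ≤ z N'` because
  -- `m β = d β + σ`. So `N` grows at least like `z ^ m`, while `hN3` bounds it at `Z`.
  have hN2 : N (L * z₀) * (L * z₀) ^ (-m) ≤ N Z * Z ^ (-m) := by
    refine monotoneOn_Icc_of_hasDerivAt (g := fun z => N z * z ^ (-m))
      (fun z (hz : z ∈ Icc (L * z₀) Z) => by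
        have hz0 : 0 < z := hz₀.trans_le (hz₀L.trans hz.1)
        exact (hNd z ⟨hz₀L.trans hz.1, hz.2⟩).fun_mul
          (Real.hasDerivAt_rpow_const (Or.inl hz0.ne'))) (fun z hz => ?_)
      (left_mem_Icc.2 hLz) (right_mem_Icc.2 hLz) hLz
    have hz' : z ∈ Icc z₀ Z := ⟨hz₀L.trans hz.1.le, hz.2.le⟩
    have hz0 : 0 < z := hz₀.trans_le hz'.1
    rw [Real.rpow_sub_one hz0.ne']
    have h1 := hN'le z hz'
    have h2 : N z ≤ d * beta d p * z ^ d * (equilibrium p - f z) := by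
      have := hv z hz'
      simp only [hN]
      linarith
    have h3 : z ^ d = z ^ (d - 1) * z := by
      rw [← pow_succ]
      congr 1
      omega
    have h4 : m * N z ≤ N' z * z := by
      calc m * N z ≤ m * (d * beta d p * z ^ d * (equilibrium p - f z)) := by gcongr
        _ = d * z ^ (d - 1) * (c * (equilibrium p - f z)) * z := by
          rw [h3, hcm]
          ring
        _ ≤ N' z * z := by gcongr
    have h5 : N' z * z ^ (-m) + N z * (-m * (z ^ (-m) / z)) =
        (N' z * z - m * N z) * (z ^ (-m) / z) := by
      field_simp
      ring
    rw [h5]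
    have h6 : 0 < z ^ (-m) := Real.rpow_pos_of_pos hz0 _
    have : 0 ≤ N' z * z - m * N z := by linarith
    positivity
  have hN3 : N Z ≤ d * beta d p * equilibrium p := by
    have h1 := hv Z (right_mem_Icc.2 hz₀Z)
    have h2 := hf Z (right_mem_Icc.2 hz₀Z)
    have h3 : Z ^ d ≤ 1 := pow_le_one₀ hZ.le hZ1
    have h4 : 0 ≤ equilibrium p - f Z := hμ.le.trans (hψ Z (right_mem_Icc.2 hz₀Z))
    calc N Z ≤ d * beta d p * Z ^ d * (equilibrium p - f Z) := by
          simp only [hN]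
          linarith
      _ ≤ d * beta d p * 1 * equilibrium p := by
          gcongr
          linarith
      _ = _ := by ring
  have hLm : 0 < (L * z₀) ^ (-m) := Real.rpow_pos_of_pos (by positivity) _
  have hZm : 0 < Z ^ (-m) := Real.rpow_pos_of_pos hZ _
  have hfin : μ * z₀ ^ d * (L * z₀) ^ (-m) ≤ d * beta d p * equilibrium p * Z ^ (-m) :=
    (mul_le_mul_of_nonneg_right hN1 hLm.le).trans
      (hN2.trans (mul_le_mul_of_nonneg_right hN3 hZm.le))
  have hz₀m : z₀ ^ (-m) * z₀ ^ d * z₀ ^ (σ / beta d p) = 1 := by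
    rw [← Real.rpow_natCast z₀ d, ← Real.rpow_add hz₀, ← Real.rpow_add hz₀]
    have : -m + d + σ / beta d p = 0 := by
      rw [hm]
      ring
    rw [this, Real.rpow_zero]
  have hLL : L ^ m * L ^ (-m) = 1 := by
    rw [← Real.rpow_add hL0, add_neg_cancel, Real.rpow_zero]
  rw [Real.mul_rpow hL0.le hz₀.le] at hfin
  calc μ = (μ * z₀ ^ d * (L ^ (-m) * z₀ ^ (-m))) * (L ^ m * z₀ ^ (σ / beta d p)) := by
        have : (μ * z₀ ^ d * (L ^ (-m) * z₀ ^ (-m))) * (L ^ m * z₀ ^ (σ / beta d p)) =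
          μ * (L ^ m * L ^ (-m)) * (z₀ ^ (-m) * z₀ ^ d * z₀ ^ (σ / beta d p)) := by ring
        rw [this, hLL, hz₀m]
        ring
    _ ≤ (d * beta d p * equilibrium p * Z ^ (-m)) * (L ^ m * z₀ ^ (σ / beta d p)) := by
        gcongr
    _ = _ := by ring

end IsRegularizedSolution

/-- A power with a larger exponent is smaller near the origin. -/
theorem eventually_rpow_lt_rpow {s t : ℝ} (hst : s < t) {c C k : ℝ} (hc : 0 < c) (hk : 0 < k) :
    ∀ᶠ x in 𝓝[>] (0 : ℝ), C * (k * x) ^ t < c * x ^ s := by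
  have h1 : Tendsto (fun x : ℝ => C * k ^ t * x ^ (t - s)) (𝓝[>] 0) (𝓝 (C * k ^ t * 0)) := by
    refine Tendsto.const_mul _ ?_
    have := (Real.continuousAt_rpow_const 0 (t - s) (Or.inr (by linarith))).tendsto
    rw [Real.zero_rpow (by linarith)] at this
    exact this.mono_left nhdsWithin_le_nhds
  rw [mul_zero] at h1
  filter_upwards [h1.eventually_lt_const hc, self_mem_nhdsWithin] with x hx hx0
  have hx0 : 0 < x := hx0
  have : C * (k * x) ^ t = C * k ^ t * x ^ (t - s) * x ^ s := by
    rw [Real.mul_rpow hk.le hx0.le, mul_assoc _ (x ^ (t - s)), ← Real.rpow_add hx0,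
      sub_add_cancel]
    ring
  rw [this]
  have := Real.rpow_pos_of_pos hx0 s
  gcongr

/-- The comparison behind both small data arguments. The left exponent measures the deviation that
the data create; the right one is `σ/β` for `σ` midway between `2dβ` and `1`, so it exceeds `2d`. -/
theorem growthExponent_lt {d : ℕ} {p : ℝ} (hd : 2 ≤ d) (hp : (d : ℝ) < p) :
    2 * d / ((d : ℝ) - 1) < (1 + 2 * d * beta d p) / 2 / beta d p := by
  have hβ := beta_pos hd hp
  have h1 := two_mul_dim_mul_beta_lt_one hd hp
  have hd2 : (2 : ℝ) ≤ d := by exact_mod_cast hd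
  have h2 : 2 * d / ((d : ℝ) - 1) ≤ 2 * d := div_le_self (by positivity) (by linarith)
  refine h2.trans_lt ?_
  rw [lt_div_iff₀ hβ]
  linarith

section NearEquilibrium

variable {d : ℕ} {p : ℝ}

/-- Bounds for the reaction term near the equilibrium, with a slope close enough to `1`. -/
theorem exists_reaction_le_near_equilibrium (hd : 2 ≤ d) (hp : (d : ℝ) < p) :
    ∃ η > 0, η < equilibrium p ∧
      (∀ x, equilibrium p - η ≤ x → x ≤ equilibrium p →
        reaction p x ≤ -((1 + 2 * d * beta d p) / 2) * (equilibrium p - x)) ∧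
      (∀ x, equilibrium p ≤ x → x ≤ equilibrium p + η →
        reaction p x ≤ 2 * (x - equilibrium p)) := by
  have hβ := beta_pos hd hp
  have h1 := two_mul_dim_mul_beta_lt_one hd hp
  -- With this tolerance `ε`, the slope `1 - ε` is the midpoint `(1 + 2dβ)/2`, and `1 + ε ≤ 2`
  -- serves above the equilibrium.
  obtain ⟨η, hη, hη', h⟩ := exists_abs_reaction_sub_le (one_lt_exponent hd hp)
    (show 0 < (1 - 2 * d * beta d p) / 2 by linarith)
  refine ⟨η, hη, hη', fun x hx hx' => ?_, fun x hx hx' => ?_⟩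
  · have h2 : |x - equilibrium p| = equilibrium p - x := by
      rw [abs_of_nonpos (by linarith)]
      ring
    have := (abs_le.1 (h x (by linarith))).2
    rw [h2] at this
    linarith
  · have h2 : |x - equilibrium p| = x - equilibrium p := abs_of_nonneg (by linarith)
    have := (abs_le.1 (h x (by linarith))).2
    rw [h2] at this
    have h3 : 0 ≤ d * beta d p * (x - equilibrium p) := by
      have : 0 ≤ x - equilibrium p := by linarith
      positivity
    nlinarith

end NearEquilibrium

/-! ### Shooting with small data -/

namespace IsRegularizedSolution

variable {d : ℕ} {p δ B a b : ℝ} {f v : ℝ → ℝ}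

/-- The contrapositive of `fst_pos_of_snd_neg`. It makes the growth bound available in proofs that
`f` stays nonnegative: a negative value of `f` supplies `v ≥ 0` everywhere. -/
theorem snd_nonneg_of_fst_nonpos (h : IsRegularizedSolution d p δ B a b f v) (hp : 1 < p)
    (hδ : 0 < δ) (ha : 0 ≤ a) (hB : equilibrium p ≤ B) (hva : v a = δ) {z : ℝ}
    (hz : z ∈ Icc a b) (hneg : f z ≤ 0) : ∀ z ∈ Icc a b, 0 ≤ v z := by
  intro y hy
  by_contra! h'
  exact hneg.not_gt (h.fst_pos_of_snd_neg hp hδ ha hB hva hy h' z hz)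

/-- The slope shortly after an interface. -/
theorem le_equilibrium_sub (h : IsRegularizedSolution d p δ B a b f v) (hd : 2 ≤ d)
    (hp : (d : ℝ) < p) (hδ : 0 < δ) (ha : 0 < a) (hB : equilibrium p ≤ B)
    (hfa : f a = equilibrium p) (hva : v a = δ) (hb : (1 + beta d p / 2) * a ≤ b) :
    beta d p / 4 * (((d : ℝ) - 1) * (beta d p / 2) * (beta d p / 4)) ^ (1 / ((d : ℝ) - 1)) *
      a ^ (2 * d / ((d : ℝ) - 1)) ≤ equilibrium p - f ((1 + beta d p / 2) * a) := by
  have hβ := beta_pos hd hp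
  have hd2 : (2 : ℝ) ≤ d := by exact_mod_cast hd
  have hd1 : 0 < (d : ℝ) - 1 := by linarith
  -- The interval after the interface is halved: up to `y` the interface bound builds up slope, and
  -- from `y` to `z` the profile falls with at least that slope over the length `β a / 4`. The
  -- exponent is `1 + (d+1)/(d-1) = 2d/(d-1)`.
  set y := (1 + beta d p / 4) * a with hy
  set z := (1 + beta d p / 2) * a with hz
  set κ := ((d : ℝ) - 1) * (beta d p / 2) * (beta d p / 4) with hκ
  have hκ0 : 0 < κ := by positivity
  have hay : a ≤ y := by nlinarith
  have hyz : y ≤ z := by nlinarith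
  have hm := (h.mono le_rfl hb).monotoneOn_after_equilibrium hd hp hδ ha hB hfa (hva ▸ hδ)
    (by nlinarith)
  have h1 := h.interface_le hd hp hδ ha hB hfa hva ⟨hay, hyz.trans hb⟩ (by nlinarith)
  have h2 := (h.mono hay hb).le_fst_sub hδ hyz (hm.mono (Icc_subset_Icc_left hay))
  have hvy : δ ≤ v y := hva ▸ hm (left_mem_Icc.2 (hay.trans hyz)) ⟨hay, hyz⟩ hay
  have hfy : f y ≤ equilibrium p :=
    hfa ▸ h.antitoneOn hδ (left_mem_Icc.2 (hay.trans (hyz.trans hb))) ⟨hay, hyz.trans hb⟩ hay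
  rw [regRoot_of_le hδ hvy] at h2
  have h3 : κ * a ^ (d + 1) ≤ v y ^ (1 - 1 / (d : ℝ)) := by
    refine le_trans (le_of_eq ?_) h1
    rw [hκ, hy, pow_succ]
    ring
  have h4 : v y ^ (1 / (d : ℝ)) = (v y ^ (1 - 1 / (d : ℝ))) ^ (1 / ((d : ℝ) - 1)) := by
    rw [← Real.rpow_mul (hδ.le.trans hvy)]
    congr 1
    field_simp
  have h5 : κ ^ (1 / ((d : ℝ) - 1)) * a ^ (((d : ℝ) + 1) / ((d : ℝ) - 1)) ≤
      v y ^ (1 / (d : ℝ)) := by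
    rw [h4]
    refine le_trans (le_of_eq ?_)
      (Real.rpow_le_rpow (by positivity) h3 (by positivity))
    rw [Real.mul_rpow hκ0.le (by positivity), ← Real.rpow_natCast a (d + 1),
      ← Real.rpow_mul ha.le]
    congr 2
    push_cast
    ring
  have h6 : a ^ (2 * d / ((d : ℝ) - 1)) = a * a ^ (((d : ℝ) + 1) / ((d : ℝ) - 1)) := by
    rw [← Real.rpow_one_add' ha.le (by positivity)]
    congr 1
    field_simp
    ring
  calc beta d p / 4 * κ ^ (1 / ((d : ℝ) - 1)) * a ^ (2 * d / ((d : ℝ) - 1))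
      = (z - y) * (κ ^ (1 / ((d : ℝ) - 1)) * a ^ (((d : ℝ) + 1) / ((d : ℝ) - 1))) := by
        rw [h6, hz, hy]
        ring
    _ ≤ (z - y) * v y ^ (1 / (d : ℝ)) := by
        have : 0 ≤ z - y := by linarith
        gcongr
    _ ≤ equilibrium p - f z := by linarith

/-- Solutions with an interface close to the origin do not become negative. -/
theorem exists_small_interface (hd : 2 ≤ d) (hp : (d : ℝ) < p) (hB : equilibrium p ≤ B)
    {R : ℝ} (hR : 0 < R) :
    ∃ a > 0, a < R ∧ ∃ δ₀ > 0, ∀ {δ b : ℝ} {f v : ℝ → ℝ}, 0 < δ → δ ≤ δ₀ → 1 ≤ b →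
      IsRegularizedSolution d p δ B a b f v → f a = equilibrium p → v a = δ →
      ∀ z ∈ Icc a b, 0 ≤ f z := by
  have hp1 := one_lt_exponent hd hp
  have hβ := beta_pos hd hp
  have he := equilibrium_pos hp1
  have hd2 : (2 : ℝ) ≤ d := by exact_mod_cast hd
  have hd1 : 0 < (d : ℝ) - 1 := by linarith
  obtain ⟨η, hη, hη', hr, -⟩ := exists_reaction_le_near_equilibrium hd hp
  obtain ⟨Z, hZ, hZ1, hlow⟩ := exists_equilibrium_sub_le hd hp hB hη hη'
  obtain ⟨C, hC, L, hL, hgrow⟩ := exists_growth_bound hd hp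
    (show 0 < (1 + 2 * d * beta d p) / 2 by positivity) zero_le_one hZ hZ1
  set c : ℝ := beta d p / 4 *
    (((d : ℝ) - 1) * (beta d p / 2) * (beta d p / 4)) ^ (1 / ((d : ℝ) - 1)) with hc
  have hc0 : 0 < c := by positivity
  set k : ℝ := 1 + beta d p / 2 with hk
  have hk0 : 0 < k := by positivity
  have hL0 : 0 < L := by linarith
  -- The position `a` is taken so small that the growth bound at `k a` contradicts the deviation `c
  -- a ^ (2d/(d-1))` reached there.
  have hev := (eventually_rpow_lt_rpow (growthExponent_lt hd hp) (C := C) hc0 hk0).and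
    ((Ioo_mem_nhdsGT (show 0 < min R (Z / (L * k)) by positivity)))
  obtain ⟨a, ha, ha0, ha1⟩ := hev.exists
  have haR : a < R := ha1.trans_le (min_le_left _ _)
  have haZ : L * (k * a) ≤ Z := by
    have := (lt_div_iff₀ (by positivity)).1 (ha1.trans_le (min_le_right _ _))
    nlinarith
  have hak : a ≤ k * a := by nlinarith
  have hkaZ : k * a ≤ Z := (le_mul_of_one_le_left (by positivity) hL).trans haZ
  set μ : ℝ := c * a ^ (2 * d / ((d : ℝ) - 1)) with hμ
  have hμ0 : 0 < μ := by positivity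
  refine ⟨a, ha0, haR, min 1 (μ * a ^ d), by positivity, ?_⟩
  intro δ b f v hδ hδ₀ hb hs hfa hva z hz
  by_contra! hneg
  have hv := hs.snd_nonneg_of_fst_nonpos hp1 hδ ha0.le hB hva hz hneg.le
  have hZb : Z ≤ b := hZ1.trans hb
  have hlow' := hlow hδ (hδ₀.trans (min_le_left _ _)) ha0.le hZb hs hfa.ge (hfa ▸ hB) hva
  have hle : ∀ z ∈ Icc a b, f z ≤ equilibrium p := fun z hz =>
    hfa ▸ hs.antitoneOn hδ (left_mem_Icc.2 (hz.1.trans hz.2)) hz hz.1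
  have hreac : ∀ z ∈ Icc a Z, truncReaction p B (f z) ≤
      -((1 + 2 * d * beta d p) / 2) * (equilibrium p - f z) := by
    intro z hz
    have h1 := hlow' z hz
    have h2 := hle z ⟨hz.1, hz.2.trans hZb⟩
    rw [truncReaction_of_mem (by linarith) (h2.trans hB)]
    exact hr _ h1 h2
  -- At the interface the energy equals `δ`, and it decreases below the equilibrium; `δ ≤ μ a ^ d`
  -- lets `K = 1` suffice.
  have hE : v (k * a) + d * beta d p * (k * a) ^ d * (f (k * a) - equilibrium p) ≤
      1 * μ * (k * a) ^ d := by
    have h1 := antitoneOn_Icc_of_hasDerivAt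
      (fun z (hz : z ∈ Icc a (k * a)) =>
        hs.hasDerivAt_energy hd (equilibrium p) ⟨hz.1, hz.2.trans (hkaZ.trans hZb)⟩)
      (fun z hz => by
        have hzZ : z ≤ Z := hz.2.le.trans hkaZ
        have e1 := hreac z ⟨hz.1.le, hzZ⟩
        have e2 := hle z ⟨hz.1.le, hzZ.trans hZb⟩
        have hz0 : 0 < z := ha0.trans hz.1
        have e3 : 0 ≤ d * beta d p * (equilibrium p - f z) := by
          have : 0 ≤ equilibrium p - f z := by linarith
          positivity
        have e4 : 0 ≤ ((1 + 2 * d * beta d p) / 2) * (equilibrium p - f z) := by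
          have : 0 ≤ equilibrium p - f z := by linarith
          positivity
        exact mul_nonpos_of_nonneg_of_nonpos (by positivity) (by linarith))
      (left_mem_Icc.2 hak) (right_mem_Icc.2 hak) hak
    simp only [hfa, hva, sub_self, mul_zero, add_zero] at h1
    refine h1.trans (hδ₀.trans ((min_le_right _ _).trans ?_))
    rw [one_mul]
    gcongr
  have := hgrow (hs.mono hak hZb) hδ (by positivity) haZ hμ0
    (fun z hz => hv z ⟨hak.trans hz.1, hz.2.trans hZb⟩)
    (fun z hz => by linarith [hlow' z ⟨hak.trans hz.1, hz.2⟩])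
    (fun z hz => hreac z ⟨hak.trans hz.1, hz.2⟩)
    (hs.le_equilibrium_sub hd hp hδ ha0 hB hfa hva (hkaZ.trans hZb)) hE
  linarith

/-- A solution that starts slightly above the equilibrium falls below it within a distance that is
controlled by the initial height. -/
theorem fst_le_equilibrium (h : IsRegularizedSolution d p δ B 0 b f v) (hd : 2 ≤ d)
    (hp : (d : ℝ) < p) (hδ : 0 < δ) (hB : equilibrium p ≤ B) (hfB : f 0 ≤ B) (hv0 : v 0 = δ)
    {l x : ℝ} (hl : 0 < l) (hlb : l ≤ b) (hx : 0 < x) (hfx : f 0 = equilibrium p + 2 * x)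
    (hlx : x < l ^ 2 / 8 * x ^ (1 / (d : ℝ))) : f l ≤ equilibrium p := by
  by_contra! hneg
  have hp1 := one_lt_exponent hd hp
  have hβ := beta_pos hd hp
  have hsl := h.mono le_rfl hlb
  have hge : ∀ z ∈ Icc 0 l, equilibrium p ≤ f z := fun z hz =>
    hneg.le.trans (hsl.antitoneOn hδ hz (right_mem_Icc.2 hl.le) hz.2)
  have hm := hsl.monotoneOn_of_equilibrium_le hd hp hδ hB le_rfl hge
  have hvδ : ∀ z ∈ Icc 0 l, δ ≤ v z := fun z hz =>
    hv0 ▸ hm (left_mem_Icc.2 hl.le) hz hz.1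
  have hl2 : 0 ≤ l / 2 := by positivity
  have hl2' : l / 2 ≤ l := by linarith
  have hh := hsl.mono le_rfl hl2'
  -- If half of the excess survives at `l / 2`, then `v ≥ x z ^ d` and `f` has dropped by `x ^ (1/d)
  -- l ^ 2 / 8 > x`, a contradiction. Otherwise more than `x` is lost on the first half, and
  -- monotone `v` makes the second half lose at least as much.
  rcases le_or_gt x (f (l / 2) - equilibrium p) with hcase | hcase
  · have hvl : ∀ z ∈ Icc 0 (l / 2), x * z ^ d ≤ v z := by
      intro z hz
      have h1 := monotoneOn_Icc_of_hasDerivAt (g := fun z => v z - x * z ^ d)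
        (fun z (hz : z ∈ Icc 0 (l / 2)) =>
          (hh.2 z hz).fun_sub ((hasDerivAt_pow d z).const_mul x)) (fun y hy => by
          have hy' := Ioo_subset_Icc_self hy
          have e1 : x ≤ f y - equilibrium p := by
            linarith [hh.antitoneOn hδ hy' (right_mem_Icc.2 hl2) hy.2.le]
          have e2 : f y ≤ B := (hh.antitoneOn hδ (left_mem_Icc.2 hl2) hy' hy.1.le).trans hfB
          have e3 := sub_equilibrium_le_truncReaction hp1 hB e2
          have hy0 := hy.1
          have e4 := regRoot_nonneg (d := d) (v := v y) hδ
          have e5 : 0 ≤ beta d p * y * regRoot d δ (v y) := by positivity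
          have e6 : 0 ≤ d * y ^ (d - 1) := by positivity
          nlinarith) (left_mem_Icc.2 hl2) hz hz.1
      simp only [zero_pow (show d ≠ 0 by omega), mul_zero, sub_zero, hv0] at h1
      linarith
    have hroot : ∀ z ∈ Icc 0 (l / 2), x ^ (1 / (d : ℝ)) * z ≤ regRoot d δ (v z) := by
      intro z hz
      rw [regRoot_of_le hδ (hvδ z ⟨hz.1, hz.2.trans hl2'⟩)]
      refine le_trans (le_of_eq ?_)
        (Real.rpow_le_rpow (by have := hz.1; positivity) (hvl z hz) (by positivity))
      rw [Real.mul_rpow hx.le (pow_nonneg hz.1 _), one_div,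
        Real.pow_rpow_inv_natCast hz.1 (by omega)]
    have h1 := antitoneOn_Icc_of_hasDerivAt
      (g := fun z => f z + x ^ (1 / (d : ℝ)) / 2 * z ^ 2)
      (fun z (hz : z ∈ Icc 0 (l / 2)) =>
        (hh.1 z hz).fun_add ((hasDerivAt_pow 2 z).const_mul (x ^ (1 / (d : ℝ)) / 2)))
      (fun z hz => by
        have := hroot z (Ioo_subset_Icc_self hz)
        simp only [Nat.cast_ofNat, Nat.add_one_sub_one, pow_one]
        linarith) (left_mem_Icc.2 hl2) (right_mem_Icc.2 hl2) hl2
    simp only at h1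
    nlinarith
  · have h1 := hh.fst_sub_le hδ hl2 (hm.mono (Icc_subset_Icc_right hl2'))
    have h2 := (hsl.mono hl2 le_rfl).le_fst_sub hδ hl2' (hm.mono (Icc_subset_Icc_left hl2))
    linarith

/-- A solution that starts above the equilibrium overshoots it. -/
theorem mul_sub_le_equilibrium_sub (h : IsRegularizedSolution d p δ B 0 b f v) (hd : 2 ≤ d)
    (hp : (d : ℝ) < p) (hδ : 0 < δ) (hB : equilibrium p ≤ B) (hv0 : v 0 = δ) {l : ℝ}
    (hl : 0 ≤ l) (hlb : (1 + beta d p) * l ≤ b) (hf0 : equilibrium p < f 0)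
    (hfl : f l ≤ equilibrium p) :
    beta d p * (f 0 - equilibrium p) ≤ equilibrium p - f ((1 + beta d p) * l) := by
  have hβ := beta_pos hd hp
  have hlb' : l ≤ b := by nlinarith
  obtain ⟨z₁, hz₁, hz₁e⟩ := intermediate_value_Icc' hl
    (h.continuousOn_fst.mono (Icc_subset_Icc_right hlb'))
    (⟨hfl, hf0.le⟩ : equilibrium p ∈ Icc (f l) (f 0))
  have hz₁0 : 0 < z₁ := by
    rcases hz₁.1.eq_or_lt with rfl | h'
    · linarith
    · exact h'
  have hz₁b : z₁ ≤ b := hz₁.2.trans hlb'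
  have hs1 := h.mono le_rfl hz₁b
  have hm1 := hs1.monotoneOn_of_equilibrium_le hd hp hδ hB le_rfl
    (fun z hz => hz₁e.ge.trans (hs1.antitoneOn hδ hz (right_mem_Icc.2 hz₁.1) hz.2))
  -- Before the crossing `z₁` the slope is at most `g(z₁)` over length `z₁`; after it the slope is
  -- at least `g(z₁)` over length `β z₁`. Hence the overshoot is at least `β` times the initial
  -- excess.
  have hg1 := hs1.fst_sub_le hδ hz₁.1 hm1
  have hvz₁ : δ ≤ v z₁ := hv0 ▸ hm1 (left_mem_Icc.2 hz₁.1) (right_mem_Icc.2 hz₁.1) hz₁.1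
  have hzz : z₁ ≤ (1 + beta d p) * z₁ := by nlinarith
  have hkzl : (1 + beta d p) * z₁ ≤ (1 + beta d p) * l := by
    have := hz₁.2
    gcongr
  have hkz : (1 + beta d p) * z₁ ≤ b := hkzl.trans hlb
  have hs2 := h.mono hz₁.1 hkz
  have hm2 := hs2.monotoneOn_after_equilibrium hd hp hδ hz₁0 hB hz₁e (hδ.trans_le hvz₁) le_rfl
  have hg2 := hs2.le_fst_sub hδ hzz hm2
  have h1 : f ((1 + beta d p) * l) ≤ f ((1 + beta d p) * z₁) :=
    h.antitoneOn hδ ⟨hz₁.1.trans hzz, hkz⟩ ⟨by positivity, hlb⟩ hkzl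
  have h2 : (1 + beta d p) * z₁ - z₁ = beta d p * z₁ := by ring
  rw [h2, hz₁e] at hg2
  rw [hz₁e, sub_zero] at hg1
  have h3 := mul_le_mul_of_nonneg_left hg1 hβ.le
  linarith

/-- Solutions that start slightly above the equilibrium do not become negative. -/
theorem exists_small_height (hd : 2 ≤ d) (hp : (d : ℝ) < p) (hB : equilibrium p < B) :
    ∃ M, equilibrium p < M ∧ M < B ∧ ∃ δ₀ > 0, ∀ {δ b : ℝ} {f v : ℝ → ℝ}, 0 < δ → δ ≤ δ₀ →
      1 ≤ b → IsRegularizedSolution d p δ B 0 b f v → f 0 = M → v 0 = δ →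
      ∀ z ∈ Icc 0 b, 0 ≤ f z := by
  have hp1 := one_lt_exponent hd hp
  have hβ := beta_pos hd hp
  have he := equilibrium_pos hp1
  have hd2 : (2 : ℝ) ≤ d := by exact_mod_cast hd
  have hd1 : 0 < (d : ℝ) - 1 := by linarith
  obtain ⟨η, hη, hη', hr, hr'⟩ := exists_reaction_le_near_equilibrium hd hp
  obtain ⟨Z, hZ, hZ1, hlow⟩ := exists_equilibrium_sub_le hd hp hB.le hη hη'
  obtain ⟨C, hC, L, hL, hgrow⟩ := exists_growth_bound hd hp
    (show 0 < (1 + 2 * d * beta d p) / 2 by positivity)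
    (show 0 ≤ (d * beta d p + 3) / beta d p by positivity) hZ hZ1
  -- With this constant, `x = c l ^ (2d/(d-1))` solves `x = (l ^ 2 / 16) x ^ (1/d)`, which is the
  -- condition of `fst_le_equilibrium` with a factor `2` to spare.
  set c : ℝ := (1 / 16) ^ ((d : ℝ) / ((d : ℝ) - 1)) with hc
  have hc0 : 0 < c := by positivity
  set k : ℝ := 1 + beta d p with hk
  have hk0 : 0 < k := by positivity
  have hL0 : 0 < L := by linarith
  have hs0 : 0 < 2 * d / ((d : ℝ) - 1) := by positivity
  have hsmall : Tendsto (fun l : ℝ => 2 * (c * l ^ (2 * d / ((d : ℝ) - 1)))) (𝓝[>] 0) (𝓝 0) := by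
    have := ((((Real.continuousAt_rpow_const 0 (2 * d / ((d : ℝ) - 1))
      (Or.inr hs0.le)).tendsto).const_mul c).const_mul 2).mono_left
      (nhdsWithin_le_nhds (s := Ioi 0))
    rwa [Real.zero_rpow hs0.ne', mul_zero, mul_zero] at this
  have hev := ((eventually_rpow_lt_rpow (growthExponent_lt hd hp) (C := C)
    (show 0 < beta d p * (2 * c) by positivity) hk0).and
    (Ioo_mem_nhdsGT (show 0 < Z / (L * k) by positivity))).and
    (hsmall.eventually_lt_const (show 0 < min η (B - equilibrium p) from
      lt_min hη (by linarith)))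
  obtain ⟨l, ⟨hl, hl0, hl1⟩, hl2⟩ := hev.exists
  have hlZ : L * (k * l) ≤ Z := by
    have := (lt_div_iff₀ (by positivity)).1 hl1
    nlinarith
  have hlk : l ≤ k * l := by nlinarith
  have hklZ : k * l ≤ Z := (le_mul_of_one_le_left (by positivity) hL).trans hlZ
  set x : ℝ := c * l ^ (2 * d / ((d : ℝ) - 1)) with hx
  have hx0 : 0 < x := by positivity
  have hxη : 2 * x < η := hl2.trans_le (min_le_left _ _)
  have hxB : 2 * x < B - equilibrium p := hl2.trans_le (min_le_right _ _)
  have hxpow : x = (l ^ 2 / 16) ^ ((d : ℝ) / ((d : ℝ) - 1)) := by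
    rw [hx, hc, div_eq_mul_one_div (l ^ 2) 16, Real.mul_rpow (by positivity) (by norm_num),
      ← Real.rpow_natCast l 2, ← Real.rpow_mul hl0.le, mul_comm]
    congr 2
    push_cast
    ring
  have hlx : x < l ^ 2 / 8 * x ^ (1 / (d : ℝ)) := by
    have h1 : l ^ 2 / 16 * x ^ (1 / (d : ℝ)) = x := by
      have hy : 0 < l ^ 2 / 16 := by positivity
      rw [hxpow, ← Real.rpow_mul hy.le, ← Real.rpow_one_add' hy.le (by positivity)]
      congr 1
      field_simp
      ring
    nlinarith
  refine ⟨equilibrium p + 2 * x, by linarith, by linarith, min 1 (2 * x * l ^ d), by positivity, ?_⟩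
  intro δ b f v hδ hδ₀ hb hs hf0 hv0 z hz
  by_contra! hneg
  have hv := hs.snd_nonneg_of_fst_nonpos hp1 hδ le_rfl hB.le hv0 hz hneg.le
  have hZb : Z ≤ b := hZ1.trans hb
  have hb0 : (0 : ℝ) ≤ b := by linarith
  have hf0B : f 0 ≤ B := by linarith
  have hlow' := hlow hδ (hδ₀.trans (min_le_left _ _)) le_rfl hZb hs (by linarith) hf0B hv0
  have hlb : l ≤ b := hlk.trans (hklZ.trans hZb)
  have hle0 : ∀ z ∈ Icc 0 b, f z ≤ equilibrium p + 2 * x := fun z hz =>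
    hf0 ▸ hs.antitoneOn hδ (left_mem_Icc.2 hb0) hz hz.1
  have hfl := hs.fst_le_equilibrium hd hp hδ hB.le hf0B hv0 hl0 hlb hx0 hf0 hlx
  have hψ : beta d p * (2 * x) ≤ equilibrium p - f (k * l) := by
    have := hs.mul_sub_le_equilibrium_sub hd hp hδ hB.le hv0 hl0.le (hklZ.trans hZb)
      (by linarith) hfl
    rwa [hf0, add_sub_cancel_left] at this
  have hreac : ∀ z ∈ Icc (k * l) Z, truncReaction p B (f z) ≤
      -((1 + 2 * d * beta d p) / 2) * (equilibrium p - f z) := by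
    intro z hz
    have hz0 : 0 ≤ z := (show 0 ≤ k * l by positivity).trans hz.1
    have h1 := hlow' z ⟨hz0, hz.2⟩
    have h2 : f z ≤ equilibrium p := (hs.antitoneOn hδ ⟨hl0.le, hlb⟩ ⟨hz0, hz.2.trans hZb⟩
      (hlk.trans hz.1)).trans hfl
    rw [truncReaction_of_mem (by linarith) (h2.trans hB.le)]
    exact hr _ h1 h2
  -- For `μ = β (2 x)`, the constant `K = (d β + 3)/β` is made up of `d β + 2` from the growth of
  -- the energy above the equilibrium and `1` from the initial value `δ`.
  have hE : v (k * l) + d * beta d p * (k * l) ^ d * (f (k * l) - equilibrium p) ≤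
      (d * beta d p + 3) / beta d p * (beta d p * (2 * x)) * (k * l) ^ d := by
    have hkl0 : 0 ≤ k * l := by positivity
    have h1 := antitoneOn_Icc_of_hasDerivAt
      (g := fun z => v z + d * beta d p * z ^ d * (f z - equilibrium p) -
        (d * beta d p + 2) * (2 * x) * z ^ d)
      (fun z (hz : z ∈ Icc 0 (k * l)) =>
        (hs.hasDerivAt_energy hd (equilibrium p) ⟨hz.1, hz.2.trans (hklZ.trans hZb)⟩).fun_sub
          ((hasDerivAt_pow d z).const_mul ((d * beta d p + 2) * (2 * x))))
      (fun z hz => by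
        have hz0 := hz.1
        have hzZ : z ≤ Z := hz.2.le.trans hklZ
        have hz' : z ∈ Icc 0 b := ⟨hz0.le, hzZ.trans hZb⟩
        have e0 := hlow' z ⟨hz0.le, hzZ⟩
        have e1 := hle0 z hz'
        have e2 : truncReaction p B (f z) ≤ 2 * (2 * x) := by
          rw [truncReaction_of_mem (by linarith) (by linarith)]
          rcases le_total (equilibrium p) (f z) with h' | h'
          · have := hr' (f z) h' (by linarith)
            linarith
          · have := reaction_nonpos hp1 (by linarith) h'
            linarith
        have e3 : d * beta d p * (f z - equilibrium p) ≤ d * beta d p * (2 * x) := by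
          gcongr
          linarith
        have e4 : 0 ≤ d * z ^ (d - 1) := by positivity
        nlinarith)
      (left_mem_Icc.2 hkl0) (right_mem_Icc.2 hkl0) hkl0
    simp only [zero_pow (show d ≠ 0 by omega), mul_zero, zero_mul, add_zero, sub_zero, hv0] at h1
    have h2 : δ ≤ 2 * x * (k * l) ^ d :=
      hδ₀.trans ((min_le_right _ _).trans (by gcongr))
    have h3 : (d * beta d p + 3) / beta d p * (beta d p * (2 * x)) * (k * l) ^ d =
        (d * beta d p + 3) * (2 * x) * (k * l) ^ d := by
      field_simp
    rw [h3]
    linarith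
  have hkl0 : 0 < k * l := by positivity
  have := hgrow (hs.mono hkl0.le hZb) hδ hkl0 hlZ (by positivity)
    (fun z hz => hv z ⟨hkl0.le.trans hz.1, hz.2.trans hZb⟩)
    (fun z hz => by linarith [hlow' z ⟨hkl0.le.trans hz.1, hz.2⟩])
    hreac hψ hE
  rw [hx] at this
  linarith

end IsRegularizedSolution

/-! ### Shooting by connectedness -/

section Shooting

variable {d : ℕ} {p δ B : ℝ}

/-- The shooting argument: on a path of initial data that joins data for which `f` remains
nonnegative with data for which `v` does, there are data for which both do. -/
theorem exists_nonneg_regularizedSolution (hd : 2 ≤ d) (hp : (d : ℝ) < p) (hδ : 0 < δ)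
    (hδ1 : δ ≤ 1) (hB : equilibrium p ≤ B) {R T : ℝ} (hR : 1 ≤ R) (hT : 0 ≤ T) {γ : ℝ → ℝ × ℝ}
    (hγ : Continuous γ) (hγR : ∀ s ∈ Icc (0 : ℝ) 1, γ s ∈ Icc (0 : ℝ) R ×ˢ Icc (0 : ℝ) R)
    (h0 : ∀ f v : ℝ → ℝ, IsRegularizedSolution d p δ B (γ 0).1 ((γ 0).1 + T) f v →
      f (γ 0).1 = (γ 0).2 → v (γ 0).1 = δ → ∀ z ∈ Icc (γ 0).1 ((γ 0).1 + T), 0 ≤ f z)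
    (h1 : ∀ f v : ℝ → ℝ, IsRegularizedSolution d p δ B (γ 1).1 ((γ 1).1 + T) f v →
      f (γ 1).1 = (γ 1).2 → v (γ 1).1 = δ → ∀ z ∈ Icc (γ 1).1 ((γ 1).1 + T), 0 ≤ v z) :
    ∃ s ∈ Icc (0 : ℝ) 1, ∃ f v : ℝ → ℝ,
      IsRegularizedSolution d p δ B (γ s).1 ((γ s).1 + T) f v ∧ f (γ s).1 = (γ s).2 ∧
      v (γ s).1 = δ ∧ ∀ z ∈ Icc (γ s).1 ((γ s).1 + T), 0 ≤ f z ∧ 0 ≤ v z := by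
  have hp1 := one_lt_exponent hd hp
  obtain ⟨f, v, hsol, hc⟩ := exists_regularizedSolution hd hp hδ hδ1
    ((equilibrium_pos hp1).le.trans hB) hR hT
  by_contra! hno
  have hcont : ∀ (g : ℝ × ℝ → ℝ), ContinuousOn g (Icc (0 : ℝ) R ×ˢ Icc (0 : ℝ) R) →
      Continuous fun s : Icc (0 : ℝ) 1 => g (γ s) := fun g hg =>
    hg.comp_continuous (hγ.comp continuous_subtype_val) fun s => hγR s s.2
  have hset : ∀ g : ℝ × ℝ → ℝ → ℝ,
      (∀ τ ∈ Icc (0 : ℝ) T, ContinuousOn (fun x => g x (x.1 + τ))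
        (Icc (0 : ℝ) R ×ˢ Icc (0 : ℝ) R)) →
      IsOpen {s : Icc (0 : ℝ) 1 | ∃ τ ∈ Icc (0 : ℝ) T, g (γ s) ((γ s).1 + τ) < 0} := by
    intro g hg
    have : {s : Icc (0 : ℝ) 1 | ∃ τ ∈ Icc (0 : ℝ) T, g (γ s) ((γ s).1 + τ) < 0} =
        ⋃ τ ∈ Icc (0 : ℝ) T, {s : Icc (0 : ℝ) 1 | g (γ s) ((γ s).1 + τ) < 0} := by
      ext s
      simp
    rw [this]
    exact isOpen_biUnion fun τ hτ => isOpen_lt (hcont _ (hg τ hτ)) continuous_const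
  have hA := hset v fun τ hτ => (hc τ hτ).2
  have hB' := hset f fun τ hτ => (hc τ hτ).1
  have hshift : ∀ s : Icc (0 : ℝ) 1, ∀ τ ∈ Icc (0 : ℝ) T,
      (γ s).1 + τ ∈ Icc (γ s).1 ((γ s).1 + T) := fun s τ hτ =>
    ⟨by linarith [hτ.1], by linarith [hτ.2]⟩
  have hunshift : ∀ s : Icc (0 : ℝ) 1, ∀ z ∈ Icc (γ s).1 ((γ s).1 + T),
      z - (γ s).1 ∈ Icc (0 : ℝ) T := fun s z hz =>
    ⟨by linarith [hz.1], by linarith [hz.2]⟩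
  have hcover : ∀ s : Icc (0 : ℝ) 1, (∃ τ ∈ Icc (0 : ℝ) T, v (γ s) ((γ s).1 + τ) < 0) ∨
      ∃ τ ∈ Icc (0 : ℝ) T, f (γ s) ((γ s).1 + τ) < 0 := by
    intro s
    obtain ⟨e1, e2, e3⟩ := hsol _ (hγR s s.2)
    obtain ⟨z, hz, hz'⟩ := hno s s.2 _ _ e3 e1 e2
    rcases lt_or_ge (f (γ s) z) 0 with h | h
    · exact Or.inr ⟨_, hunshift s z hz, by simpa using h⟩
    · exact Or.inl ⟨_, hunshift s z hz, by simpa using hz' h⟩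
  -- If every datum failed, the two open sets would cover the interval and, by the behaviour at the
  -- ends, both be nonempty; a common point has `v` and `f` both negative somewhere.
  have hpre : IsPreconnected (univ : Set (Icc (0 : ℝ) 1)) :=
    (Subtype.preconnectedSpace isPreconnected_Icc).isPreconnected_univ
  obtain ⟨s, -, ⟨τ, hτ, hv⟩, τ', hτ', hf⟩ := hpre _ _ hA hB' (fun s _ => hcover s)
    ⟨⟨0, by simp⟩, mem_univ _, by
      refine (hcover ⟨0, by simp⟩).resolve_right ?_
      rintro ⟨τ, hτ, h⟩
      obtain ⟨e1, e2, e3⟩ := hsol _ (hγR 0 (by simp))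
      exact h.not_ge (h0 _ _ e3 e1 e2 _ (hshift ⟨0, by simp⟩ τ hτ))⟩
    ⟨⟨1, by simp⟩, mem_univ _, by
      refine (hcover ⟨1, by simp⟩).resolve_left ?_
      rintro ⟨τ, hτ, h⟩
      obtain ⟨e1, e2, e3⟩ := hsol _ (hγR 1 (by simp))
      exact h.not_ge (h1 _ _ e3 e1 e2 _ (hshift ⟨1, by simp⟩ τ hτ))⟩
  obtain ⟨e1, e2, e3⟩ := hsol _ (hγR s s.2)
  exact hf.not_gt (e3.fst_pos_of_snd_neg hp1 hδ (hγR s s.2).1.1 hB e2 (hshift s τ hτ) hv _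
    (hshift s τ' hτ'))

/-- The regularization parameters. -/
noncomputable def regParam (n : ℕ) : ℝ := 1 / ((n : ℝ) + 1)

theorem regParam_pos (n : ℕ) : 0 < regParam n := Nat.one_div_pos_of_nat

theorem regParam_le_one (n : ℕ) : regParam n ≤ 1 := by
  unfold regParam
  rw [div_le_one (by positivity)]
  linarith [(Nat.cast_nonneg n : (0 : ℝ) ≤ n)]

theorem tendsto_regParam : Tendsto regParam atTop (𝓝 0) :=
  tendsto_one_div_add_atTop_nhds_zero_nat

/-- Approximate profiles on `[a, a + n]` that are nonnegative and nonincreasing, starting from the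
height `M` at `a`. -/
def IsApproximation (d : ℕ) (p B a M : ℝ) (n : ℕ) (f v : ℝ → ℝ) : Prop :=
  IsRegularizedSolution d p (regParam n) B a (a + n) f v ∧ f a = M ∧ v a = regParam n ∧
    ∀ z ∈ Icc a (a + n), 0 ≤ f z ∧ 0 ≤ v z

/-- The range of heights does not depend on `n` and stays strictly above the equilibrium, so the
limit cannot degenerate to the constant solution. -/
theorem exists_approximation_height (hd : 2 ≤ d) (hp : (d : ℝ) < p) :
    ∃ M₁ M₂ : ℝ, equilibrium p < M₁ ∧ ∀ᶠ n : ℕ in atTop, ∃ M ∈ Icc M₁ M₂, ∃ f v : ℝ → ℝ,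
      IsApproximation d p M₂ 0 M n f v := by
  have hp1 := one_lt_exponent hd hp
  have hβ := beta_pos hd hp
  have he := equilibrium_pos hp1
  have hpp : 0 < p - 1 := by linarith
  set M₂ := equilibrium p + (equilibrium p / (p - 1) + 1) / beta d p with hM₂
  have hM₂e : equilibrium p < M₂ := by
    have : 0 < (equilibrium p / (p - 1) + 1) / beta d p := by positivity
    linarith
  obtain ⟨M₁, hM₁, hM₁₂, δ₀, hδ₀, hsmall⟩ :=
    IsRegularizedSolution.exists_small_height hd hp hM₂e
  refine ⟨M₁, M₂, hM₁, ?_⟩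
  filter_upwards [tendsto_regParam.eventually_le_const hδ₀, eventually_ge_atTop 1] with n hn hn1
  have hn1' : (1 : ℝ) ≤ n := by exact_mod_cast hn1
  have hmem : ∀ s ∈ Icc (0 : ℝ) 1, M₁ + s * (M₂ - M₁) ∈ Icc M₁ M₂ := by
    intro s hs
    have h1 := mul_nonneg hs.1 (sub_nonneg.2 hM₁₂.le)
    have h2 := mul_le_mul_of_nonneg_right hs.2 (sub_nonneg.2 hM₁₂.le)
    constructor <;> linarith
  obtain ⟨s, hs, f, v, h1, h2, h3, h4⟩ := exists_nonneg_regularizedSolution hd hp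
    (regParam_pos n) (regParam_le_one n) hM₂e.le (R := M₂ + 1) (T := n) (by linarith) (by linarith)
    (γ := fun s => (0, M₁ + s * (M₂ - M₁))) (by fun_prop)
    (fun s hs => ⟨⟨le_rfl, by linarith⟩,
      ⟨by linarith [(hmem s hs).1], by linarith [(hmem s hs).2]⟩⟩)
    (fun f v h e1 e2 => by
      simp only [zero_mul, add_zero, zero_add] at h e1 e2 ⊢
      exact hsmall (regParam_pos n) hn hn1' h e1 e2)
    (fun f v h e1 e2 => by
      simp only [zero_add, one_mul, add_sub_cancel] at h e1 e2 ⊢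
      refine h.snd_nonneg_of_large_height hd hp (regParam_pos n) hM₂e.le e2 ?_
      rw [e1, hM₂, add_sub_cancel_left, mul_div_cancel₀ _ hβ.ne']
      linarith)
  exact ⟨_, hmem s hs, f, v, h1, h2, h3, h4⟩

/-- Here the path moves the interface at fixed height; the bound `a₁ > 0`, uniform in `n`, keeps it
away from the origin in the limit. -/
theorem exists_approximation_interface (hd : 2 ≤ d) (hp : (d : ℝ) < p) :
    ∃ a₁ a₂ : ℝ, 0 < a₁ ∧ ∀ᶠ n : ℕ in atTop, ∃ a ∈ Icc a₁ a₂, ∃ f v : ℝ → ℝ,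
      IsApproximation d p (equilibrium p) a (equilibrium p) n f v := by
  have hp1 := one_lt_exponent hd hp
  have hβ := beta_pos hd hp
  have he := equilibrium_pos hp1
  have hpp : 0 < p - 1 := by linarith
  have hd2 : (2 : ℝ) ≤ d := by exact_mod_cast hd
  have hd1 : 0 < (d : ℝ) - 1 := by linarith
  set κ : ℝ := ((d : ℝ) - 1) * (beta d p / 2) * (beta d p / 2) with hκ
  have hκ0 : 0 < κ := by positivity
  set a₂ : ℝ := 1 + 1 / κ + (equilibrium p / (p - 1) + 1) / beta d p with ha₂
  have ha₂1 : 1 ≤ a₂ := by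
    have h1 : 0 < 1 / κ := by positivity
    have h2 : 0 < (equilibrium p / (p - 1) + 1) / beta d p := by positivity
    linarith
  have ha₂κ : 1 ≤ κ * a₂ := by
    have h2 : 0 < (equilibrium p / (p - 1) + 1) / beta d p := by positivity
    have : 1 / κ ≤ a₂ := by linarith
    calc 1 = κ * (1 / κ) := by field_simp
      _ ≤ κ * a₂ := by gcongr
  have ha₂β : equilibrium p / (p - 1) < beta d p * a₂ := by
    have h1 : 0 < 1 / κ := by positivity
    calc equilibrium p / (p - 1) < equilibrium p / (p - 1) + 1 := by linarith
      _ = beta d p * ((equilibrium p / (p - 1) + 1) / beta d p) := by field_simp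
      _ ≤ beta d p * a₂ := by
        gcongr
        linarith
  obtain ⟨a₁, ha₁, ha₁₂, δ₀, hδ₀, hsmall⟩ :=
    IsRegularizedSolution.exists_small_interface hd hp le_rfl (show 0 < a₂ by linarith)
  refine ⟨a₁, a₂, ha₁, ?_⟩
  filter_upwards [tendsto_regParam.eventually_le_const hδ₀, eventually_ge_atTop 1,
    tendsto_natCast_atTop_atTop.eventually_ge_atTop a₂] with n hn hn1 hna
  have hn1' : (1 : ℝ) ≤ n := by exact_mod_cast hn1
  have hmem : ∀ s ∈ Icc (0 : ℝ) 1, a₁ + s * (a₂ - a₁) ∈ Icc a₁ a₂ := by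
    intro s hs
    have h1 := mul_nonneg hs.1 (sub_nonneg.2 ha₁₂.le)
    have h2 := mul_le_mul_of_nonneg_right hs.2 (sub_nonneg.2 ha₁₂.le)
    constructor <;> linarith
  obtain ⟨s, hs, f, v, h1, h2, h3, h4⟩ := exists_nonneg_regularizedSolution hd hp
    (regParam_pos n) (regParam_le_one n) le_rfl (R := a₂ + equilibrium p) (T := n)
    (by linarith) (by linarith)
    (γ := fun s => (a₁ + s * (a₂ - a₁), equilibrium p)) (by fun_prop)
    (fun s hs => ⟨⟨by linarith [(hmem s hs).1], by linarith [(hmem s hs).2]⟩,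
      ⟨he.le, by linarith⟩⟩)
    (fun f v h e1 e2 => by
      simp only [zero_mul, add_zero] at h e1 e2 ⊢
      exact hsmall (regParam_pos n) hn (by linarith) h e1 e2)
    (fun f v h e1 e2 => by
      simp only [one_mul, add_sub_cancel] at h e1 e2 ⊢
      refine h.snd_nonneg_of_large_interface hd hp (regParam_pos n) (regParam_le_one n) le_rfl
        (by linarith) e1 e2 ?_ ?_ ha₂β
      · have := beta_lt_quarter hd hp
        nlinarith
      · have h5 : (1 : ℝ) ≤ a₂ ^ d := one_le_pow₀ ha₂1
        calc (1 : ℝ) ≤ κ * a₂ * 1 := by linarith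
          _ ≤ κ * a₂ * a₂ ^ d := by gcongr
          _ = _ := by
            rw [hκ]
            ring)
  exact ⟨_, hmem s hs, f, v, h1, h2, h3, h4⟩

end Shooting

/-! ### Compactness and removal of the regularization -/

section Limits

/-- Passing to the limit in a derivative, for pointwise limits of functions whose derivatives
converge jointly in the index and the point. -/
theorem hasDerivAt_of_tendsto_prod {U : Filter ℕ} [NeBot U] {F D : ℕ → ℝ → ℝ} {G : ℝ → ℝ}
    {x L : ℝ} (hF : ∀ᶠ q : ℕ × ℝ in U ×ˢ 𝓝 x, HasDerivAt (F q.1) (D q.1 q.2) q.2)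
    (hG : ∀ᶠ y in 𝓝 x, Tendsto (fun n => F n y) U (𝓝 (G y)))
    (hD : Tendsto (fun q : ℕ × ℝ => D q.1 q.2) (U ×ˢ 𝓝 x) (𝓝 L)) : HasDerivAt G L x := by
  refine hasDerivAt_of_tendstoUniformlyOnFilter (g' := fun _ => L) ?_ hF hG
  rw [tendstoUniformlyOnFilter_iff_tendsto]
  exact Uniform.tendsto_nhds_right.1 hD

/-- A Lipschitz constant common to all indices upgrades convergence at one point to joint
convergence, as required by `hasDerivAt_of_tendsto_prod`. -/
theorem tendsto_prod_of_lipschitz {U : Filter ℕ} {F : ℕ → ℝ → ℝ} {x L K : ℝ}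
    (hF : ∀ᶠ q : ℕ × ℝ in U ×ˢ 𝓝 x, |F q.1 q.2 - F q.1 x| ≤ K * |q.2 - x|)
    (hL : Tendsto (fun n => F n x) U (𝓝 L)) :
    Tendsto (fun q : ℕ × ℝ => F q.1 q.2) (U ×ˢ 𝓝 x) (𝓝 L) := by
  have h1 : Tendsto (fun q : ℕ × ℝ => F q.1 q.2 - F q.1 x) (U ×ˢ 𝓝 x) (𝓝 0) := by
    refine squeeze_zero_norm' hF ?_
    have : Tendsto (fun y : ℝ => K * |y - x|) (𝓝 x) (𝓝 0) := by
      have : Continuous fun y : ℝ => K * |y - x| := by fun_prop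
      simpa using this.tendsto x
    exact this.comp tendsto_snd
  simpa using h1.add (hL.comp tendsto_fst)

theorem exists_tendsto_of_mem_Icc {U : Ultrafilter ℕ} {g : ℕ → ℝ} {a b : ℝ}
    (h : ∀ᶠ n in U, g n ∈ Icc a b) : ∃ x ∈ Icc a b, Tendsto g U (𝓝 x) := by
  obtain ⟨x, hx, hle⟩ := isCompact_Icc.ultrafilter_le_nhds (U.map g) (le_principal_iff.2 h)
  exact ⟨x, hx, hle⟩

end Limits

/-- Nonnegative solutions `f`, `v = |f'| ^ d` of the first order system for the profile that are
constant up to `a`, where `f = M`. -/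
structure IsLimitProfile (d : ℕ) (p a M : ℝ) (f v : ℝ → ℝ) : Prop where
  fst_nonneg : ∀ z, 0 ≤ f z
  snd_nonneg : ∀ z, 0 ≤ v z
  fst_eq : ∀ z ≤ a, f z = M
  snd_eq : ∀ z ≤ a, v z = 0
  continuous_fst : Continuous f
  continuous_snd : Continuous v
  hasDerivAt_fst : ∀ z, a < z → HasDerivAt f (-(v z ^ (1 / (d : ℝ)))) z
  hasDerivAt_snd : ∀ z, a < z → HasDerivAt v
    (d * z ^ (d - 1) * (beta d p * z * v z ^ (1 / (d : ℝ)) + reaction p (f z))) z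

section Bounds

variable {d : ℕ} {p B A : ℝ}

theorem exists_approximation_bounds (hd : 2 ≤ d) (hp : (d : ℝ) < p) (hB : equilibrium p ≤ B)
    (hA : 0 ≤ A) {T : ℝ} (hT : 0 ≤ T) :
    ∃ K, 0 ≤ K ∧ ∀ {a M : ℝ} {n : ℕ} {f v : ℝ → ℝ}, a ∈ Icc 0 A → M ≤ B →
      IsApproximation d p B a M n f v → T ≤ n →
      (∀ x ∈ Icc 0 T, f (a + x) ∈ Icc 0 B ∧ v (a + x) ∈ Icc 0 K) ∧
      ∀ x ∈ Icc 0 T, ∀ y ∈ Icc 0 T, |f (a + x) - f (a + y)| ≤ K * |x - y| ∧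
        |v (a + x) - v (a + y)| ≤ K * |x - y| := by
  have hp1 := one_lt_exponent hd hp
  have hβ := beta_pos hd hp
  have he := equilibrium_pos hp1
  have hd2 : (2 : ℝ) ≤ d := by exact_mod_cast hd
  have hB0 : 0 < B := he.trans_le hB
  obtain ⟨H, hH0, hH⟩ := exists_abs_truncReaction_le hp1 B
  set Z := A + T with hZ
  have hZ0 : 0 ≤ Z := by positivity
  set c : ℝ := d * Z ^ (d - 1) with hc
  have hc0 : 0 ≤ c := by positivity
  set V : ℝ := 1 + c * (beta d p * Z) * B + c * H * T with hV
  have hV1 : 1 ≤ V := by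
    have h1 : 0 ≤ c * (beta d p * Z) * B := by positivity
    have h2 : 0 ≤ c * H * T := by positivity
    linarith
  set K : ℝ := max V (c * (beta d p * Z * V + H)) with hK
  have hVK : V ≤ K := le_max_left _ _
  have hK0 : 0 ≤ K := by linarith
  refine ⟨K, hK0, ?_⟩
  intro a M n f v ha hM hs hTn
  obtain ⟨hs, hfa, hva, hnn⟩ := hs
  have hδ := regParam_pos n
  have hδ1 := regParam_le_one n
  have hsT : IsRegularizedSolution d p (regParam n) B a (a + T) f v := hs.mono le_rfl (by linarith)
  have hmem : ∀ x ∈ Icc 0 T, a + x ∈ Icc a (a + T) := fun x hx =>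
    ⟨by linarith [hx.1], by linarith [hx.2]⟩
  have hnn' : ∀ z ∈ Icc a (a + T), 0 ≤ f z ∧ 0 ≤ v z := fun z hz =>
    hnn z ⟨hz.1, by linarith [hz.2]⟩
  have haT : a ≤ a + T := by linarith
  have hfB : ∀ z ∈ Icc a (a + T), f z ≤ B := fun z hz =>
    (hsT.antitoneOn hδ (left_mem_Icc.2 haT) hz hz.1).trans (hfa ▸ hM)
  have hz0Z : ∀ z ∈ Icc a (a + T), 0 ≤ z ∧ z ≤ Z := fun z hz =>
    ⟨ha.1.trans hz.1, by linarith [hz.2, ha.2]⟩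
  have hcz : ∀ z ∈ Icc a (a + T), d * z ^ (d - 1) ≤ c := fun z hz => by
    obtain ⟨h1, h2⟩ := hz0Z z hz
    rw [hc]
    gcongr
  have hvV : ∀ z ∈ Icc a (a + T), v z ≤ V := by
    intro z hz
    have hza : a ≤ z := hz.1
    -- Since `f'` is minus the root, adding this multiple of the bounded function `f` absorbs the
    -- transport term and bounds `v` independently of `n`.
    have h1 := sub_le_of_hasDerivAt (g := fun z => v z + c * (beta d p * Z) * f z) (c := c * H)
      hza (fun y (hy : y ∈ Icc a z) => (hsT.2 y ⟨hy.1, hy.2.trans hz.2⟩).fun_add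
        ((hsT.1 y ⟨hy.1, hy.2.trans hz.2⟩).const_mul (c * (beta d p * Z)))) (fun y hy => by
          have hy' : y ∈ Icc a (a + T) := ⟨hy.1.le, hy.2.le.trans hz.2⟩
          obtain ⟨e1, e2⟩ := hz0Z y hy'
          have e3 := hcz y hy'
          have e4 := (abs_le.1 (hH (f y))).2
          have e5 := regRoot_nonneg (d := d) (v := v y) hδ
          have e6 : 0 ≤ d * y ^ (d - 1) := by positivity
          have e7 : d * y ^ (d - 1) * (beta d p * y * regRoot d (regParam n) (v y)) ≤
              c * (beta d p * Z * regRoot d (regParam n) (v y)) := by gcongr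
          have e8 : d * y ^ (d - 1) * truncReaction p B (f y) ≤ c * H :=
            (mul_le_mul_of_nonneg_left e4 e6).trans (mul_le_mul_of_nonneg_right e3 hH0.le)
          linarith)
    simp only [hva, hfa] at h1
    have h2 : 0 ≤ c * (beta d p * Z) * f z := by
      have := (hnn' z hz).1
      positivity
    have h3 : c * H * (z - a) ≤ c * H * T := by
      have : z - a ≤ T := by linarith [hz.2]
      gcongr
    have h4 : c * (beta d p * Z) * M ≤ c * (beta d p * Z) * B := by gcongr
    linarith
  have hroot : ∀ z ∈ Icc a (a + T), regRoot d (regParam n) (v z) ≤ V := by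
    intro z hz
    calc regRoot d (regParam n) (v z) ≤ (max (v z) (regParam n)) ^ (1 / (d : ℝ)) := regRoot_le hδ
      _ ≤ V ^ (1 / (d : ℝ)) := Real.rpow_le_rpow (hδ.le.trans (le_max_right _ _))
          (max_le (hvV z hz) (hδ1.trans hV1)) (by positivity)
      _ ≤ V ^ (1 : ℝ) := Real.rpow_le_rpow_of_exponent_le hV1 (by
          rw [div_le_one (by positivity)]
          linarith)
      _ = V := Real.rpow_one V
  refine ⟨fun x hx => ⟨⟨(hnn' _ (hmem x hx)).1, hfB _ (hmem x hx)⟩,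
    ⟨(hnn' _ (hmem x hx)).2, (hvV _ (hmem x hx)).trans hVK⟩⟩, fun x hx y hy => ⟨?_, ?_⟩⟩
  · have := (convex_Icc a (a + T)).norm_image_sub_le_of_norm_hasDerivWithin_le (C := K)
      (fun z hz => (hsT.1 z hz).hasDerivWithinAt) (fun z hz => by
        rw [norm_neg, Real.norm_eq_abs, abs_of_nonneg (regRoot_nonneg hδ)]
        exact (hroot z hz).trans hVK) (hmem y hy) (hmem x hx)
    simpa [Real.norm_eq_abs] using this
  · have := (convex_Icc a (a + T)).norm_image_sub_le_of_norm_hasDerivWithin_le (C := K)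
      (fun z hz => (hsT.2 z hz).hasDerivWithinAt) (fun z hz => by
        obtain ⟨e1, e2⟩ := hz0Z z hz
        have e3 := hcz z hz
        have e4 := hroot z hz
        have e5 := regRoot_nonneg (d := d) (v := v z) hδ
        have e6 : 0 ≤ d * z ^ (d - 1) := by positivity
        refine le_trans ?_ (le_max_right V _)
        rw [Real.norm_eq_abs, abs_mul, abs_of_nonneg e6]
        refine mul_le_mul e3 ((abs_add_le _ _).trans (add_le_add ?_ (hH _))) (abs_nonneg _) hc0
        rw [abs_of_nonneg (by positivity)]
        gcongr) (hmem y hy) (hmem x hx)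
    simpa [Real.norm_eq_abs] using this

end Bounds

theorem tendsto_regRoot {d : ℕ} (hd : 2 ≤ d) {ι : Type*} {l : Filter ι} {δ w : ι → ℝ} {x : ℝ}
    (hδ : ∀ i, 0 < δ i) (hδ0 : Tendsto δ l (𝓝 0)) (hw : Tendsto w l (𝓝 x)) (hx : 0 ≤ x) :
    Tendsto (fun i => regRoot d (δ i) (w i)) l (𝓝 (x ^ (1 / (d : ℝ)))) := by
  have hq : 0 < 1 / (d : ℝ) := by positivity
  have h1 : Tendsto (fun i => regRoot d (δ i) (w i) - (max (w i) 0) ^ (1 / (d : ℝ))) l (𝓝 0) := by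
    refine squeeze_zero_norm (fun i => abs_regRoot_sub_le hd (hδ i)) ?_
    have := ((Real.continuousAt_rpow_const 0 (1 / (d : ℝ)) (Or.inr hq.le)).tendsto).comp hδ0
    rwa [Real.zero_rpow hq.ne'] at this
  have h2 : Tendsto (fun i => (max (w i) 0) ^ (1 / (d : ℝ))) l (𝓝 (x ^ (1 / (d : ℝ)))) := by
    have := ((Real.continuousAt_rpow_const (max x 0) (1 / (d : ℝ)) (Or.inr hq.le)).tendsto).comp
      (hw.max tendsto_const_nhds)
    rwa [max_eq_left hx] at this
  simpa using h1.add h2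

/-- Approximations converge to a solution along a suitable filter. -/
theorem exists_limitProfile {d : ℕ} {p B A : ℝ} (hd : 2 ≤ d) (hp : (d : ℝ) < p)
    (hB : equilibrium p ≤ B) (hA : 0 ≤ A) {a M : ℕ → ℝ} {f v : ℕ → ℝ → ℝ}
    (h : ∀ᶠ n in atTop, a n ∈ Icc 0 A ∧ M n ∈ Icc (equilibrium p) B ∧
      IsApproximation d p B (a n) (M n) n (f n) (v n)) :
    ∃ U : Filter ℕ, NeBot U ∧ U ≤ atTop ∧ ∃ a₀ M₀ : ℝ, ∃ F V : ℝ → ℝ,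
      Tendsto a U (𝓝 a₀) ∧ Tendsto M U (𝓝 M₀) ∧
      (∀ τ, 0 ≤ τ → Tendsto (fun n => v n (a n + τ)) U (𝓝 (V (a₀ + τ)))) ∧
      IsLimitProfile d p a₀ M₀ F V := by
  have hp1 := one_lt_exponent hd hp
  have hqd : 1 / (d : ℝ) ≠ 0 := by positivity
  -- Along an ultrafilter all bounded sequences converge at once, so no diagonal subsequence over
  -- the points `τ` is needed.
  set U : Ultrafilter ℕ := Ultrafilter.of atTop with hU
  have hUtop : (U : Filter ℕ) ≤ atTop := Ultrafilter.of_le atTop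
  have hUev : ∀ᶠ n in (U : Filter ℕ), a n ∈ Icc 0 A ∧ M n ∈ Icc (equilibrium p) B ∧
      IsApproximation d p B (a n) (M n) n (f n) (v n) := hUtop h
  have hUge : ∀ T : ℝ, ∀ᶠ n : ℕ in (U : Filter ℕ), T ≤ n := fun T =>
    hUtop (tendsto_natCast_atTop_atTop.eventually_ge_atTop T)
  obtain ⟨a₀, ha₀, ha⟩ := exists_tendsto_of_mem_Icc (hUev.mono fun n hn => hn.1)
  obtain ⟨M₀, hM₀, hM⟩ := exists_tendsto_of_mem_Icc (hUev.mono fun n hn => hn.2.1)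
  have hbd : ∀ T : ℝ, 0 ≤ T → ∃ K, 0 ≤ K ∧ ∀ᶠ n in (U : Filter ℕ),
      (∀ x ∈ Icc 0 T, f n (a n + x) ∈ Icc 0 B ∧ v n (a n + x) ∈ Icc 0 K) ∧
      ∀ x ∈ Icc 0 T, ∀ y ∈ Icc 0 T, |f n (a n + x) - f n (a n + y)| ≤ K * |x - y| ∧
        |v n (a n + x) - v n (a n + y)| ≤ K * |x - y| := by
    intro T hT
    obtain ⟨K, hK, hKb⟩ := exists_approximation_bounds hd hp hB hA hT
    refine ⟨K, hK, ?_⟩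
    filter_upwards [hUev, hUge T] with n hn hn'
    exact hKb hn.1 hn.2.1.2 hn.2.2 hn'
  have hlim : ∀ τ : ℝ, ∃ y w : ℝ, 0 ≤ τ → y ∈ Icc 0 B ∧ 0 ≤ w ∧
      Tendsto (fun n => f n (a n + τ)) U (𝓝 y) ∧ Tendsto (fun n => v n (a n + τ)) U (𝓝 w) := by
    intro τ
    by_cases hτ : 0 ≤ τ
    · obtain ⟨K, hK, hKb⟩ := hbd τ hτ
      obtain ⟨y, hy, hy'⟩ := exists_tendsto_of_mem_Icc
        (hKb.mono fun n hn => (hn.1 τ (right_mem_Icc.2 hτ)).1)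
      obtain ⟨w, hw, hw'⟩ := exists_tendsto_of_mem_Icc
        (hKb.mono fun n hn => (hn.1 τ (right_mem_Icc.2 hτ)).2)
      exact ⟨y, w, fun _ => ⟨hy, hw.1, hy', hw'⟩⟩
    · exact ⟨0, 0, fun h' => absurd h' hτ⟩
  -- The limits are functions of the distance `τ` from the start, because the starting points `a n`
  -- vary.
  choose φ ω hφω using hlim
  have hf0 : φ 0 = M₀ := by
    refine tendsto_nhds_unique (hφω 0 le_rfl).2.2.1 (hM.congr' ?_)
    filter_upwards [hUev] with n hn
    rw [add_zero, hn.2.2.2.1]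
  have hreg : Tendsto regParam U (𝓝 0) := tendsto_regParam.mono_left hUtop
  have hv0 : ω 0 = 0 := by
    refine tendsto_nhds_unique (hφω 0 le_rfl).2.2.2 (hreg.congr' ?_)
    filter_upwards [hUev] with n hn
    rw [add_zero, hn.2.2.2.2.1]
  have hcont : ContinuousOn φ (Ici 0) ∧ ContinuousOn ω (Ici 0) := by
    have key : ∀ x₀ ∈ Ici (0 : ℝ), ContinuousWithinAt φ (Ici 0) x₀ ∧
        ContinuousWithinAt ω (Ici 0) x₀ := by
      intro x₀ hx₀
      have hx₀ : 0 ≤ x₀ := hx₀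
      obtain ⟨K, hK, hKb⟩ := hbd (x₀ + 1) (by linarith)
      have hlip : ∀ x ∈ Icc 0 (x₀ + 1), ∀ y ∈ Icc 0 (x₀ + 1),
          |φ x - φ y| ≤ K * |x - y| ∧ |ω x - ω y| ≤ K * |x - y| := by
        intro x hx y hy
        obtain ⟨-, -, e1, e2⟩ := hφω x hx.1
        obtain ⟨-, -, e3, e4⟩ := hφω y hy.1
        exact ⟨le_of_tendsto (e1.sub e3).abs (hKb.mono fun n hn => (hn.2 x hx y hy).1),
          le_of_tendsto (e2.sub e4).abs (hKb.mono fun n hn => (hn.2 x hx y hy).2)⟩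
      have hnh : Icc 0 (x₀ + 1) ∈ 𝓝[Ici 0] x₀ := by
        rw [← Ici_inter_Iic]
        exact inter_mem_nhdsWithin _ (Iic_mem_nhds (by linarith))
      have h1 : ContinuousOn φ (Icc 0 (x₀ + 1)) := (LipschitzOnWith.of_dist_le_mul
        (K := ⟨K, hK⟩) fun x hx y hy => by
          rw [Real.dist_eq, Real.dist_eq]
          exact (hlip x hx y hy).1).continuousOn
      have h2 : ContinuousOn ω (Icc 0 (x₀ + 1)) := (LipschitzOnWith.of_dist_le_mul
        (K := ⟨K, hK⟩) fun x hx y hy => by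
          rw [Real.dist_eq, Real.dist_eq]
          exact (hlip x hx y hy).2).continuousOn
      have hm : x₀ ∈ Icc 0 (x₀ + 1) := ⟨hx₀, by linarith⟩
      exact ⟨(h1 x₀ hm).mono_of_mem_nhdsWithin hnh, (h2 x₀ hm).mono_of_mem_nhdsWithin hnh⟩
    exact ⟨fun x hx => (key x hx).1, fun x hx => (key x hx).2⟩
  have hder : ∀ x, 0 < x → HasDerivAt φ (-(ω x ^ (1 / (d : ℝ)))) x ∧
      HasDerivAt ω (d * (a₀ + x) ^ (d - 1) *
        (beta d p * (a₀ + x) * ω x ^ (1 / (d : ℝ)) + reaction p (φ x))) x := by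
    intro x hx
    obtain ⟨hy, hw, e1, e2⟩ := hφω x hx.le
    obtain ⟨K, hK, hKb⟩ := hbd (x + 1) (by linarith)
    have hxn : Ioo 0 (x + 1) ∈ 𝓝 x := Ioo_mem_nhds hx (by linarith)
    have hxm : x ∈ Icc 0 (x + 1) := ⟨hx.le, by linarith⟩
    have hf2 : Tendsto (fun q : ℕ × ℝ => f q.1 (a q.1 + q.2)) (U ×ˢ 𝓝 x) (𝓝 (φ x)) :=
      tendsto_prod_of_lipschitz (F := fun n y => f n (a n + y)) (K := K)
        ((hKb.prod_mk (eventually_of_mem hxn fun y hy => hy)).mono fun q hq =>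
          (hq.1.2 q.2 (Ioo_subset_Icc_self hq.2) x hxm).1) e1
    have hv2 : Tendsto (fun q : ℕ × ℝ => v q.1 (a q.1 + q.2)) (U ×ˢ 𝓝 x) (𝓝 (ω x)) :=
      tendsto_prod_of_lipschitz (F := fun n y => v n (a n + y)) (K := K)
        ((hKb.prod_mk (eventually_of_mem hxn fun y hy => hy)).mono fun q hq =>
          (hq.1.2 q.2 (Ioo_subset_Icc_self hq.2) x hxm).2) e2
    have hr2 : Tendsto (fun q : ℕ × ℝ => regRoot d (regParam q.1) (v q.1 (a q.1 + q.2)))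
        (U ×ˢ 𝓝 x) (𝓝 (ω x ^ (1 / (d : ℝ)))) :=
      tendsto_regRoot hd (fun q => regParam_pos q.1) (hreg.comp tendsto_fst) hv2 hw
    have hz2 : Tendsto (fun q : ℕ × ℝ => a q.1 + q.2) (U ×ˢ 𝓝 x) (𝓝 (a₀ + x)) :=
      (ha.comp tendsto_fst).add tendsto_snd
    have hh2 : Tendsto (fun q : ℕ × ℝ => truncReaction p B (f q.1 (a q.1 + q.2)))
        (U ×ˢ 𝓝 x) (𝓝 (reaction p (φ x))) := by
      refine (((continuous_reaction hp1).tendsto _).comp hf2).congr' ?_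
      filter_upwards [hKb.prod_mk (eventually_of_mem hxn fun y hy => hy)] with q hq
      have := (hq.1.1 q.2 (Ioo_subset_Icc_self hq.2)).1
      exact (truncReaction_of_mem this.1 this.2).symm
    have hode : ∀ᶠ q : ℕ × ℝ in U ×ˢ 𝓝 x,
        IsRegularizedSolution d p (regParam q.1) B (a q.1) (a q.1 + q.1) (f q.1) (v q.1) ∧
        a q.1 + q.2 ∈ Icc (a q.1) (a q.1 + q.1) := by
      filter_upwards [(hUev.and (hUge (x + 1))).prod_mk
        (eventually_of_mem hxn fun y hy => hy)] with q hq
      have h1 := hq.2.1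
      have h2 := hq.2.2
      have h3 := hq.1.2
      exact ⟨hq.1.1.2.2.1, by linarith, by linarith⟩
    have hnear : ∀ᶠ y in 𝓝 x, 0 ≤ y := by
      filter_upwards [hxn] with y hy using hy.1.le
    constructor
    · exact hasDerivAt_of_tendsto_prod (F := fun n y => f n (a n + y))
        (D := fun n y => -regRoot d (regParam n) (v n (a n + y)))
        (hode.mono fun q hq => (hq.1.1 _ hq.2).comp_const_add (a q.1) q.2)
        (hnear.mono fun y hy => (hφω y hy).2.2.1) hr2.neg
    · refine hasDerivAt_of_tendsto_prod (F := fun n y => v n (a n + y))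
        (D := fun n y => d * (a n + y) ^ (d - 1) *
          (beta d p * (a n + y) * regRoot d (regParam n) (v n (a n + y)) +
            truncReaction p B (f n (a n + y))))
        (hode.mono fun q hq => (hq.1.2 _ hq.2).comp_const_add (a q.1) q.2)
        (hnear.mono fun y hy => (hφω y hy).2.2.2) ?_
      exact ((hz2.pow (d - 1)).const_mul (d : ℝ)).mul (((hz2.const_mul _).mul hr2).add hh2)
  -- Composition with `max (z - a₀) 0` extends the limits by their initial values `M₀` and `0` to
  -- the left of `a₀`.
  have hmax : Continuous fun z : ℝ => max (z - a₀) 0 := by fun_prop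
  have hmaxmem : ∀ z : ℝ, max (z - a₀) 0 ∈ Ici (0 : ℝ) := fun z => le_max_right (z - a₀) 0
  have hnhds : ∀ z, a₀ < z → ∀ g : ℝ → ℝ,
      (fun y => g (max (y - a₀) 0)) =ᶠ[𝓝 z] fun y => g (y - a₀) := by
    intro z hz g
    filter_upwards [Ioi_mem_nhds hz] with y hy
    rw [max_eq_left (by linarith [mem_Ioi.1 hy])]
  refine ⟨U, inferInstance, hUtop, a₀, M₀, fun z => φ (max (z - a₀) 0),
    fun z => ω (max (z - a₀) 0), ha, hM, fun τ hτ => ?_, ?_⟩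
  · simp only [add_sub_cancel_left, max_eq_left hτ]
    exact (hφω τ hτ).2.2.2
  · refine ⟨fun z => (hφω _ (hmaxmem z)).1.1, fun z => (hφω _ (hmaxmem z)).2.1, fun z hz => ?_,
      fun z hz => ?_, hcont.1.comp_continuous hmax hmaxmem, hcont.2.comp_continuous hmax hmaxmem,
      fun z hz => ?_, fun z hz => ?_⟩
    · simp only [max_eq_right (sub_nonpos.2 hz), hf0]
    · simp only [max_eq_right (sub_nonpos.2 hz), hv0]
    · have h1 := ((hder (z - a₀) (by linarith)).1.comp_sub_const z a₀).congr_of_eventuallyEq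
        (hnhds z hz φ)
      simpa only [max_eq_left (sub_nonneg.2 hz.le)] using h1
    · have h1 := ((hder (z - a₀) (by linarith)).2.comp_sub_const z a₀).congr_of_eventuallyEq
        (hnhds z hz ω)
      simp only [add_sub_cancel] at h1
      simpa only [max_eq_left (sub_nonneg.2 hz.le)] using h1

/-! ### Positivity and decay of limit profiles -/

namespace IsLimitProfile

variable {d : ℕ} {p a M : ℝ} {f v : ℝ → ℝ}

theorem antitone (h : IsLimitProfile d p a M f v) : Antitone f := by
  have h1 : AntitoneOn f (Ici a) := by
    refine antitoneOn_of_deriv_nonpos (convex_Ici a) h.continuous_fst.continuousOn ?_ ?_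
    · rw [interior_Ici]
      exact fun z hz => (h.hasDerivAt_fst z hz).differentiableAt.differentiableWithinAt
    · rw [interior_Ici]
      intro z hz
      rw [(h.hasDerivAt_fst z hz).deriv]
      exact neg_nonpos.2 (Real.rpow_nonneg (h.snd_nonneg z) _)
  intro x y hxy
  rcases le_total y a with hy | hy
  · rw [h.fst_eq x (hxy.trans hy), h.fst_eq y hy]
  rcases le_total x a with hx | hx
  · rw [h.fst_eq x hx, ← h.fst_eq a le_rfl]
    exact h1 self_mem_Ici hy hy
  · exact h1 hx hy hxy

theorem fst_le (h : IsLimitProfile d p a M f v) (z : ℝ) : f z ≤ M := by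
  rw [← h.fst_eq (min z a) (min_le_right _ _)]
  exact h.antitone (min_le_left _ _)

theorem fst_le_sub (h : IsLimitProfile d p a M f v) {x y : ℝ} (hx : a < x) (hxy : x ≤ y)
    (hm : MonotoneOn v (Icc x y)) : f y ≤ f x - v x ^ (1 / (d : ℝ)) * (y - x) := by
  have := sub_le_of_hasDerivAt (c := -(v x ^ (1 / (d : ℝ)))) hxy
    (fun z (hz : z ∈ Icc x y) => h.hasDerivAt_fst z (hx.trans_le hz.1)) (fun z hz =>
      neg_le_neg (Real.rpow_le_rpow (h.snd_nonneg x)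
        (hm (left_mem_Icc.2 hxy) (Ioo_subset_Icc_self hz) hz.1.le) (by positivity)))
  linarith

/-- A nonnegative profile cannot have `v` bounded away from zero by monotonicity. -/
theorem not_forall_monotoneOn (h : IsLimitProfile d p a M f v) {x : ℝ} (hx : a < x)
    (hv : 0 < v x) : ¬ ∀ y, x ≤ y → MonotoneOn v (Icc x y) := by
  intro hm
  have hg : 0 < v x ^ (1 / (d : ℝ)) := Real.rpow_pos_of_pos hv _
  have hfx := h.fst_nonneg x
  set y := x + (f x + 1) / v x ^ (1 / (d : ℝ)) with hy
  have hxy : x ≤ y := by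
    have : 0 < (f x + 1) / v x ^ (1 / (d : ℝ)) := by positivity
    linarith
  have h1 := h.fst_le_sub hx hxy (hm y hxy)
  have h2 : v x ^ (1 / (d : ℝ)) * (y - x) = f x + 1 := by
    rw [hy]
    field_simp
    ring
  linarith [h.fst_nonneg y]

/-- The transport term never dominates the linear damping. -/
theorem mul_rpow_le (h : IsLimitProfile d p a M f v) (hd : 2 ≤ d) (hp : (d : ℝ) < p) (ha : 0 ≤ a)
    {z : ℝ} (hz : a < z) : beta d p * z * v z ^ (1 / (d : ℝ)) ≤ f z / (p - 1) := by
  have hp1 := one_lt_exponent hd hp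
  have hβ := beta_pos hd hp
  by_contra! hneg
  have hz0 : 0 < z := ha.trans_lt hz
  have hq : 0 < 1 / (d : ℝ) := by positivity
  have hvz : 0 < v z := by
    refine (h.snd_nonneg z).lt_of_ne fun h0 => ?_
    rw [← h0, Real.zero_rpow hq.ne', mul_zero] at hneg
    have h1 : 0 ≤ f z / (p - 1) := div_nonneg (h.fst_nonneg z) (by linarith)
    linarith
  -- If transport ever dominated, `v` would be nondecreasing from then on and `f` would fall below
  -- zero at a linear rate. The root is extended by zero to negative arguments to fit the general
  -- barrier lemma.
  refine h.not_forall_monotoneOn hz hvz fun y hy => ?_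
  have hv : ∀ x, (max (v x) 0) = v x := fun x => max_eq_left (h.snd_nonneg x)
  refine monotoneOn_of_transport_dominates (d := d) (f := f) (H := fun z => reaction p (f z))
    (ρ := fun x => (max x 0) ^ (1 / (d : ℝ))) hp1 hβ (fun x y hxy => ?_) ?_
    (fun x => Real.rpow_nonneg (le_max_right _ _) _) hz0 (fun x hx => ?_) (fun x hx => ?_)
    (fun x hx => ?_) ?_
  · exact Real.rpow_le_rpow (le_max_right _ _) (max_le_max hxy le_rfl) hq.le
  · exact (Real.continuous_rpow_const hq.le).comp (continuous_id.max continuous_const)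
  · simp only [hv]
    exact h.hasDerivAt_fst x (hz.trans_le hx.1)
  · simp only [hv]
    exact h.hasDerivAt_snd x (hz.trans_le hx.1)
  · rw [max_eq_left (h.fst_nonneg x)]
    exact neg_div_le_reaction (h.fst_nonneg x)
  · rw [max_eq_left (h.fst_nonneg z)]
    simpa only [hv] using hneg

/-- Dividing `mul_rpow_le` by `β` gives `z |f'| ≤ γ f`, which is the sign of the derivative of `f z
^ γ`. -/
theorem monotoneOn_mul_rpow (h : IsLimitProfile d p a M f v) (hd : 2 ≤ d) (hp : (d : ℝ) < p)
    (ha : 0 ≤ a) : MonotoneOn (fun z => f z * z ^ (2 * d / (p - d))) (Ioi a) := by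
  have hp1 := one_lt_exponent hd hp
  have hβ := beta_pos hd hp
  set γ : ℝ := 2 * d / (p - d) with hγ
  have hγβ : γ * beta d p = 1 / (p - 1) := decayExponent_mul_beta hd hp
  have hder : ∀ z ∈ Ioi a, HasDerivAt (fun z => f z * z ^ γ)
      (-(v z ^ (1 / (d : ℝ))) * z ^ γ + f z * (γ * z ^ (γ - 1))) z := fun z hz =>
    (h.hasDerivAt_fst z hz).fun_mul
      (Real.hasDerivAt_rpow_const (Or.inl (ha.trans_lt (mem_Ioi.1 hz)).ne'))
  refine monotoneOn_of_deriv_nonneg (convex_Ioi a)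
    (fun z hz => (hder z hz).continuousAt.continuousWithinAt) ?_ ?_
  · rw [interior_Ioi]
    exact fun z hz => (hder z hz).differentiableAt.differentiableWithinAt
  · rw [interior_Ioi]
    intro z hz
    have hz0 : 0 < z := ha.trans_lt hz
    rw [(hder z hz).deriv, Real.rpow_sub_one hz0.ne']
    have h1 := h.mul_rpow_le hd hp ha hz
    rw [div_eq_mul_one_div (f z), ← hγβ] at h1
    have h2 : v z ^ (1 / (d : ℝ)) * z ≤ f z * γ := by
      have h3 : beta d p * (v z ^ (1 / (d : ℝ)) * z) ≤ beta d p * (f z * γ) := by linarith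
      exact le_of_mul_le_mul_left h3 hβ
    have h3 : -(v z ^ (1 / (d : ℝ))) * z ^ γ + f z * (γ * (z ^ γ / z)) =
        (f z * γ - v z ^ (1 / (d : ℝ)) * z) * (z ^ γ / z) := by
      field_simp
      ring
    rw [h3]
    have : 0 ≤ f z * γ - v z ^ (1 / (d : ℝ)) * z := by linarith
    have := Real.rpow_pos_of_pos hz0 γ
    positivity

/-- By continuity `f` is positive just after `a`, and from there the nondecreasing `f z ^ γ` cannot
return to zero. -/
theorem fst_pos (h : IsLimitProfile d p a M f v) (hd : 2 ≤ d) (hp : (d : ℝ) < p) (ha : 0 ≤ a)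
    (hM : 0 < M) (z : ℝ) : 0 < f z := by
  have hfa : f a = M := h.fst_eq a le_rfl
  have hev : ∀ᶠ y in 𝓝[>] a, 0 < f y :=
    ((h.continuous_fst.tendsto a).eventually_const_lt (hfa ▸ hM)).filter_mono nhdsWithin_le_nhds
  obtain ⟨y, hy, hay⟩ := (hev.and self_mem_nhdsWithin).exists
  have hay : a < y := hay
  rcases le_total z y with hzy | hzy
  · exact hy.trans_le (h.antitone hzy)
  have h1 := h.monotoneOn_mul_rpow hd hp ha hay (hay.trans_le hzy) hzy
  have hy0 : 0 < y := ha.trans_lt hay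
  have h2 : 0 < f z * z ^ (2 * d / (p - d)) :=
    (mul_pos hy (Real.rpow_pos_of_pos hy0 _)).trans_le h1
  exact pos_of_mul_pos_left h2 (Real.rpow_nonneg (hy0.le.trans hzy) _)

/-- A zero of `v` is a minimum, so `v' = 0` there and the reaction vanishes; as `f > 0`, this forces
`f ≥ f₀` up to that point. Then `v` is nondecreasing before its zero, hence identically zero, which
`hnt` excludes. -/
theorem snd_pos (h : IsLimitProfile d p a M f v) (hd : 2 ≤ d) (hp : (d : ℝ) < p) (ha : 0 ≤ a)
    (hM : 0 < M) (hnt : ∀ z, a < z → ∃ y ∈ Icc a z, v y ≠ 0) {z : ℝ} (hz : a < z) : 0 < v z := by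
  have hp1 := one_lt_exponent hd hp
  have hβ := beta_pos hd hp
  refine (h.snd_nonneg z).lt_of_ne fun h0 => ?_
  have hz0 : 0 < z := ha.trans_lt hz
  have hmin : IsLocalMin v z := Eventually.of_forall fun y => h0 ▸ h.snd_nonneg y
  have hder := hmin.hasDerivAt_eq_zero (h.hasDerivAt_snd z hz)
  have hq : (1 / (d : ℝ)) ≠ 0 := by positivity
  rw [← h0, Real.zero_rpow hq, mul_zero, zero_add] at hder
  have hr : reaction p (f z) = 0 := by
    rcases mul_eq_zero.1 hder with h' | h'
    · exact absurd h' (by positivity)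
    · exact h'
  have hfe : equilibrium p ≤ f z := by
    by_contra! h'
    exact (reaction_neg hp1 (h.fst_pos hd hp ha hM z) h').ne hr
  obtain ⟨y, hy, hvy⟩ := hnt z hz
  have hmono : MonotoneOn v (Icc a z) := by
    refine monotoneOn_of_deriv_nonneg (convex_Icc a z) h.continuous_snd.continuousOn ?_ ?_
    · rw [interior_Icc]
      exact fun x hx => (h.hasDerivAt_snd x hx.1).differentiableAt.differentiableWithinAt
    · rw [interior_Icc]
      intro x hx
      rw [(h.hasDerivAt_snd x hx.1).deriv]
      have h1 := reaction_nonneg hp1 (hfe.trans (h.antitone hx.2.le))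
      have h2 : 0 ≤ x := ha.trans hx.1.le
      have h3 := h.snd_nonneg x
      positivity
  have := hmono hy (right_mem_Icc.2 hz.le) hy.2
  exact hvy (le_antisymm (this.trans h0.ge) (h.snd_nonneg y))

theorem exists_fst_lt_equilibrium (h : IsLimitProfile d p a M f v) (hd : 2 ≤ d)
    (hp : (d : ℝ) < p) (ha : 0 ≤ a) (hv : ∀ z, a < z → 0 < v z) :
    ∃ z > a, f z < equilibrium p := by
  by_contra! hno
  have hp1 := one_lt_exponent hd hp
  have hβ := beta_pos hd hp
  have hz : a < a + 1 := by linarith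
  refine h.not_forall_monotoneOn hz (hv _ hz) fun y hy => ?_
  refine monotoneOn_Icc_of_hasDerivAt (fun x hx => h.hasDerivAt_snd x (hz.trans_le hx.1))
    fun x hx => ?_
  have h1 := reaction_nonneg hp1 (hno x (hz.trans hx.1))
  have h2 : 0 ≤ x := ha.trans (hz.trans hx.1).le
  have h3 := h.snd_nonneg x
  positivity

/-- The function `f + v / (d β z ^ d)`, in which the transport term cancels. -/
theorem hasDerivAt_corrected (h : IsLimitProfile d p a M f v) (hd : 2 ≤ d) (hp : (d : ℝ) < p)
    (ha : 0 ≤ a) {z : ℝ} (hz : a < z) :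
    HasDerivAt (fun z => f z + v z / (d * beta d p * z ^ d))
      ((reaction p (f z) - v z / z ^ d) / (beta d p * z)) z := by
  have hβ := beta_pos hd hp
  have hz0 : 0 < z := ha.trans_lt hz
  have hd0 : (d : ℝ) ≠ 0 := by positivity
  have h1 := (h.hasDerivAt_fst z hz).fun_add ((h.hasDerivAt_snd z hz).fun_div
    ((hasDerivAt_pow d z).const_mul (d * beta d p)) (by positivity))
  refine h1.congr_deriv ?_
  have : z ^ d = z ^ (d - 1) * z := by
    rw [← pow_succ]
    congr 1
    omega
  rw [this]
  field_simp
  ring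

theorem fst_le_corrected (h : IsLimitProfile d p a M f v) (hd : 2 ≤ d) (hp : (d : ℝ) < p)
    {z : ℝ} (hz : 0 < z) : f z ≤ f z + v z / (d * beta d p * z ^ d) := by
  have hβ := beta_pos hd hp
  have := h.snd_nonneg z
  have : 0 ≤ v z / (d * beta d p * z ^ d) := by positivity
  linarith

/-- Profiles decay at some algebraic rate. -/
theorem exists_decay (h : IsLimitProfile d p a M f v) (hd : 2 ≤ d) (hp : (d : ℝ) < p) (ha : 0 ≤ a)
    (hM : 0 < M) (hv : ∀ z, a < z → 0 < v z) :
    ∃ ν > (0 : ℝ), ∃ C > 0, ∃ b > a, 1 ≤ b ∧ f b ≤ equilibrium p ∧ ∀ z, b ≤ z → f z ≤ C * z ^ (-ν) := by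
  have hp1 := one_lt_exponent hd hp
  have hβ := beta_pos hd hp
  obtain ⟨b₀, hb₀, hfb₀⟩ := h.exists_fst_lt_equilibrium hd hp ha hv
  set b := max b₀ 1 with hb
  have hab : a < b := hb₀.trans_le (le_max_left _ _)
  have hfb : f b < equilibrium p := (h.antitone (le_max_left _ _)).trans_lt hfb₀
  have hb1 : 1 ≤ b := le_max_right _ _
  have hf := h.fst_pos hd hp ha hM
  set κ := 1 / (p - 1) - f b ^ (p - 1) with hκ
  have hκ0 : 0 < κ := by
    rw [hκ, ← equilibrium_rpow_sub_one hp1]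
    linarith [Real.rpow_lt_rpow (hf b).le hfb (show 0 < p - 1 by linarith)]
  have hd0 : (0 : ℝ) < d := by positivity
  -- For the corrected function `X`, `β z X' ≤ -κ f - v / z ^ d`. The rate `κ / β` controls the part
  -- `f` of `X` and the rate `d` the part `v / (d β z ^ d)`.
  set ν := min (κ / beta d p) d with hν
  have hν0 : 0 < ν := by positivity
  set X : ℝ → ℝ := fun z => f z + v z / (d * beta d p * z ^ d) with hX
  have hXpos : ∀ z, b ≤ z → 0 < X z := fun z hz =>
    (hf z).trans_le (h.fst_le_corrected hd hp (by linarith))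
  refine ⟨ν, hν0, X b * b ^ ν, ?_, b, hab, hb1, hfb.le, fun z hz => ?_⟩
  · have := hXpos b le_rfl
    positivity
  have hanti : X z * z ^ ν ≤ X b * b ^ ν := by
    refine antitoneOn_Icc_of_hasDerivAt (g := fun z => X z * z ^ ν)
      (fun x (hx : x ∈ Icc b z) => (h.hasDerivAt_corrected hd hp ha (hab.trans_le hx.1)).fun_mul
        (Real.hasDerivAt_rpow_const (Or.inl
          (show x ≠ 0 from (zero_lt_one.trans_le (hb1.trans hx.1)).ne')))) (fun x hx => ?_)
      (left_mem_Icc.2 hz) (right_mem_Icc.2 hz) hz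
    have hx0 : 0 < x := zero_lt_one.trans_le (hb1.trans hx.1.le)
    have hxν : 0 < x ^ ν := Real.rpow_pos_of_pos hx0 _
    have e1 : reaction p (f x) ≤ -κ * f x := by
      rw [reaction_eq_mul _ (hf x), hκ]
      have := Real.rpow_le_rpow (hf x).le (h.antitone hx.1.le) (show 0 ≤ p - 1 by linarith)
      have := hf x
      nlinarith
    set w := v x / x ^ d with hw
    have hw0 : 0 ≤ w := by
      have := h.snd_nonneg x
      positivity
    have e2 : X x = f x + w / (d * beta d p) := by
      rw [hX, hw]
      field_simp
    have e3 : ν * f x ≤ κ / beta d p * f x :=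
      mul_le_mul_of_nonneg_right (min_le_left _ _) (hf x).le
    have e4 : ν * (w / (d * beta d p)) ≤ w / beta d p := by
      calc ν * (w / (d * beta d p)) ≤ d * (w / (d * beta d p)) := by
            gcongr
            exact min_le_right _ _
        _ = w / beta d p := by field_simp
    have e5 : (reaction p (f x) - w) / beta d p + ν * X x ≤ 0 := by
      have : (reaction p (f x) - w) / beta d p ≤ (-κ * f x - w) / beta d p := by gcongr
      have e6 : (-κ * f x - w) / beta d p = -(κ / beta d p * f x) - w / beta d p := by ring
      rw [e2]
      linarith
    have e7 : (reaction p (f x) - w) / (beta d p * x) * x ^ ν + X x * (ν * x ^ (ν - 1)) =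
        ((reaction p (f x) - w) / beta d p + ν * X x) * (x ^ ν / x) := by
      rw [Real.rpow_sub_one hx0.ne']
      field_simp
    rw [e7]
    exact mul_nonpos_of_nonpos_of_nonneg e5 (by positivity)
  have hz0 : 0 < z := by linarith
  have h1 : f z * z ^ ν ≤ X b * b ^ ν :=
    (mul_le_mul_of_nonneg_right (h.fst_le_corrected hd hp hz0)
      (Real.rpow_nonneg hz0.le _)).trans hanti
  rw [Real.rpow_neg hz0.le, ← div_eq_mul_inv, le_div_iff₀ (Real.rpow_pos_of_pos hz0 _)]
  exact h1

theorem snd_le (h : IsLimitProfile d p a M f v) (hd : 2 ≤ d) (hp : (d : ℝ) < p) (ha : 0 ≤ a)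
    {z : ℝ} (hz : a < z) : v z ≤ (2 * d / (p - d) * (f z / z)) ^ d := by
  have hβ := beta_pos hd hp
  have hz0 : 0 < z := ha.trans_lt hz
  have h1 := h.mul_rpow_le hd hp ha hz
  rw [div_eq_mul_one_div (f z), ← decayExponent_mul_beta hd hp] at h1
  have h2 : v z ^ (1 / (d : ℝ)) ≤ 2 * d / (p - d) * (f z / z) := by
    rw [← mul_div_assoc, le_div_iff₀ hz0]
    have h3 : beta d p * (v z ^ (1 / (d : ℝ)) * z) ≤ beta d p * (2 * d / (p - d) * f z) := by
      linarith
    exact le_of_mul_le_mul_left h3 hβ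
  calc v z = (v z ^ (1 / (d : ℝ))) ^ d := by
        rw [one_div, Real.rpow_inv_natCast_pow (h.snd_nonneg z) (by omega)]
    _ ≤ _ := pow_le_pow_left₀ (Real.rpow_nonneg (h.snd_nonneg z) _) h2 d

/-- A profile is bounded by a multiple of `z ^ (-2 d / (p - d))`. -/
theorem exists_mul_rpow_le (h : IsLimitProfile d p a M f v) (hd : 2 ≤ d) (hp : (d : ℝ) < p)
    (ha : 0 ≤ a) (hM : 0 < M) (hv : ∀ z, a < z → 0 < v z) :
    ∃ C, ∃ b > a, ∀ z, b ≤ z → f z * z ^ (2 * d / (p - d)) ≤ C := by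
  have hp1 := one_lt_exponent hd hp
  have hβ := beta_pos hd hp
  have hd2 : (2 : ℝ) ≤ d := by exact_mod_cast hd
  have hpd : 0 < p - d := by linarith
  have hpp : 0 < p - 1 := by linarith
  obtain ⟨ν, hν, C, hC, b, hab, hb1, hfb, hdec⟩ := h.exists_decay hd hp ha hM hv
  have hf := h.fst_pos hd hp ha hM
  have he := equilibrium_pos hp1
  set γ : ℝ := 2 * d / (p - d) with hγ
  have hγ0 : 0 < γ := by positivity
  have hγβ : γ * beta d p = 1 / (p - 1) := decayExponent_mul_beta hd hp
  set X : ℝ → ℝ := fun z => f z + v z / (d * beta d p * z ^ d) with hX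
  -- Both errors carry a decaying factor relative to `X`: `f ^ p` gains `z ^ (-ν (p-1))` from the
  -- preliminary decay, and `v / z ^ d` gains `z ^ (-2d)` from `snd_le`.
  set σ : ℝ := min (ν * (p - 1)) (2 * d) with hσ
  have hσ0 : 0 < σ := by positivity
  set C₁ : ℝ := (C ^ (p - 1) + 1 / ((p - 1) * (d * beta d p)) * (γ ^ d * equilibrium p ^ (d - 1))) /
    beta d p with hC₁
  have hC₁0 : 0 < C₁ := by positivity
  -- Gronwall's argument for `z X' + γ X ≤ C₁ z ^ (-σ) X`: the right-hand coefficient is integrable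
  -- against `dz / z`, and the exponential is the integrating factor.
  have hexp : ∀ z, b ≤ z → X z * z ^ γ * Real.exp (C₁ / σ * z ^ (-σ)) ≤
      X b * b ^ γ * Real.exp (C₁ / σ * b ^ (-σ)) := by
    intro z hz
    refine antitoneOn_Icc_of_hasDerivAt
      (g := fun z => X z * z ^ γ * Real.exp (C₁ / σ * z ^ (-σ)))
      (fun x (hx : x ∈ Icc b z) =>
        have hx0 : x ≠ 0 := (zero_lt_one.trans_le (hb1.trans hx.1)).ne'
        ((h.hasDerivAt_corrected hd hp ha (hab.trans_le hx.1)).fun_mul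
          (Real.hasDerivAt_rpow_const (Or.inl hx0))).fun_mul
          (((Real.hasDerivAt_rpow_const (Or.inl hx0)).const_mul (C₁ / σ)).exp))
      (fun x hx => ?_) (left_mem_Icc.2 hz) (right_mem_Icc.2 hz) hz
    have hx1 : 1 ≤ x := hb1.trans hx.1.le
    have hx0 : 0 < x := zero_lt_one.trans_le hx1
    have hfx := hf x
    have hXx : f x ≤ X x := h.fst_le_corrected hd hp hx0
    have hX0 : 0 < X x := hfx.trans_le hXx
    set w := v x / x ^ d with hw
    have hw0 : 0 ≤ w := by
      have := h.snd_nonneg x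
      positivity
    have e2 : X x = f x + w / (d * beta d p) := by
      rw [hX, hw]
      field_simp
    have hxσ : 0 < x ^ (-σ) := Real.rpow_pos_of_pos hx0 _
    have e3 : f x ^ p ≤ C ^ (p - 1) * x ^ (-σ) * X x := by
      calc f x ^ p = f x ^ (p - 1) * f x := by
            rw [Real.rpow_sub_one hfx.ne']
            field_simp
        _ ≤ (C * x ^ (-ν)) ^ (p - 1) * X x := by
            gcongr
            exact hdec x hx.1.le
        _ = C ^ (p - 1) * x ^ (-(ν * (p - 1))) * X x := by
            rw [Real.mul_rpow hC.le (Real.rpow_nonneg hx0.le _), ← Real.rpow_mul hx0.le]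
            ring_nf
        _ ≤ C ^ (p - 1) * x ^ (-σ) * X x := by
            have : x ^ (-(ν * (p - 1))) ≤ x ^ (-σ) :=
              Real.rpow_le_rpow_of_exponent_le hx1 (neg_le_neg (min_le_left _ _))
            gcongr
    have e4 : w ≤ γ ^ d * equilibrium p ^ (d - 1) * x ^ (-σ) * X x := by
      have hfe : f x ≤ equilibrium p := (h.antitone hx.1.le).trans hfb
      have e5 : f x ^ d = f x ^ (d - 1) * f x := by
        rw [← pow_succ]
        congr 1
        omega
      have e6 : x ^ (-(2 * d : ℝ)) = (x ^ d * x ^ d)⁻¹ := by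
        rw [Real.rpow_neg hx0.le, ← pow_add, ← Real.rpow_natCast]
        congr 2
        push_cast
        ring
      calc w ≤ (γ * (f x / x)) ^ d / x ^ d := by
            rw [hw]
            gcongr
            exact h.snd_le hd hp ha (hab.trans hx.1)
        _ = γ ^ d * f x ^ (d - 1) * x ^ (-(2 * d : ℝ)) * f x := by
            rw [e6, mul_pow, div_pow (f x) x, e5]
            field_simp
        _ ≤ γ ^ d * equilibrium p ^ (d - 1) * x ^ (-σ) * X x := by
            have : x ^ (-(2 * d : ℝ)) ≤ x ^ (-σ) :=
              Real.rpow_le_rpow_of_exponent_le hx1 (neg_le_neg (min_le_right _ _))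
            gcongr
    have e7 : (reaction p (f x) - w) / beta d p + γ * X x ≤ C₁ * x ^ (-σ) * X x := by
      have e8 : (reaction p (f x) - w) / beta d p + γ * X x =
          (f x ^ p + 1 / ((p - 1) * (d * beta d p)) * w - w) / beta d p := by
        have : γ = 1 / (p - 1) / beta d p := by
          rw [← hγβ]
          field_simp
        rw [e2, this]
        unfold reaction
        field_simp
        ring
      rw [e8, div_le_iff₀ hβ]
      have e9 : C₁ * x ^ (-σ) * X x * beta d p = C ^ (p - 1) * x ^ (-σ) * X x +
          1 / ((p - 1) * (d * beta d p)) *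
            (γ ^ d * equilibrium p ^ (d - 1) * x ^ (-σ) * X x) := by
        rw [hC₁]
        field_simp
      rw [e9]
      have e10 : 1 / ((p - 1) * (d * beta d p)) * w ≤ 1 / ((p - 1) * (d * beta d p)) *
          (γ ^ d * equilibrium p ^ (d - 1) * x ^ (-σ) * X x) := by gcongr
      linarith
    have hxγ : 0 < x ^ γ := Real.rpow_pos_of_pos hx0 _
    have e11 : ((reaction p (f x) - w) / (beta d p * x) * x ^ γ + X x * (γ * x ^ (γ - 1))) *
          Real.exp (C₁ / σ * x ^ (-σ)) +
        X x * x ^ γ * (Real.exp (C₁ / σ * x ^ (-σ)) * (C₁ / σ * (-σ * x ^ (-σ - 1)))) =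
        ((reaction p (f x) - w) / beta d p + γ * X x - C₁ * x ^ (-σ) * X x) *
          (x ^ γ / x * Real.exp (C₁ / σ * x ^ (-σ))) := by
      rw [Real.rpow_sub_one hx0.ne', Real.rpow_sub_one hx0.ne']
      field_simp
      ring
    rw [e11]
    exact mul_nonpos_of_nonpos_of_nonneg (by linarith) (by positivity)
  refine ⟨X b * b ^ γ * Real.exp (C₁ / σ * b ^ (-σ)), b, hab, fun z hz => ?_⟩
  have hz0 : 0 < z := by linarith
  have hzγ : 0 < z ^ γ := Real.rpow_pos_of_pos hz0 _
  have h1 : 1 ≤ Real.exp (C₁ / σ * z ^ (-σ)) := Real.one_le_exp (by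
    have := Real.rpow_pos_of_pos hz0 (-σ)
    positivity)
  have h2 : f z ≤ X z := h.fst_le_corrected hd hp hz0
  have h3 : 0 < X z := (hf z).trans_le h2
  calc f z * z ^ γ ≤ X z * z ^ γ := by gcongr
    _ ≤ X z * z ^ γ * Real.exp (C₁ / σ * z ^ (-σ)) := le_mul_of_one_le_right (by positivity) h1
    _ ≤ _ := hexp z hz

/-- The asymptotic behaviour of profiles. -/
theorem exists_asymptotics (h : IsLimitProfile d p a M f v) (hd : 2 ≤ d) (hp : (d : ℝ) < p)
    (ha : 0 ≤ a) (hM : 0 < M) (hv : ∀ z, a < z → 0 < v z) :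
    ∃ C > 0, Tendsto (fun z => f z * z ^ (2 * d / (p - d))) atTop (𝓝 C) ∧
      ∃ K, ∀ z, 0 < z → f z * z ^ (2 * d / (p - d)) ≤ K := by
  have hpd : 0 < p - d := by linarith
  obtain ⟨K, b, hab, hK⟩ := h.exists_mul_rpow_le hd hp ha hM hv
  have hf := h.fst_pos hd hp ha hM
  have hmono := h.monotoneOn_mul_rpow hd hp ha
  set γ : ℝ := 2 * d / (p - d) with hγ
  have hγ0 : 0 < γ := by positivity
  have hb0 : 0 < b := ha.trans_lt hab
  have hbdd : BddAbove (range fun z : ℝ => f (max z b) * (max z b) ^ γ) :=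
    ⟨K, by
      rintro _ ⟨z, rfl⟩
      exact hK _ (le_max_right z b)⟩
  have hm : Monotone fun z : ℝ => f (max z b) * (max z b) ^ γ := fun x y hxy =>
    hmono (hab.trans_le (le_max_right x b)) (hab.trans_le (le_max_right y b))
      (max_le_max hxy le_rfl)
  have hlim := tendsto_atTop_ciSup hm hbdd
  refine ⟨_, ?_, hlim.congr' ?_, max K (M * b ^ γ), fun z hz => ?_⟩
  · refine lt_of_lt_of_le ?_ (le_ciSup hbdd b)
    have := hf b
    simp only [max_self]
    positivity
  · filter_upwards [eventually_ge_atTop b] with z hz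
    rw [max_eq_left hz]
  · rcases le_total b z with hz' | hz'
    · exact (hK z hz').trans (le_max_left _ _)
    · refine le_trans ?_ (le_max_right _ _)
      have h1 := h.fst_le z
      have h2 : z ^ γ ≤ b ^ γ := Real.rpow_le_rpow hz.le hz' hγ0.le
      have := hf z
      exact mul_le_mul h1 h2 (by positivity) hM.le

end IsLimitProfile

theorem abs_rpow_sub_one_mul_self {p x : ℝ} (hx : 0 < x) : |x| ^ (p - 1) * x = x ^ p := by
  rw [abs_of_pos hx, Real.rpow_sub_one hx.ne', div_mul_cancel₀ _ hx.ne']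

/-! ### The profile equation across the interface, and smoothness -/

namespace IsLimitProfile

variable {d : ℕ} {p a M : ℝ} {f v : ℝ → ℝ}

theorem continuous_root (h : IsLimitProfile d p a M f v) :
    Continuous fun z => v z ^ (1 / (d : ℝ)) :=
  h.continuous_snd.rpow_const fun _ => Or.inr (by positivity)

theorem hasDerivAt_fst_all (h : IsLimitProfile d p a M f v) (hd : 2 ≤ d) (z : ℝ) :
    HasDerivAt f (-(v z ^ (1 / (d : ℝ)))) z := by
  have hne : ∀ y, y ≠ a → HasDerivAt f (-(v y ^ (1 / (d : ℝ)))) y := by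
    intro y hy
    rcases hy.lt_or_gt with hlt | hgt
    · rw [h.snd_eq y hlt.le, Real.zero_rpow (by positivity), neg_zero]
      exact (hasDerivAt_const y M).congr_of_eventuallyEq
        ((gt_mem_nhds hlt).mono fun x hx => h.fst_eq x hx.le)
    · exact h.hasDerivAt_fst y hgt
  exact hasDerivAt_of_hasDerivAt_of_ne' (g := fun y => -(v y ^ (1 / (d : ℝ)))) hne
    h.continuous_fst.continuousAt h.continuous_root.neg.continuousAt z

/-- To the left of `a` the solution is constant, so the equation holds there only if the reaction
vanishes at `M`; for `a = 0` there is nothing on the left. At `a` itself the derivative is recovered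
from its continuous extension. -/
theorem hasDerivAt_snd_of_pos (h : IsLimitProfile d p a M f v) (hd : 2 ≤ d) (hp : (d : ℝ) < p)
    (haM : a = 0 ∨ M = equilibrium p) {z : ℝ} (hz : 0 < z) : HasDerivAt v
      (d * z ^ (d - 1) * (beta d p * z * v z ^ (1 / (d : ℝ)) + reaction p (f z))) z := by
  rcases haM with rfl | rfl
  · exact h.hasDerivAt_snd z hz
  have hp1 := one_lt_exponent hd hp
  have hne : ∀ y, y ≠ a → HasDerivAt v
      (d * y ^ (d - 1) * (beta d p * y * v y ^ (1 / (d : ℝ)) + reaction p (f y))) y := by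
    intro y hy
    rcases hy.lt_or_gt with hlt | hgt
    · rw [h.snd_eq y hlt.le, Real.zero_rpow (by positivity), h.fst_eq y hlt.le,
        reaction_equilibrium hp1, mul_zero, add_zero, mul_zero]
      exact (hasDerivAt_const y 0).congr_of_eventuallyEq
        ((gt_mem_nhds hlt).mono fun x hx => h.snd_eq x hx.le)
    · exact h.hasDerivAt_snd y hgt
  refine hasDerivAt_of_hasDerivAt_of_ne' (g := fun y => d * y ^ (d - 1) *
    (beta d p * y * v y ^ (1 / (d : ℝ)) + reaction p (f y))) hne
    h.continuous_snd.continuousAt (Continuous.continuousAt ?_) z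
  exact (continuous_const.mul (continuous_pow _)).mul
    (((continuous_const.mul continuous_id).mul h.continuous_root).add
      ((continuous_reaction hp1).comp h.continuous_fst))

theorem deriv_fst (h : IsLimitProfile d p a M f v) (hd : 2 ≤ d) :
    deriv f = fun z => -(v z ^ (1 / (d : ℝ))) :=
  funext fun z => (h.hasDerivAt_fst_all hd z).deriv

theorem root_pow (h : IsLimitProfile d p a M f v) (hd : 2 ≤ d) (z : ℝ) :
    (v z ^ (1 / (d : ℝ))) ^ d = v z := by
  rw [one_div, Real.rpow_inv_natCast_pow (h.snd_nonneg z) (by omega)]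

theorem flux_fst (h : IsLimitProfile d p a M f v) (hd : 2 ≤ d) : flux d f = fun z => -v z := by
  funext z
  have hg : 0 ≤ v z ^ (1 / (d : ℝ)) := Real.rpow_nonneg (h.snd_nonneg z) _
  unfold flux
  rw [h.deriv_fst hd]
  beta_reduce
  rw [abs_neg, abs_of_nonneg hg, mul_neg, ← pow_succ, Nat.sub_add_cancel (by omega), h.root_pow hd]

theorem tendsto_fst {γ C : ℝ} (hγ : 0 < γ)
    (hC : Tendsto (fun z => f z * z ^ γ) atTop (𝓝 C)) : Tendsto f atTop (𝓝 0) := by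
  have := hC.mul (tendsto_rpow_neg_atTop hγ)
  rw [mul_zero] at this
  refine this.congr' ?_
  filter_upwards [eventually_gt_atTop 0] with z hz
  rw [mul_assoc, ← Real.rpow_add hz, add_neg_cancel, Real.rpow_zero, mul_one]

theorem lowerOrder_fst (h : IsLimitProfile d p a M f v) (hd : 2 ≤ d) {z : ℝ} (hf : 0 < f z) :
    lowerOrder d p f z = beta d p * z * v z ^ (1 / (d : ℝ)) + reaction p (f z) := by
  unfold lowerOrder reaction
  rw [h.deriv_fst hd, abs_rpow_sub_one_mul_self hf]
  ring

theorem isProfile (h : IsLimitProfile d p a M f v) (hd : 2 ≤ d) (hp : (d : ℝ) < p)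
    (ha : 0 ≤ a) (hM : 0 < M) (haM : a = 0 ∨ M = equilibrium p) (h0 : Tendsto f atTop (𝓝 0)) :
    IsProfile d p f where
  contDiffOn := by
    refine (contDiff_one_iff_deriv.2 ⟨fun z => (h.hasDerivAt_fst_all hd z).differentiableAt, ?_⟩).contDiffOn
    rw [h.deriv_fst hd]
    exact h.continuous_root.neg
  nonneg z _ := h.fst_nonneg z
  deriv_nonpos z _ := by
    rw [h.deriv_fst hd]
    exact neg_nonpos.2 (Real.rpow_nonneg (h.snd_nonneg z) _)
  deriv_zero := by
    have := h.hasDerivAt_fst_all hd 0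
    rw [h.snd_eq 0 ha, Real.zero_rpow (by positivity), neg_zero] at this
    exact this.hasDerivWithinAt
  tendsto_zero := h0
  flux_differentiable z hz := by
    rw [h.flux_fst hd]
    exact (h.hasDerivAt_snd_of_pos hd hp haM hz).differentiableAt.fun_neg
  equation z hz := by
    rw [h.flux_fst hd, (h.hasDerivAt_snd_of_pos hd hp haM hz).fun_neg.deriv,
      h.lowerOrder_fst hd (h.fst_pos hd hp ha hM z)]
    have : (d : ℝ) ≠ 0 := by positivity
    field_simp
    ring
  equation_classical z hz hne := by
    have hv : v z ≠ 0 := by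
      intro h'
      refine hne ?_
      simp only [h.deriv_fst hd, h', Real.zero_rpow (show 1 / (d : ℝ) ≠ 0 by positivity), neg_zero]
    have hv0 : 0 < v z := (h.snd_nonneg z).lt_of_ne' hv
    have hd0 : (d : ℝ) ≠ 0 := by positivity
    have hder := ((h.hasDerivAt_snd_of_pos hd hp haM hz).rpow_const (p := 1 / (d : ℝ))
      (Or.inl hv)).fun_neg
    rw [h.lowerOrder_fst hd (h.fst_pos hd hp ha hM z), h.deriv_fst hd]
    refine ⟨hder.differentiableAt, ?_⟩
    rw [hder.deriv, abs_neg, abs_of_nonneg (Real.rpow_nonneg hv0.le _)]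
    -- The degenerate factor `|f'| ^ (d - 1)` cancels the chain rule factor of `v ^ (1/d)`.
    have hg : (v z ^ (1 / (d : ℝ))) ^ (d - 1) * v z ^ (1 / (d : ℝ) - 1) = 1 := by
      rw [← Real.rpow_natCast, ← Real.rpow_mul hv0.le, ← Real.rpow_add hv0,
        Nat.cast_sub (by omega), Nat.cast_one]
      convert Real.rpow_zero (v z) using 2
      field_simp
      ring
    set W := beta d p * z * v z ^ (1 / (d : ℝ)) + reaction p (f z) with hW
    have : (v z ^ (1 / (d : ℝ))) ^ (d - 1) * (d * z ^ (d - 1) * W * (1 / d) * v z ^ (1 / (d : ℝ) - 1))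
        = z ^ (d - 1) * W := by
      calc _ = ((v z ^ (1 / (d : ℝ))) ^ (d - 1) * v z ^ (1 / (d : ℝ) - 1)) *
            (z ^ (d - 1) * W * (d * (1 / d))) := by ring
        _ = _ := by rw [hg, mul_one_div_cancel hd0]; ring
    rw [mul_neg, this]
    have hzd : z ^ (d - 1) ≠ 0 := (pow_pos hz _).ne'
    field_simp
    ring

theorem isEquivalent_fst {C : ℝ} (hC0 : 0 < C)
    (hC : Tendsto (fun z => f z * z ^ (2 * d / (p - d))) atTop (𝓝 C)) :
    f ~[atTop] (fun z => C * z ^ (-(2 * d) / (p - d))) := by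
  refine isEquivalent_of_tendsto_one ?_
  have := hC.div_const C
  rw [div_self hC0.ne'] at this
  refine this.congr' ?_
  filter_upwards [eventually_gt_atTop 0] with z hz
  have : 0 < z ^ (2 * d / (p - d)) := Real.rpow_pos_of_pos hz _
  rw [Pi.div_apply, neg_div, Real.rpow_neg hz.le]
  field_simp

/-- Bootstrap: where `f` and `v` are positive, all powers in the system are smooth, so each order of
regularity yields the next. -/
theorem contDiffOn_Ioi (h : IsLimitProfile d p a M f v) (hd : 2 ≤ d) (hp : (d : ℝ) < p)
    (ha : 0 ≤ a) (hM : 0 < M) (hv : ∀ z, a < z → 0 < v z) (n : ℕ) :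
    ContDiffOn ℝ n f (Ioi a) ∧ ContDiffOn ℝ n v (Ioi a) := by
  induction n with
  | zero =>
    exact ⟨contDiffOn_zero.2 h.continuous_fst.continuousOn,
      contDiffOn_zero.2 h.continuous_snd.continuousOn⟩
  | succ n ih =>
    have hg : ContDiffOn ℝ n (fun z => v z ^ (1 / (d : ℝ))) (Ioi a) :=
      ih.2.rpow_const_of_ne fun z hz => (hv z hz).ne'
    have hr : ContDiffOn ℝ n (fun z => reaction p (f z)) (Ioi a) :=
      (ih.1.rpow_const_of_ne fun z _ => (h.fst_pos hd hp ha hM z).ne').sub (ih.1.div_const _)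
    push_cast
    rw [contDiffOn_succ_iff_deriv_of_isOpen isOpen_Ioi,
      contDiffOn_succ_iff_deriv_of_isOpen isOpen_Ioi]
    refine ⟨⟨fun z hz => (h.hasDerivAt_fst z hz).differentiableAt.differentiableWithinAt,
      by simp, hg.neg.congr fun z hz => (h.hasDerivAt_fst z hz).deriv⟩,
      fun z hz => (h.hasDerivAt_snd z hz).differentiableAt.differentiableWithinAt, by simp,
      ContDiffOn.congr ?_ fun z hz => (h.hasDerivAt_snd z hz).deriv⟩
    exact (contDiffOn_const.mul (contDiffOn_id.pow _)).mul
      (((contDiffOn_const.mul contDiffOn_id).mul hg).add hr)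

end IsLimitProfile

/-! ### Self-similar solutions and their blow-up -/

section Scaling

variable {d : ℕ} {p T : ℝ} {f : ℝ → ℝ}

/-- Since `γ β = 1/(p - 1)`, the amplitude is absorbed into `z ^ γ`. Both the final profile and the
bound away from the origin become statements about `f z ^ γ`. -/
theorem similaritySolution_eq_mul_rpow (hd : 2 ≤ d) (hp : (d : ℝ) < p) {r t : ℝ} (hr : 0 < r)
    (ht : t < T) : similaritySolution d p T f r t =
      f (r / (T - t) ^ beta d p) * (r / (T - t) ^ beta d p) ^ (2 * d / (p - d)) *
        r ^ (-(2 * d) / (p - d)) := by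
  have hs : 0 < T - t := sub_pos.2 ht
  unfold similaritySolution
  rw [Real.div_rpow hr.le (Real.rpow_nonneg hs.le _), ← Real.rpow_mul hs.le,
    mul_comm (beta d p), decayExponent_mul_beta hd hp, neg_div, neg_div, Real.rpow_neg hs.le,
    Real.rpow_neg hr.le]
  have h1 : r ^ (2 * d / (p - d)) ≠ 0 := (Real.rpow_pos_of_pos hr _).ne'
  field_simp

theorem tendsto_similarityVariable (hd : 2 ≤ d) (hp : (d : ℝ) < p) {r : ℝ} (hr : 0 < r) :
    Tendsto (fun t => r / (T - t) ^ beta d p) (𝓝[<] T) atTop := by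
  have hβ := beta_pos hd hp
  have h1 : Tendsto (fun t => (T - t) ^ beta d p) (𝓝[<] T) (𝓝[>] 0) := by
    refine tendsto_nhdsWithin_iff.2 ⟨?_, ?_⟩
    · have : Continuous fun t => (T - t) ^ beta d p :=
        (continuous_const.sub continuous_id).rpow_const fun _ => Or.inr hβ.le
      have := this.tendsto T
      rw [sub_self, Real.zero_rpow hβ.ne'] at this
      exact this.mono_left nhdsWithin_le_nhds
    · filter_upwards [self_mem_nhdsWithin] with t ht
      exact Real.rpow_pos_of_pos (sub_pos.2 ht) _
  exact (tendsto_inv_nhdsGT_zero.comp h1).const_mul_atTop hr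

theorem tendsto_similaritySolution (hd : 2 ≤ d) (hp : (d : ℝ) < p) {C r : ℝ} (hr : 0 < r)
    (hC : Tendsto (fun z => f z * z ^ (2 * d / (p - d))) atTop (𝓝 C)) :
    Tendsto (fun t => similaritySolution d p T f r t) (𝓝[<] T)
      (𝓝 (C * r ^ (-(2 * d) / (p - d)))) := by
  refine ((hC.comp (tendsto_similarityVariable hd hp hr)).mul_const _).congr' ?_
  filter_upwards [self_mem_nhdsWithin] with t ht
  exact (similaritySolution_eq_mul_rpow hd hp hr ht).symm

/-- Away from the origin `u ≤ K r ^ (-γ)` uniformly in time; at the origin `u = (T - t) ^ (-1/(p-1))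
f 0` diverges. -/
theorem blowUpSet_similaritySolution (hd : 2 ≤ d) (hp : (d : ℝ) < p) {K : ℝ}
    (hf : ∀ z, 0 ≤ f z) (hf0 : 0 < f 0) (hK : ∀ z, 0 < z → f z * z ^ (2 * d / (p - d)) ≤ K) :
    blowUpSet d T (similaritySolution d p T f) = {0} := by
  have hp1 := one_lt_exponent hd hp
  have hpp : 0 < p - 1 := by linarith
  have hpd : 0 < p - d := by linarith
  ext x
  rw [mem_singleton_iff]
  constructor
  · rintro ⟨y, t, ht, hy, -, hu⟩
    by_contra hx
    have hx0 : 0 < ‖x‖ := norm_pos_iff.2 hx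
    have hev : ∀ᶠ n in atTop, ‖x‖ / 2 < ‖y n‖ := hy.norm.eventually_const_lt (by linarith)
    obtain ⟨n, hn, hn'⟩ := (hev.and (hu.eventually_gt_atTop
      (K * (‖x‖ / 2) ^ (-(2 * d) / (p - d))))).exists
    have hyn : 0 < ‖y n‖ := by linarith
    have hz : 0 < ‖y n‖ / (T - t n) ^ beta d p :=
      div_pos hyn (Real.rpow_pos_of_pos (sub_pos.2 (ht n)) _)
    rw [similaritySolution_eq_mul_rpow hd hp hyn (ht n)] at hn'
    have h1 := mul_nonneg (hf (‖y n‖ / (T - t n) ^ beta d p)) (Real.rpow_nonneg hz.le (2 * d / (p - d)))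
    rw [abs_of_nonneg (mul_nonneg h1 (Real.rpow_nonneg hyn.le _))] at hn'
    refine hn'.not_ge (mul_le_mul (hK _ hz) ?_ (Real.rpow_nonneg hyn.le _) (h1.trans (hK _ hz)))
    refine Real.rpow_le_rpow_of_nonpos (by linarith) hn.le ?_
    rw [neg_div]
    exact neg_nonpos.2 (by positivity)
  · rintro rfl
    have h0 : Tendsto (fun n : ℕ => T - 1 / ((n : ℝ) + 1)) atTop (𝓝 T) := by
      simpa using tendsto_const_nhds.sub (tendsto_one_div_add_atTop_nhds_zero_nat (𝕜 := ℝ))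
    refine ⟨fun _ => 0, fun n => T - 1 / ((n : ℝ) + 1), fun n => ?_, tendsto_const_nhds, h0, ?_⟩
    · have : 0 < 1 / ((n : ℝ) + 1) := by positivity
      linarith
    have h1 : Tendsto (fun n : ℕ => ((n : ℝ) + 1) ^ (1 / (p - 1)) * f 0) atTop atTop :=
      ((tendsto_rpow_atTop (by positivity)).comp
        (tendsto_natCast_atTop_atTop.atTop_add tendsto_const_nhds)).atTop_mul_const hf0
    refine h1.congr fun n => ?_
    have hn : 0 < (n : ℝ) + 1 := by positivity
    unfold similaritySolution
    rw [norm_zero, zero_div, sub_sub_cancel, abs_of_nonneg (by positivity), one_div (_ + _),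
      neg_div, Real.inv_rpow hn.le, Real.rpow_neg hn.le, inv_inv]

end Scaling

namespace IsLimitProfile

variable {d : ℕ} {p a M : ℝ} {f v : ℝ → ℝ}

theorem hasDerivAt_similaritySolution_space (h : IsLimitProfile d p a M f v) (hd : 2 ≤ d)
    (T t r : ℝ) : HasDerivAt (fun r => similaritySolution d p T f r t)
      (-((T - t) ^ (-1 / (p - 1)) / (T - t) ^ beta d p *
        v (r / (T - t) ^ beta d p) ^ (1 / (d : ℝ)))) r := by
  unfold similaritySolution
  have h1 := ((h.hasDerivAt_fst_all hd (r / (T - t) ^ beta d p)).comp r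
    ((hasDerivAt_id' r).div_const ((T - t) ^ beta d p))).const_mul ((T - t) ^ (-1 / (p - 1)))
  exact h1.congr_deriv (by ring)

theorem hasDerivAt_similaritySolution_time (h : IsLimitProfile d p a M f v) (hd : 2 ≤ d)
    {T t : ℝ} (ht : t < T) (r : ℝ) : HasDerivAt (fun t => similaritySolution d p T f r t)
      ((T - t) ^ (-1 / (p - 1)) / (T - t) * (f (r / (T - t) ^ beta d p) / (p - 1) -
        beta d p * (r / (T - t) ^ beta d p) * v (r / (T - t) ^ beta d p) ^ (1 / (d : ℝ)))) t := by
  have hs : 0 < T - t := sub_pos.2 ht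
  have h0 : HasDerivAt (fun t => T - t) (-1) t := by
    simpa using (hasDerivAt_const t T).fun_sub (hasDerivAt_id' t)
  have hA := h0.rpow_const (p := -1 / (p - 1)) (Or.inl hs.ne')
  have hL := h0.rpow_const (p := beta d p) (Or.inl hs.ne')
  have hL0 : (T - t) ^ beta d p ≠ 0 := (Real.rpow_pos_of_pos hs _).ne'
  have hy := ((hasDerivAt_const t r).fun_div hL hL0)
  unfold similaritySolution
  have h1 := hA.fun_mul ((h.hasDerivAt_fst_all hd (r / (T - t) ^ beta d p)).comp t hy)
  refine h1.congr_deriv ?_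
  rw [Real.rpow_sub_one hs.ne', Real.rpow_sub_one hs.ne']
  simp only [Function.comp_apply]
  field_simp
  ring

theorem isRadialSolution (h : IsLimitProfile d p a M f v) (hd : 2 ≤ d) (hp : (d : ℝ) < p)
    (ha : 0 ≤ a) (hM : 0 < M) (haM : a = 0 ∨ M = equilibrium p) (T : ℝ) :
    IsRadialSolution d p T (similaritySolution d p T f) := by
  have hflux : ∀ r t, 0 < r → t < T →
      HasDerivAt (fun ρ => deriv (fun s => similaritySolution d p T f s t) ρ ^ d)
        ((-1) ^ d * ((T - t) ^ (-1 / (p - 1)) / (T - t) ^ beta d p) ^ d *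
          (d * (r / (T - t) ^ beta d p) ^ (d - 1) * (beta d p * (r / (T - t) ^ beta d p) *
            v (r / (T - t) ^ beta d p) ^ (1 / (d : ℝ)) +
              reaction p (f (r / (T - t) ^ beta d p))) / (T - t) ^ beta d p)) r := by
    intro r t hr ht
    have hL : 0 < (T - t) ^ beta d p := Real.rpow_pos_of_pos (sub_pos.2 ht) _
    have h1 := ((h.hasDerivAt_snd_of_pos hd hp haM (div_pos hr hL)).comp r
      ((hasDerivAt_id' r).div_const ((T - t) ^ beta d p))).const_mul
        ((-1) ^ d * ((T - t) ^ (-1 / (p - 1)) / (T - t) ^ beta d p) ^ d)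
    refine (h1.congr_deriv (by rw [mul_one_div])).congr_of_eventuallyEq (.of_forall fun ρ => ?_)
    beta_reduce
    rw [(h.hasDerivAt_similaritySolution_space hd T t ρ).deriv, neg_pow, mul_pow, h.root_pow hd,
      Function.comp_apply, mul_assoc]
  refine ⟨fun t _ => ?_, fun r t _ _ => ?_, fun r t hr ht => ?_, fun r t _ ht => ?_,
    fun r t hr ht => (hflux r t hr ht).differentiableAt, fun r t hr ht => ?_⟩
  · have := h.hasDerivAt_similaritySolution_space hd T t 0
    rw [zero_div, h.snd_eq 0 ha, Real.zero_rpow (by positivity), mul_zero, neg_zero] at this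
    exact this.hasDerivWithinAt
  · exact (h.hasDerivAt_similaritySolution_space hd T t r).differentiableAt
  · rw [(h.hasDerivAt_similaritySolution_space hd T t r).deriv]
    have hs : 0 < T - t := sub_pos.2 ht
    exact neg_nonpos.2 (mul_nonneg (by positivity) (Real.rpow_nonneg (h.snd_nonneg _) _))
  · exact (h.hasDerivAt_similaritySolution_time hd ht r).differentiableAt
  · have hs : 0 < T - t := sub_pos.2 ht
    have hp1 := one_lt_exponent hd hp
    have hpp : p - 1 ≠ 0 := by linarith
    have hf := h.fst_pos hd hp ha hM (r / (T - t) ^ beta d p)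
    rw [(h.hasDerivAt_similaritySolution_time hd ht r).deriv, (hflux r t hr ht).deriv]
    have hL : 0 < (T - t) ^ beta d p := Real.rpow_pos_of_pos hs _
    have hA : 0 < (T - t) ^ (-1 / (p - 1)) := Real.rpow_pos_of_pos hs _
    have hAp : ((T - t) ^ (-1 / (p - 1))) ^ p = (T - t) ^ (-1 / (p - 1)) / (T - t) := by
      rw [← Real.rpow_mul hs.le, ← Real.rpow_sub_one hs.ne']
      congr 1
      field_simp
      ring
    -- This identity expresses the choice of `β`: diffusion scales like `u_t` precisely because `2dβ
    -- = (p - d)/(p - 1)`.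
    have hAd : ((T - t) ^ (-1 / (p - 1))) ^ d =
        (T - t) ^ (-1 / (p - 1)) / (T - t) * ((T - t) ^ beta d p) ^ (2 * d) := by
      rw [← Real.rpow_sub_one hs.ne', ← Real.rpow_natCast, ← Real.rpow_natCast,
        ← Real.rpow_mul hs.le, ← Real.rpow_mul hs.le, ← Real.rpow_add hs]
      congr 1
      have hd0 : (d : ℝ) ≠ 0 := by positivity
      unfold beta
      push_cast
      field_simp
      ring
    have hu : |similaritySolution d p T f r t| ^ (p - 1) * similaritySolution d p T f r t =
        (T - t) ^ (-1 / (p - 1)) / (T - t) * f (r / (T - t) ^ beta d p) ^ p := by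
      unfold similaritySolution
      rw [abs_rpow_sub_one_mul_self (mul_pos hA hf), Real.mul_rpow hA.le hf.le, hAp]
    rw [hu]
    obtain ⟨k, rfl⟩ : ∃ k, d = k + 1 := ⟨d - 1, by omega⟩
    rw [div_pow, hAd]
    generalize (T - t) ^ (-1 / (p - 1)) / (T - t) = S at *
    generalize (T - t) ^ beta (k + 1) p = L at *
    unfold reaction
    rw [Nat.add_sub_cancel]
    have hk : ((-1 : ℝ) ^ k) * (-1) ^ (k + 1) = -1 := by
      rw [← pow_add, ← add_assoc, pow_succ, ← two_mul, pow_mul]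
      norm_num
    have hk0 : ((k + 1 : ℕ) : ℝ) ≠ 0 := by positivity
    generalize v (r / L) ^ (1 / ((k + 1 : ℕ) : ℝ)) = g
    generalize f (r / L) ^ p = w
    generalize f (r / L) = φ
    generalize beta (k + 1) p = b
    generalize ((k + 1 : ℕ) : ℝ) = D at hk0 ⊢
    have e1 : ((-1 : ℝ) ^ k) * (1 / r ^ k) * ((-1) ^ (k + 1) * (S * L ^ (2 * (k + 1)) / L ^ (k + 1)) *
        (D * (r / L) ^ k * (b * (r / L) * g + (w - φ / (p - 1))) / L) / D) =
        ((-1 : ℝ) ^ k) * (-1) ^ (k + 1) * (S * (b * (r / L) * g + (w - φ / (p - 1)))) := by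
      rw [div_pow, two_mul, pow_add L, pow_succ L]
      field_simp
    rw [e1, hk]
    ring

theorem givesSinglePointBlowUp (h : IsLimitProfile d p a M f v) (hd : 2 ≤ d) (hp : (d : ℝ) < p)
    (ha : 0 ≤ a) (hM : 0 < M) (haM : a = 0 ∨ M = equilibrium p) {C K : ℝ}
    (hC : Tendsto (fun z => f z * z ^ (2 * d / (p - d))) atTop (𝓝 C))
    (hK : ∀ z, 0 < z → f z * z ^ (2 * d / (p - d)) ≤ K) : GivesSinglePointBlowUp d p f C where
  solution := h.isRadialSolution hd hp ha hM haM
  blowUpSet_eq _ := blowUpSet_similaritySolution hd hp h.fst_nonneg (h.fst_pos hd hp ha hM 0) hK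
  final_profile _ _ hr := tendsto_similaritySolution hd hp hr hC

end IsLimitProfile

/-! ### Behaviour at the interface and nontriviality -/

namespace IsLimitProfile

variable {d : ℕ} {p a M : ℝ} {f v : ℝ → ℝ}

theorem sub_fst_le (h : IsLimitProfile d p a M f v) (hd : 2 ≤ d) {z : ℝ} (hz : a ≤ z)
    (hm : MonotoneOn v (Icc a z)) : M - f z ≤ v z ^ (1 / (d : ℝ)) * (z - a) := by
  have := le_sub_of_hasDerivAt (c := -(v z ^ (1 / (d : ℝ)))) hz
    (fun x _ => h.hasDerivAt_fst_all hd x) (fun x hx =>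
      neg_le_neg (Real.rpow_le_rpow (h.snd_nonneg x)
        (hm (Ioo_subset_Icc_self hx) (right_mem_Icc.2 hz) hx.2.le) (by positivity)))
  rw [h.fst_eq a le_rfl] at this
  linarith

/-- The derivative is `(d-1) z ^ (d-1) (β z + h(f)/g)` with `g = v ^ (1/d)`. Here `|h(f)| ≤ C (f₀ -
f) ≤ C g (z - a)`, so the quotient tends to zero. -/
theorem tendsto_deriv_snd_rpow (h : IsLimitProfile d p a (equilibrium p) f v) (hd : 2 ≤ d)
    (hp : (d : ℝ) < p) {b : ℝ} (hb : a < b) (hm : MonotoneOn v (Icc a b))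
    (hv : ∀ z, a < z → 0 < v z) :
    Tendsto (deriv fun z => v z ^ (1 - 1 / (d : ℝ))) (𝓝[>] a)
      (𝓝 (((d : ℝ) - 1) * beta d p * a ^ d)) := by
  have hp1 := one_lt_exponent hd hp
  have hd0 : (d : ℝ) ≠ 0 := by positivity
  obtain ⟨C, hC0, hC⟩ := exists_lipschitz_reaction hp1 (equilibrium p)
  have hR : Tendsto (fun z => reaction p (f z) / v z ^ (1 / (d : ℝ))) (𝓝[>] a) (𝓝 0) := by
    refine squeeze_zero_norm' (a := fun z => C * (z - a)) ?_ ?_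
    · filter_upwards [Ioo_mem_nhdsGT hb] with z hz
      have hg : 0 < v z ^ (1 / (d : ℝ)) := Real.rpow_pos_of_pos (hv z hz.1) _
      have h1 := hC (f z) ⟨h.fst_nonneg z, h.fst_le z⟩ (equilibrium p)
        ⟨(equilibrium_pos hp1).le, le_rfl⟩
      rw [reaction_equilibrium hp1, sub_zero, abs_sub_comm (f z),
        abs_of_nonneg (sub_nonneg.2 (h.fst_le z))] at h1
      have h2 := h.sub_fst_le hd hz.1.le (hm.mono (Icc_subset_Icc_right hz.2.le))
      rw [Real.norm_eq_abs, abs_div, abs_of_pos hg, div_le_iff₀ hg]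
      calc _ ≤ C * (equilibrium p - f z) := h1
        _ ≤ C * (v z ^ (1 / (d : ℝ)) * (z - a)) := by gcongr
        _ = _ := by ring
    · have : Continuous fun z : ℝ => C * (z - a) := by fun_prop
      have := this.tendsto a
      rw [sub_self, mul_zero] at this
      exact this.mono_left nhdsWithin_le_nhds
  have hpoly : Tendsto (fun z : ℝ => ((d : ℝ) - 1) * z ^ (d - 1)) (𝓝[>] a)
      (𝓝 (((d : ℝ) - 1) * a ^ (d - 1))) := by
    have : Continuous fun z : ℝ => ((d : ℝ) - 1) * z ^ (d - 1) := by fun_prop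
    exact (this.tendsto a).mono_left nhdsWithin_le_nhds
  have hlin : Tendsto (fun z : ℝ => beta d p * z) (𝓝[>] a) (𝓝 (beta d p * a)) := by
    have : Continuous fun z : ℝ => beta d p * z := by fun_prop
    exact (this.tendsto a).mono_left nhdsWithin_le_nhds
  have hlim := hpoly.mul (hlin.add hR)
  have e : ((d : ℝ) - 1) * a ^ (d - 1) * (beta d p * a + 0) =
      ((d : ℝ) - 1) * beta d p * a ^ d := by
    rw [← pow_sub_one_mul (show d ≠ 0 by omega) a]
    ring
  rw [e] at hlim
  refine hlim.congr' ?_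
  filter_upwards [self_mem_nhdsWithin] with z hz
  have hvz := hv z hz
  have hg : 0 < v z ^ (1 / (d : ℝ)) := Real.rpow_pos_of_pos hvz _
  rw [((h.hasDerivAt_snd z hz).rpow_const (p := 1 - 1 / (d : ℝ)) (Or.inl hvz.ne')).deriv,
    show 1 - 1 / (d : ℝ) - 1 = -(1 / (d : ℝ)) by ring, Real.rpow_neg hvz.le]
  field_simp

/-- The limit of the derivative gives `v ^ (1 - 1/d) ~ m (z - a)`, so `-f' ~ (m (z - a)) ^
(1/(d-1))`; L'Hôpital's rule integrates this. To the left of `a` both sides vanish. -/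
theorem isEquivalent_interface (h : IsLimitProfile d p a (equilibrium p) f v) (hd : 2 ≤ d)
    (hp : (d : ℝ) < p) (ha : 0 < a) {b : ℝ} (hb : a < b) (hm : MonotoneOn v (Icc a b))
    (hv : ∀ z, a < z → 0 < v z) :
    (fun z => equilibrium p - f z) ~[𝓝 a]
      (fun z => interfaceCoeff d p a * (max (z - a) 0) ^ ((d : ℝ) / ((d : ℝ) - 1))) := by
  have hβ := beta_pos hd hp
  have hd2 : (2 : ℝ) ≤ d := by exact_mod_cast hd
  have hd1 : 0 < (d : ℝ) - 1 := by linarith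
  have hd0 : 0 < (d : ℝ) := by linarith
  have hq : 0 < 1 - 1 / (d : ℝ) := by
    rw [sub_pos, div_lt_one hd0]
    linarith
  set m := ((d : ℝ) - 1) * beta d p * a ^ d with hm_def
  set s := (d : ℝ) / ((d : ℝ) - 1) with hs
  have hs1 : s - 1 = 1 / ((d : ℝ) - 1) := by
    rw [hs]
    field_simp
    ring
  have hs0 : 0 < s := by positivity
  have hc : 0 < interfaceCoeff d p a := by
    unfold interfaceCoeff
    positivity
  have hy : HasDerivWithinAt (fun z => v z ^ (1 - 1 / (d : ℝ))) m (Ici a) a := by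
    refine hasDerivWithinAt_Ici_of_tendsto_deriv (s := Ioi a) (fun z hz => ?_) ?_
      self_mem_nhdsWithin (h.tendsto_deriv_snd_rpow hd hp hb hm hv)
    · exact ((h.hasDerivAt_snd z hz).rpow_const
        (Or.inl (hv z hz).ne')).differentiableAt.differentiableWithinAt
    · exact (h.continuous_snd.rpow_const fun _ => Or.inr hq.le).continuousWithinAt
  have hy' : Tendsto (fun z => v z ^ (1 - 1 / (d : ℝ)) / (z - a)) (𝓝[>] a) (𝓝 m) := by
    rw [hasDerivWithinAt_iff_tendsto_slope, Ici_sdiff_left] at hy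
    refine hy.congr fun z => ?_
    rw [slope_def_field, h.snd_eq a le_rfl, Real.zero_rpow hq.ne', sub_zero]
  have hg : Tendsto (fun z => v z ^ (1 / (d : ℝ)) / (s * (z - a) ^ (s - 1))) (𝓝[>] a)
      (𝓝 (interfaceCoeff d p a)) := by
    have h1 := (hy'.rpow_const (p := 1 / ((d : ℝ) - 1)) (Or.inr (by positivity))).const_mul s⁻¹
    have e : s⁻¹ * m ^ (1 / ((d : ℝ) - 1)) = interfaceCoeff d p a := by
      rw [hs, inv_div]
      rfl
    rw [e] at h1
    refine h1.congr' ?_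
    filter_upwards [self_mem_nhdsWithin] with z hz
    have hza : 0 < z - a := sub_pos.2 hz
    rw [Real.div_rpow (Real.rpow_nonneg (h.snd_nonneg z) _) hza.le, ← Real.rpow_mul (h.snd_nonneg z),
      hs1]
    have : (1 - 1 / (d : ℝ)) * (1 / ((d : ℝ) - 1)) = 1 / d := by
      field_simp
    rw [this, inv_mul_eq_div, div_div, mul_comm s]
  have hlim : Tendsto (fun z => (equilibrium p - f z) / (z - a) ^ s) (𝓝[>] a)
      (𝓝 (interfaceCoeff d p a)) := by
    refine HasDerivAt.lhopital_zero_nhdsGT (f' := fun z => v z ^ (1 / (d : ℝ)))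
      (g' := fun z => s * (z - a) ^ (s - 1)) ?_ ?_ ?_ ?_ ?_ hg
    · refine .of_forall fun z => ?_
      simpa using (hasDerivAt_const z (equilibrium p)).fun_sub (h.hasDerivAt_fst_all hd z)
    · filter_upwards [self_mem_nhdsWithin] with z hz
      have := ((hasDerivAt_id' z).sub_const a).rpow_const (p := s) (Or.inl (sub_pos.2 hz).ne')
      simpa using this
    · filter_upwards [self_mem_nhdsWithin] with z hz
      exact (mul_pos hs0 (Real.rpow_pos_of_pos (sub_pos.2 hz) _)).ne'
    · have := (continuous_const.sub h.continuous_fst).tendsto (f := fun z => equilibrium p - f z) a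
      rw [h.fst_eq a le_rfl, sub_self] at this
      exact this.mono_left nhdsWithin_le_nhds
    · have : Continuous fun z : ℝ => (z - a) ^ s :=
        (continuous_id.sub continuous_const).rpow_const fun _ => Or.inr hs0.le
      have := this.tendsto a
      rw [sub_self, Real.zero_rpow hs0.ne'] at this
      exact this.mono_left nhdsWithin_le_nhds
  rw [← nhdsLE_sup_nhdsGT a]
  refine IsLittleO.sup ?_ ?_
  · refine (isLittleO_zero _ _).congr' ?_ .rfl
    filter_upwards [self_mem_nhdsWithin] with z (hz : z ≤ a)
    rw [Pi.sub_apply, h.fst_eq z hz, max_eq_right (sub_nonpos.2 hz), Real.zero_rpow hs0.ne']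
    simp
  · refine isEquivalent_of_tendsto_one ?_
    have := hlim.div_const (interfaceCoeff d p a)
    rw [div_self hc.ne'] at this
    refine this.congr' ?_
    filter_upwards [self_mem_nhdsWithin] with z hz
    rw [Pi.div_apply, max_eq_left (sub_pos.2 hz).le, div_div, mul_comm]

/-- If `v` vanished near the origin, `f` would equal `M` there and the positive reaction at `M`
would give `v' > 0`. -/
theorem exists_snd_ne_zero_of_equilibrium_lt (h : IsLimitProfile d p 0 M f v) (hd : 2 ≤ d)
    (hp : (d : ℝ) < p) (hM : equilibrium p < M) {z : ℝ} (hz : 0 < z) :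
    ∃ y ∈ Icc 0 z, v y ≠ 0 := by
  by_contra! hno
  have hp1 := one_lt_exponent hd hp
  have hq : (1 / (d : ℝ)) ≠ 0 := by positivity
  have hfM : f (z / 2) = M := by
    have hm : MonotoneOn v (Icc 0 (z / 2)) := fun x hx y hy _ => by
      rw [hno x ⟨hx.1, by linarith [hx.2]⟩, hno y ⟨hy.1, by linarith [hy.2]⟩]
    have h1 := h.sub_fst_le hd (by positivity) hm
    rw [hno _ ⟨by positivity, by linarith⟩, Real.zero_rpow hq, zero_mul] at h1
    linarith [h.fst_le (z / 2)]
  have h1 := h.hasDerivAt_snd (z / 2) (by positivity)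
  have h2 : HasDerivAt v 0 (z / 2) := (hasDerivAt_const (z / 2) 0).congr_of_eventuallyEq <| by
    filter_upwards [Icc_mem_nhds (show 0 < z / 2 by positivity) (show z / 2 < z by linarith)]
      with x hx using hno x hx
  have h3 := h1.unique h2
  rw [hno _ ⟨by positivity, by linarith⟩, Real.zero_rpow hq, hfM, mul_zero, zero_add] at h3
  have h4 := sub_equilibrium_le_reaction hp1 ((equilibrium_pos hp1).le.trans hM.le)
  have h5 : 0 < d * (z / 2) ^ (d - 1) * reaction p M :=
    mul_pos (by positivity) (by linarith)
  exact h5.ne' h3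

end IsLimitProfile

/-! ### Existence of both profiles -/

variable {d : ℕ} {p : ℝ}

theorem exists_limitProfile_height (hd : 2 ≤ d) (hp : (d : ℝ) < p) :
    ∃ M f v, equilibrium p < M ∧ IsLimitProfile d p 0 M f v ∧ ∀ z, 0 < z → 0 < v z := by
  have hp1 := one_lt_exponent hd hp
  obtain ⟨M₁, M₂, hM₁, hev⟩ := exists_approximation_height hd hp
  obtain ⟨M, hM⟩ := Filter.skolem.1 hev
  obtain ⟨f, hf⟩ := Filter.skolem.1 (hM.mono fun n hn => ⟨hn.2.choose, hn.1, hn.2.choose_spec⟩ :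
    ∀ᶠ n : ℕ in atTop, ∃ f : ℝ → ℝ, M n ∈ Icc M₁ M₂ ∧
      ∃ v : ℝ → ℝ, IsApproximation d p M₂ 0 (M n) n f v)
  obtain ⟨v, hv⟩ := Filter.skolem.1 (hf.mono fun n hn => ⟨hn.2.choose, hn.1, hn.2.choose_spec⟩ :
    ∀ᶠ n : ℕ in atTop, ∃ v : ℝ → ℝ, M n ∈ Icc M₁ M₂ ∧ IsApproximation d p M₂ 0 (M n) n (f n) v)
  obtain ⟨n, hn⟩ := hv.exists
  obtain ⟨U, hU, hUtop, a₀, M₀, F, V, ha, hMt, -, hF⟩ := exists_limitProfile (a := fun _ => 0) hd hp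
    (hM₁.le.trans (hn.1.1.trans hn.1.2)) le_rfl
    (hv.mono fun n hn => ⟨⟨le_rfl, le_rfl⟩, ⟨hM₁.le.trans hn.1.1, hn.1.2⟩, hn.2⟩)
  obtain rfl : 0 = a₀ := tendsto_nhds_unique tendsto_const_nhds ha
  have hM₀ : equilibrium p < M₀ :=
    hM₁.trans_le (ge_of_tendsto hMt (hUtop (hv.mono fun n hn => hn.1.1)))
  exact ⟨M₀, F, V, hM₀, hF, fun z hz => hF.snd_pos hd hp le_rfl ((equilibrium_pos hp1).trans hM₀)
    (fun z hz => hF.exists_snd_ne_zero_of_equilibrium_lt hd hp hM₀ hz) hz⟩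

theorem exists_limitProfile_interface (hd : 2 ≤ d) (hp : (d : ℝ) < p) :
    ∃ a f v, 0 < a ∧ IsLimitProfile d p a (equilibrium p) f v ∧ (∀ z, a < z → 0 < v z) ∧
      ∃ b > a, MonotoneOn v (Icc a b) := by
  have hp1 := one_lt_exponent hd hp
  have hβ := beta_pos hd hp
  have he := equilibrium_pos hp1
  have hd2 : (2 : ℝ) ≤ d := by exact_mod_cast hd
  have hd1 : 0 < (d : ℝ) - 1 := by linarith
  obtain ⟨a₁, a₂, ha₁, hev⟩ := exists_approximation_interface hd hp
  obtain ⟨a, ha⟩ := Filter.skolem.1 hev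
  obtain ⟨f, hf⟩ := Filter.skolem.1 (ha.mono fun n hn => ⟨hn.2.choose, hn.1, hn.2.choose_spec⟩ :
    ∀ᶠ n : ℕ in atTop, ∃ f : ℝ → ℝ, a n ∈ Icc a₁ a₂ ∧
      ∃ v : ℝ → ℝ, IsApproximation d p (equilibrium p) (a n) (equilibrium p) n f v)
  obtain ⟨v, hv⟩ := Filter.skolem.1 (hf.mono fun n hn => ⟨hn.2.choose, hn.1, hn.2.choose_spec⟩ :
    ∀ᶠ n : ℕ in atTop, ∃ v : ℝ → ℝ, a n ∈ Icc a₁ a₂ ∧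
      IsApproximation d p (equilibrium p) (a n) (equilibrium p) n (f n) v)
  obtain ⟨n, hn⟩ := hv.exists
  obtain ⟨U, hU, hUtop, a₀, M₀, F, V, hat, hMt, hV, hF⟩ :=
    exists_limitProfile (M := fun _ => equilibrium p) hd hp le_rfl
      (ha₁.le.trans (hn.1.1.trans hn.1.2))
      (hv.mono fun n hn => ⟨⟨ha₁.le.trans hn.1.1, hn.1.2⟩, ⟨le_rfl, le_rfl⟩, hn.2⟩)
  obtain rfl : equilibrium p = M₀ := tendsto_nhds_unique tendsto_const_nhds hMt
  have ha₀ : 0 < a₀ := ha₁.trans_le (ge_of_tendsto hat (hUtop (hv.mono fun n hn => hn.1.1)))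
  -- The constant `f₀` with `v = 0` also satisfies the limit system, so nontriviality must come from
  -- the approximations: the interface bound is independent of `n` and passes to the limit.
  have hlow : ∀ τ, 0 ≤ τ → τ < beta d p / 2 * a₀ →
      (d - 1) * (beta d p / 2) * a₀ ^ d * τ ≤ V (a₀ + τ) ^ (1 - 1 / (d : ℝ)) := by
    intro τ hτ hτa
    have hq : 0 ≤ 1 - 1 / (d : ℝ) := by
      rw [sub_nonneg, div_le_one (by linarith)]
      linarith
    refine le_of_tendsto_of_tendsto (((hat.pow d).const_mul _).mul_const τ)
      ((hV τ hτ).rpow_const (Or.inr hq)) ?_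
    filter_upwards [hUtop hv, hUtop (tendsto_natCast_atTop_atTop.eventually_ge_atTop τ),
      (hat.const_mul (beta d p / 2)).eventually_const_lt hτa] with n hn hτn hτa'
    have han : 0 < a n := ha₁.trans_le hn.1.1
    have := hn.2.1.interface_le hd hp (regParam_pos n) han le_rfl hn.2.2.1 hn.2.2.2.1
      (z := a n + τ) ⟨by linarith, by linarith⟩ (by linarith)
    rwa [add_sub_cancel_left] at this
  have hmono : MonotoneOn V (Icc a₀ (a₀ + beta d p / 2 * a₀)) := by
    intro x hx y hy hxy
    have hlim : ∀ w ∈ Icc a₀ (a₀ + beta d p / 2 * a₀),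
        Tendsto (fun n => v n (a n + (w - a₀))) U (𝓝 (V w)) := fun w hw => by
      simpa using hV (w - a₀) (sub_nonneg.2 hw.1)
    refine le_of_tendsto_of_tendsto (hlim x hx) (hlim y hy) ?_
    have hya : y - a₀ < beta d p * a₀ := by nlinarith [hy.2, mul_pos hβ ha₀]
    filter_upwards [hUtop hv, hUtop (tendsto_natCast_atTop_atTop.eventually_ge_atTop (y - a₀)),
      (hat.const_mul (beta d p)).eventually_const_lt hya] with n hn hyn hya'
    have han : 0 < a n := ha₁.trans_le hn.1.1
    have := (hn.2.1.mono le_rfl (by linarith : a n + (y - a₀) ≤ a n + n)).monotoneOn_after_equilibrium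
      hd hp (regParam_pos n) han le_rfl hn.2.2.1 (hn.2.2.2.1 ▸ regParam_pos n) (by linarith)
    exact this ⟨by linarith [hx.1], by linarith⟩ ⟨by linarith [hy.1], le_rfl⟩ (by linarith)
  refine ⟨a₀, F, V, ha₀, hF, fun z hz => hF.snd_pos hd hp ha₀.le he (fun z hz => ?_) hz,
    a₀ + beta d p / 2 * a₀, by simp; positivity, hmono⟩
  set τ := min (z - a₀) (beta d p / 4 * a₀) with hτ
  have hτ0 : 0 < τ := lt_min (sub_pos.2 hz) (by positivity)
  refine ⟨a₀ + τ, ⟨by linarith, by linarith [min_le_left (z - a₀) (beta d p / 4 * a₀)]⟩, fun h0 => ?_⟩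
  have h1 := hlow τ hτ0.le
    ((min_le_right _ _).trans_lt (by nlinarith [mul_pos hβ ha₀]))
  have hq : 1 - 1 / (d : ℝ) ≠ 0 := by
    rw [sub_ne_zero, ne_comm, Ne, div_eq_one_iff_eq (by linarith)]
    linarith
  rw [h0, Real.zero_rpow hq] at h1
  have : 0 < (d - 1) * (beta d p / 2) * a₀ ^ d * τ := by positivity
  linarith

end MongeAmpere

theorem proposition2p2 (d : ℕ) (hd : 2 ≤ d) (p : ℝ) (hp : (d : ℝ) < p) :
    ∃ FP FQ : ℝ → ℝ, ∃ CP CQ a₀ : ℝ,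
      -- the P-type profile
      (MongeAmpere.IsProfile d p FP ∧
        (∀ z, 0 ≤ z → 0 < FP z) ∧
        0 < CP ∧ FP ~[atTop] (fun z => CP * z ^ (-(2 * d) / (p - d))) ∧
        (∀ z, 0 < z → deriv FP z < 0) ∧
        MongeAmpere.equilibrium p < FP 0 ∧
        MongeAmpere.GivesSinglePointBlowUp d p FP CP) ∧
      -- the Q-type profile
      (MongeAmpere.IsProfile d p FQ ∧
        (∀ z, 0 ≤ z → 0 < FQ z) ∧
        0 < CQ ∧ FQ ~[atTop] (fun z => CQ * z ^ (-(2 * d) / (p - d))) ∧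
        0 < a₀ ∧ (∀ z ∈ Icc 0 a₀, FQ z = MongeAmpere.equilibrium p) ∧
        (fun z => MongeAmpere.equilibrium p - FQ z) ~[𝓝 a₀]
          (fun z => MongeAmpere.interfaceCoeff d p a₀ *
            (max (z - a₀) 0) ^ ((d : ℝ) / ((d : ℝ) - 1))) ∧
        (∀ z, a₀ < z → deriv FQ z < 0) ∧
        ContDiffOn ℝ ((⊤ : ℕ∞) : WithTop ℕ∞) FQ (Ioi a₀) ∧
        MongeAmpere.GivesSinglePointBlowUp d p FQ CQ) := by
  have hp1 := MongeAmpere.one_lt_exponent hd hp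
  have he := MongeAmpere.equilibrium_pos hp1
  have hγ : 0 < 2 * (d : ℝ) / (p - d) := div_pos (by positivity) (by linarith)
  obtain ⟨M, FP, VP, hM, hFP, hVP⟩ := MongeAmpere.exists_limitProfile_height hd hp
  obtain ⟨a, FQ, VQ, ha, hFQ, hVQ, b, hb, hmono⟩ :=
    MongeAmpere.exists_limitProfile_interface hd hp
  have hM0 := he.trans hM
  obtain ⟨CP, hCP, hlimP, KP, hKP⟩ := hFP.exists_asymptotics hd hp le_rfl hM0 hVP
  obtain ⟨CQ, hCQ, hlimQ, KQ, hKQ⟩ := hFQ.exists_asymptotics hd hp ha.le he hVQ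
  refine ⟨FP, FQ, CP, CQ, a, ⟨hFP.isProfile hd hp le_rfl hM0 (Or.inl rfl)
      (MongeAmpere.IsLimitProfile.tendsto_fst hγ hlimP),
      fun z _ => hFP.fst_pos hd hp le_rfl hM0 z, hCP,
      MongeAmpere.IsLimitProfile.isEquivalent_fst hCP hlimP, fun z hz => ?_, ?_,
      hFP.givesSinglePointBlowUp hd hp le_rfl hM0 (Or.inl rfl) hlimP hKP⟩,
    ⟨hFQ.isProfile hd hp ha.le he (Or.inr rfl)
      (MongeAmpere.IsLimitProfile.tendsto_fst hγ hlimQ),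
      fun z _ => hFQ.fst_pos hd hp ha.le he z, hCQ,
      MongeAmpere.IsLimitProfile.isEquivalent_fst hCQ hlimQ, ha, fun z hz => hFQ.fst_eq z hz.2,
      hFQ.isEquivalent_interface hd hp ha hb hmono hVQ, fun z hz => ?_,
      contDiffOn_infty.2 fun n => (hFQ.contDiffOn_Ioi hd hp ha.le he hVQ n).1,
      hFQ.givesSinglePointBlowUp hd hp ha.le he (Or.inr rfl) hlimQ hKQ⟩⟩
  · rw [hFP.deriv_fst hd]
    exact neg_neg_of_pos (Real.rpow_pos_of_pos (hVP z hz) _)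
  · rwa [hFP.fst_eq 0 le_rfl]
  · rw [hFQ.deriv_fst hd]
    exact neg_neg_of_pos (Real.rpow_pos_of_pos (hVQ z hz) _)
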